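/- **Setting.** For $c\in(0,1)$ and $\alpha\in(0,1)$ put $\ell=\sqrt{1-c^2}$, $a=\ell-10\alpha/c$, $b=\ell+\alpha+10\alpha/c$, and let $W_{\alpha,c}$ be the probability distribution on $[a,b]$ whose density is the trapezoid that rises linearly from $0$ to $H=2/(b-a+\alpha)$ on $[a,\ell]$, equals $H$ on $[\ell,\ell+\alpha]$, and decreases linearly to $0$ on $[\ell+\alpha,b]$. For $M\subset[n]$ with $|M|=m$ let $\mathcal N_{n,M}$ be the distribution of a vector in $\mathbb R^n$ with independent $\mathcal N(0,1/m)$ entries on $M$ and zero entries outside $M$. *Attack.* Given $A\in\mathbb R^{k\times n}$, $h\in[n]$ and $M\subset[n]\setminus\{h\}$, in each step $t=1,\dots,r$ the attacker draws independently $w^{(t)}\sim W_{\alpha,c}$ and $z^{(t)}\sim\mathcal N_{n,M}$ and queries $v^{(t)}=w^{(t)}e_h+c\,z^{(t)}$; a responder returns $s^{(t)}\in\{-1,1\}$. The responder may depend on all parameters and on $A,h,M$; its response in step $t$ is an arbitrary measurable function of the sketch $Av^{(t)}$, of $(w^{(j)},z^{(j)})_{j<t}$ (hence also of its own earlier responses),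 and of a private random seed independent of all queries. The output is $z^{(\mathrm{adv})}=\sum_t s^{(t)}z^{(t)}\big/\big\|\sum_t s^{(t)}z^{(t)}\big\|_2$. *Errors.* The response $s^{(t)}$ is wrong for the $(1,\alpha)$-gap problem on the norm if $\|v^{(t)}\|_2\le 1$ and $s^{(t)}=1$, or if $\|v^{(t)}\|_2\ge 1+\alpha$ and $s^{(t)}=-1$. *Adversarial noise.* The optimal estimator $T=T_{h,M}:\mathbb R^k\to\mathbb R$ is the continuous unbiased, complete and sufficient statistic for the parameter $w\in\mathbb R$ based on the sketch $A(we_h+cz)$, $z\sim\mathcal N_{n,M}$. A unit vector $u$ supported on $M$ is $\gamma$-adversarial for $A,h,M$ if $T_{h,M}$ exists and $|T_{h,M}(A(we_h+u))-w|>\gamma$ for all $w\in\mathbb R$. **Theorem.** There is $c_0\in(0,1)$ such that for every $c\in(0,c_0]$ there are constants $C,K>0$ and, for each $\alpha\in(0,1)$, a constant $\delta(\alpha)>0$ (all depending only on $c$, and $\delta$ also on $\alpha$) with the following property. Let $k\ge2$, $\gamma\ge1$, $\alpha\in(0,1)$, $K\gamma^2k^2\le m<n$, let $A\in\mathbb R^{k\times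 n}$ be any matrix, consider any responder as above, and let $$r=\left\lceil C\,\gamma^2\alpha^{-2}k^2\log^2k\right\rceil .$$ Choose $h\in[n]$ uniformly at random, then an $m$-element set $M\subset[n]\setminus\{h\}$ uniformly at random, and run the attack with $r$ queries. Then with probability at least $0.9$ (over $h$, $M$, the queries and the seed of the responder), more than $\delta(\alpha)\,r$ of the $r$ responses are wrong for the $(1,\alpha)$-gap problem on the norm, or $z^{(\mathrm{adv})}$ is $\gamma$-adversarial for $A,h,M$. -/

import Mathlib

open MeasureTheory ProbabilityTheory
open scoped ENNReal NNReal

noncomputable section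

namespace SketchAttack

/-- The Euclidean norm of a vector with `n` real coordinates. -/
def l2norm {n : ℕ} (v : Fin n → ℝ) : ℝ :=
  ‖(WithLp.toLp 2 v : EuclideanSpace ℝ (Fin n))‖

/-- The value `s` is a correct output of the `(y, α)`-gap problem on the input `x`: it is one of
`-1` and `1`, it is `-1` when `x ≤ y`, and it is `1` when `y + α ≤ x`. -/
def IsGapAnswer (y α x s : ℝ) : Prop :=
  (s = -1 ∨ s = 1) ∧ (x ≤ y → s = -1) ∧ (y + α ≤ x → s = 1)

/-- The trapezoidal density `ν` of the signal weight, with plateau `[l, l + α]` and support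
`[a, b]`, where `l = √(1 - c²)`, `a = l - 10 α / c` and `b = l + α + 10 α / c`.
The noise `c z` has squared norm close to `c²`, so a query of signal weight `l` has norm close
to `1`. -/
def signalDensity (α c w : ℝ) : ℝ :=
  let l := √(1 - c ^ 2)
  let a := l - 10 * α / c
  let b := l + α + 10 * α / c
  let C := 2 / (b - a + α)
  if w < a ∨ b < w then 0
  else if w ≤ l then C * ((w - a) / (l - a))
  else if w < l + α then C
  else C * ((b - w) / (b - (l + α)))

/-- The distribution `W` of the signal weight. -/
def signalLaw (α c : ℝ) : Measure ℝ :=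
  volume.withDensity fun w => ENNReal.ofReal (signalDensity α c w)

/-- The distribution of the noise vector with support `M`, `|M| = m`: independent coordinates,
`N(0, 1/m)` on `M` and `0` outside of `M` (`gaussianReal 0 0` is the point mass at `0`). -/
def noiseLaw {n : ℕ} (M : Finset (Fin n)) : Measure (Fin n → ℝ) :=
  Measure.pi fun i => gaussianReal 0 (if i ∈ M then (M.card : ℝ≥0)⁻¹ else 0)

/-- The query vector `w e_h + c z`. -/
def query {n : ℕ} (h : Fin n) (c w : ℝ) (z : Fin n → ℝ) : Fin n → ℝ :=
  w • Pi.single h (1 : ℝ) + c • z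

/-- The distribution of the sketch `A v` of a query `v = w e_h + c z` with fixed signal weight `w`
and random noise `z` with support `M`. -/
def sketchLaw {k n : ℕ} (A : Matrix (Fin k) (Fin n) ℝ) (h : Fin n) (M : Finset (Fin n))
    (c w : ℝ) : Measure (Fin k → ℝ) :=
  (noiseLaw M).map fun z => A.mulVec (query h c w z)

/-- The statistic `T` is unbiased for the parameter `w` of the family `P w`. -/
def IsUnbiased {Y : Type*} [MeasurableSpace Y] (P : ℝ → Measure Y) (T : Y → ℝ) : Prop :=
  ∀ w, Integrable T (P w) ∧ ∫ y, T y ∂(P w) = w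

/-- The statistic `T` is sufficient for the family `P`: the conditional distribution of the
observation given `T` can be chosen independently of the parameter. -/
def IsSufficient {Y : Type*} [MeasurableSpace Y] (P : ℝ → Measure Y) (T : Y → ℝ) : Prop :=
  ∃ κ : Kernel ℝ Y, IsMarkovKernel κ ∧
    ∀ w, (P w).map (fun y => (T y, y)) = ((P w).map T) ⊗ₘ κ

/-- The statistic `T` is complete for the family `P`: a function of `T` whose mean is `0` for
every parameter vanishes almost surely. -/
def IsCompleteStatistic {Y : Type*} [MeasurableSpace Y] (P : ℝ → Measure Y) (T : Y → ℝ) : Prop :=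
  ∀ g : ℝ → ℝ, Measurable g →
    (∀ w, Integrable (fun y => g (T y)) (P w) ∧ ∫ y, g (T y) ∂(P w) = 0) →
    ∀ w, ∀ᵐ y ∂(P w), g (T y) = 0

/-- `T` is the optimal estimator of the signal weight from the sketch: the unbiased, complete and
sufficient statistic for `w`. Such a statistic is determined up to null sets; continuity selects
the version that is determined at every sketch of a vector `w e_h + u` with `u` supported
on `M`. -/
def IsOptimalEstimator {k n : ℕ} (A : Matrix (Fin k) (Fin n) ℝ) (h : Fin n) (M : Finset (Fin n))
    (c : ℝ) (T : (Fin k → ℝ) → ℝ) : Prop :=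
  Continuous T ∧ IsUnbiased (sketchLaw A h M c) T ∧ IsSufficient (sketchLaw A h M c) T ∧
    IsCompleteStatistic (sketchLaw A h M c) T

/-- A `γ`-adversarial noise vector: a unit vector `u` supported on `M` such that the optimal
estimator of the signal exists and, for every signal weight `w`, deviates from `w` by more than
`γ` on the sketch of `w e_h + u`. -/
def IsAdversarial {k n : ℕ} (A : Matrix (Fin k) (Fin n) ℝ) (h : Fin n) (M : Finset (Fin n))
    (c γ : ℝ) (u : Fin n → ℝ) : Prop :=
  l2norm u = 1 ∧ (∀ i, i ∉ M → u i = 0) ∧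
    ∃ T : (Fin k → ℝ) → ℝ, IsOptimalEstimator A h M c T ∧
      ∀ w : ℝ, γ < |T (A.mulVec (query h 1 w u)) - w|

/-- A query responder. It may be strategic (it knows the signal index and the noise support, and
it is chosen after the matrix and all other parameters), randomized (through a random seed `ω`),
and adaptive: in step `t` it has access to the seed, to the signal weights and noise vectors of
all earlier steps, hence to the whole earlier state of the attacker and, by recomputing them, to
its own earlier responses, and to the sketch of the current query, from which it computes its
response in `{-1, 1}`. -/
structure Responder (k n : ℕ) (Ω : Type*) [MeasurableSpace Ω] where
  answer : Fin n → Finset (Fin n) → (t : ℕ) → Ω → (Fin t → ℝ × (Fin n → ℝ)) → (Fin k → ℝ) → ℝ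
  measurable_answer : ∀ h M t,
    Measurable fun p : Ω × (Fin t → ℝ × (Fin n → ℝ)) × (Fin k → ℝ) => answer h M t p.1 p.2.1 p.2.2
  answer_eq : ∀ h M t ω past y, answer h M t ω past y = -1 ∨ answer h M t ω past y = 1

section Run

variable {k n r : ℕ} {Ω : Type*} [MeasurableSpace Ω]

/-- The response `s⁽ᵗ⁾`, where `x j = (w⁽ʲ⁾, z⁽ʲ⁾)` is the pair of signal weight and noise drawn
in step `j` of the attack, and `ω` is the seed of the responder. -/
def response (R : Responder k n Ω) (A : Matrix (Fin k) (Fin n) ℝ) (h : Fin n)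
    (M : Finset (Fin n)) (c : ℝ) (ω : Ω) (x : Fin r → ℝ × (Fin n → ℝ)) (t : Fin r) : ℝ :=
  R.answer h M t ω (fun j : Fin (t : ℕ) => x ⟨j, j.isLt.trans t.isLt⟩)
    (A.mulVec (query h c (x t).1 (x t).2))

/-- The number of steps in which the response is wrong for the `(1, α)`-gap problem on the norm of
the query. -/
def errorCount (R : Responder k n Ω) (A : Matrix (Fin k) (Fin n) ℝ) (h : Fin n)
    (M : Finset (Fin n)) (α c : ℝ) (ω : Ω) (x : Fin r → ℝ × (Fin n → ℝ)) : ℕ :=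
  Set.ncard {t : Fin r |
    ¬ IsGapAnswer 1 α (l2norm (query h c (x t).1 (x t).2)) (response R A h M c ω x t)}

/-- The output of the attack, the normalized signed sum of the noise vectors. -/
def advNoise (R : Responder k n Ω) (A : Matrix (Fin k) (Fin n) ℝ) (h : Fin n)
    (M : Finset (Fin n)) (c : ℝ) (ω : Ω) (x : Fin r → ℝ × (Fin n → ℝ)) : Fin n → ℝ :=
  (l2norm (∑ t, response R A h M c ω x t • (x t).2))⁻¹ • ∑ t, response R A h M c ω x t • (x t).2

/-- The joint distribution of the seed of the responder and of the `r` independent pairs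
`(w⁽ᵗ⁾, z⁽ᵗ⁾)` in a run of the attack with signal index `h` and noise support `M`. -/
def runLaw (r : ℕ) (μ : Measure Ω) (M : Finset (Fin n)) (α c : ℝ) :
    Measure (Ω × (Fin r → ℝ × (Fin n → ℝ))) :=
  μ.prod (Measure.pi fun _ : Fin r => (signalLaw α c).prod (noiseLaw M))

/-- The runs in which the fraction of wrong responses exceeds `δ` or the output of the attack is
`γ`-adversarial. -/
def successEvent (r : ℕ) (R : Responder k n Ω) (A : Matrix (Fin k) (Fin n) ℝ) (h : Fin n)
    (M : Finset (Fin n)) (α c γ δ : ℝ) : Set (Ω × (Fin r → ℝ × (Fin n → ℝ))) :=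
  {p | δ * r < (errorCount R A h M α c p.1 p.2 : ℝ) ∨
    IsAdversarial A h M c γ (advNoise R A h M c p.1 p.2)}

/-- The pairs of a signal index `h` and a noise support `M` of size `m` that avoids `h`. -/
def choices (n m : ℕ) : Finset (Fin n × Finset (Fin n)) :=
  Finset.univ.filter fun p => p.1 ∉ p.2 ∧ p.2.card = m

/-- The probability of the success event when `h` and `M` are uniformly random (a uniform index
`h`, then a uniform `m`-subset `M` of the other indices) and the attack is run on them. -/
def successProb (r m : ℕ) (μ : Measure Ω) (R : Responder k n Ω) (A : Matrix (Fin k) (Fin n) ℝ)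
    (α c γ δ : ℝ) : ℝ :=
  (∑ p ∈ choices n m, (runLaw r μ p.2 α c).real (successEvent r R A p.1 p.2 α c γ δ)) /
    (choices n m).card

end Run

end SketchAttack

end

/-! Given the seed and the past, the responder in one step is a fixed measurable function `s` from
sketches to signs. So it suffices to analyse one step against an arbitrary `s` and to add up the
steps with a potential argument that tolerates adaptivity.

Suppose `x`, supported on `M`, has the same sketch as `e_h` and is orthogonal to the kernel vectors
of `A` supported on `M`. Noise along `x` then imitates signal: the sketch depends on `w` and on the
error u = c (x·z)/(x·x) only through w + u, and the rest of the noise is independent of u. The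
sketches thus carry a Gaussian location family whose optimal estimator is linear, T(Av) = x·v/(x·x)
for v on `M` (`isOptimalEstimator_of_linear`). Normalizing Z gives a γ-adversarial vector once x·Z >
γ (x·x) ‖Z‖.

Two regimes of m = |M| are distinguished. If m α² is large, the norm of the noise is known up to
less than α. Gaussian integration by parts (`meanResponse_sub`) identifies the correlation of the
response with x·z as the derivative of the mean response in `w`. The signal law is a mixture of
uniform laws on intervals around the plateau, so the averaged correlation is a difference of mean
responses on the two slopes. A correct responder says -1 just below the plateau and 1 above it,
which forces a correlation of order c²/α, where every error is charged 20/α (`slope_gap`,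
`errorRate_large`). With few errors x·Z therefore grows linearly in r, while ‖Z‖² is of order r +
r²/m whatever the signs are (`measure_signedSum_gt_le`). If m (x·x) = O(k), then r and m of order
γ²k² are enough.

If m α² is bounded, the squared norm of the noise fluctuates on a scale at least comparable to α,
and all but `k` of the dimensions of the noise are invisible to the sketch. Whatever `s` answers,
the invisible part makes the answer wrong with a constant probability (`errorRate_slice_small`).

A short `x` exists for all but 1/50 of the pairs (h, M): the squared lengths of the projections of
the `e_h` to the kernel on S = M ∪ {h} add up to at least |S| - k (`exists_leverage`). -/

namespace SketchAttack

open scoped Matrix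

/-! ### The Gaussian noise vector -/

section Gaussian

variable {n : ℕ}

instance isProbabilityMeasure_noiseLaw (M : Finset (Fin n)) :
    IsProbabilityMeasure (noiseLaw M) := by
  unfold noiseLaw; infer_instance

theorem ext_of_dotProduct_char {ι : Type*} [Fintype ι] {μ ν : Measure (ι → ℝ)}
    [IsFiniteMeasure μ] [IsFiniteMeasure ν]
    (h : ∀ t : ι → ℝ, ∫ z, Complex.exp ((t ⬝ᵥ z : ℝ) * Complex.I) ∂μ =
      ∫ z, Complex.exp ((t ⬝ᵥ z : ℝ) * Complex.I) ∂ν) : μ = ν := by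
  refine (MeasurableEquiv.toLp 2 (ι → ℝ)).map_measurableEquiv_injective
      <| Measure.ext_of_charFun <| funext fun t ↦ ?_
  simp only [charFun_apply, integral_map_equiv]
  convert h (WithLp.ofLp t) using 4 <;>
  · simp [PiLp.inner_apply, dotProduct]

theorem integral_char_noiseLaw (M : Finset (Fin n)) (t : Fin n → ℝ) :
    ∫ z, Complex.exp ((t ⬝ᵥ z : ℝ) * Complex.I) ∂(noiseLaw M) =
      Complex.exp ((-(∑ i ∈ M, t i ^ 2) / (2 * M.card) : ℝ)) := by
  have h1 : ∀ z : Fin n → ℝ, Complex.exp ((t ⬝ᵥ z : ℝ) * Complex.I) =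
      ∏ i, Complex.exp (t i * z i * Complex.I) := fun z => by
    rw [← Complex.exp_sum]; simp [dotProduct, Finset.sum_mul]
  simp_rw [h1, noiseLaw]
  rw [integral_fintype_prod_eq_prod (fun i (y : ℝ) => Complex.exp (t i * y * Complex.I))]
  simp_rw [← charFun_apply_real, charFun_gaussianReal]
  rw [← Complex.exp_sum]
  congr 1
  push_cast
  rw [neg_div, Finset.sum_div, ← Finset.sum_neg_distrib,
    ← Finset.sum_subset (Finset.subset_univ M)]
  · refine Finset.sum_congr rfl fun i hi => ?_
    simp [hi]; field_simp
  · intro i _ hi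
    simp [hi]

theorem sum_sq_eq_dotProduct {M : Finset (Fin n)} {x y : Fin n → ℝ} (hx : ∀ i, i ∉ M → x i = 0) :
    ∑ i ∈ M, x i * y i = x ⬝ᵥ y := by
  rw [dotProduct]
  exact Finset.sum_subset (Finset.subset_univ M) fun i _ hi => by simp [hx i hi]

/-- A symmetric projection with range supported on `M` splits the noise into two independent
parts. -/
theorem noiseLaw_map_split (M : Finset (Fin n)) (Q : (Fin n → ℝ) →ₗ[ℝ] (Fin n → ℝ))
    (hsymm : ∀ a b, Q a ⬝ᵥ b = a ⬝ᵥ Q b) (hidem : ∀ a, Q (Q a) = Q a)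
    (hsupp : ∀ a, ∀ i, i ∉ M → Q a i = 0) :
    ((noiseLaw M).prod (noiseLaw M)).map (fun p => Q p.1 + (p.2 - Q p.2)) = noiseLaw M := by
  have hQ : Measurable Q := (LinearMap.continuous_of_finiteDimensional Q).measurable
  have hmeas : Measurable fun p : (Fin n → ℝ) × (Fin n → ℝ) => Q p.1 + (p.2 - Q p.2) := by
    fun_prop
  have : IsProbabilityMeasure
    (((noiseLaw M).prod (noiseLaw M)).map (fun p => Q p.1 + (p.2 - Q p.2))) :=
    Measure.isProbabilityMeasure_map hmeas.aemeasurable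
  refine ext_of_dotProduct_char fun t => ?_
  have hc : Continuous fun z : Fin n → ℝ => Complex.exp ((t ⬝ᵥ z : ℝ) * Complex.I) := by
    unfold dotProduct; fun_prop
  rw [integral_map hmeas.aemeasurable hc.aestronglyMeasurable]
  have h1 : ∀ p : (Fin n → ℝ) × (Fin n → ℝ),
      Complex.exp ((t ⬝ᵥ (Q p.1 + (p.2 - Q p.2)) : ℝ) * Complex.I) =
      Complex.exp ((Q t ⬝ᵥ p.1 : ℝ) * Complex.I) *
        Complex.exp (((t - Q t) ⬝ᵥ p.2 : ℝ) * Complex.I) := fun p => by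
    rw [← Complex.exp_add, ← add_mul, ← Complex.ofReal_add, hsymm, sub_dotProduct, hsymm,
      dotProduct_add, dotProduct_sub]
  simp_rw [h1]
  rw [integral_prod_mul (fun z => Complex.exp ((Q t ⬝ᵥ z : ℝ) * Complex.I))
    (fun z => Complex.exp (((t - Q t) ⬝ᵥ z : ℝ) * Complex.I))]
  rw [integral_char_noiseLaw, integral_char_noiseLaw, integral_char_noiseLaw, ← Complex.exp_add,
    ← Complex.ofReal_add]
  congr 2
  rw [← add_div]
  congr 1
  -- Pythagoras on `M`: the cross term vanishes, so the exponents of the two independent parts add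
  -- up to the exponent of the whole noise.
  have h2 : ∑ i ∈ M, Q t i * (t - Q t) i = 0 := by
    rw [sum_sq_eq_dotProduct (hsupp t), hsymm, map_sub, hidem, sub_self, dotProduct_zero]
  have h3 : ∑ i ∈ M, t i ^ 2 = ∑ i ∈ M, Q t i ^ 2 + ∑ i ∈ M, (t - Q t) i ^ 2 +
      2 * ∑ i ∈ M, Q t i * (t - Q t) i := by
    rw [Finset.mul_sum, ← Finset.sum_add_distrib, ← Finset.sum_add_distrib]
    refine Finset.sum_congr rfl fun i _ => ?_
    simp only [Pi.sub_apply]; ring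
  rw [h3, h2]; ring

theorem noiseLaw_map_dotProduct (M : Finset (Fin n)) (x : Fin n → ℝ)
    (hx : ∀ i, i ∉ M → x i = 0) :
    (noiseLaw M).map (fun z => x ⬝ᵥ z) =
      gaussianReal 0 (Real.toNNReal (x ⬝ᵥ x / M.card)) := by
  have hc : Continuous fun z : Fin n → ℝ => x ⬝ᵥ z := by unfold dotProduct; fun_prop
  have : IsProbabilityMeasure ((noiseLaw M).map (fun z => x ⬝ᵥ z)) :=
    Measure.isProbabilityMeasure_map hc.measurable.aemeasurable
  refine Measure.ext_of_charFun (funext fun t => ?_)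
  rw [charFun_gaussianReal, charFun_apply_real, integral_map hc.measurable.aemeasurable
    (by fun_prop)]
  have h := integral_char_noiseLaw M (t • x)
  rw [show ∑ i ∈ M, (t • x) i ^ 2 = t ^ 2 * (x ⬝ᵥ x) by
    rw [← sum_sq_eq_dotProduct hx, Finset.mul_sum]
    exact Finset.sum_congr rfl fun i _ => by simp only [Pi.smul_apply, smul_eq_mul]; ring] at h
  have h0 : 0 ≤ x ⬝ᵥ x / M.card := div_nonneg (Finset.sum_nonneg fun i _ => mul_self_nonneg _)
    (Nat.cast_nonneg _)
  simp only [smul_dotProduct, smul_eq_mul, Complex.ofReal_mul] at h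
  rw [h]
  congr 1
  have h3 : ((Real.toNNReal (x ⬝ᵥ x / M.card) : ℝ≥0) : ℂ) = ((x ⬝ᵥ x / M.card : ℝ) : ℂ) := by
    rw [← Complex.ofReal_inj.mpr (Real.coe_toNNReal _ h0)]
  rw [h3]
  push_cast
  by_cases hm : (M.card : ℂ) = 0
  · simp [hm]
  · field_simp; simp; ring

/-- Rotation invariance: the characteristic function at a combination of the `b j` depends only on
its Euclidean length, which is the length of the coefficient vector. -/
theorem noiseLaw_map_orthonormal (M : Finset (Fin n)) {d : ℕ} (b : Fin d → Fin n → ℝ)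
    (hb : ∀ i j, b i ⬝ᵥ b j = if i = j then 1 else 0) (hsupp : ∀ j, ∀ i, i ∉ M → b j i = 0) :
    (noiseLaw M).map (fun z j => b j ⬝ᵥ z) =
      Measure.pi fun _ : Fin d => gaussianReal 0 (M.card : ℝ≥0)⁻¹ := by
  have hc : Continuous fun (z : Fin n → ℝ) (j : Fin d) => b j ⬝ᵥ z := by
    unfold dotProduct; fun_prop
  have : IsProbabilityMeasure ((noiseLaw M).map (fun z j => b j ⬝ᵥ z)) :=
    Measure.isProbabilityMeasure_map hc.measurable.aemeasurable
  refine ext_of_dotProduct_char fun t => ?_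
  have hc2 : Continuous fun z : Fin d → ℝ => Complex.exp ((t ⬝ᵥ z : ℝ) * Complex.I) := by
    unfold dotProduct; fun_prop
  rw [integral_map hc.measurable.aemeasurable hc2.aestronglyMeasurable]
  have h1 : ∀ z : Fin n → ℝ, t ⬝ᵥ (fun j => b j ⬝ᵥ z) = (∑ j, t j • b j) ⬝ᵥ z := fun z => by
    rw [sum_dotProduct]; simp [dotProduct, Finset.mul_sum, mul_assoc]
  simp_rw [h1]
  rw [integral_char_noiseLaw]
  have h2 : ∀ i, i ∉ M → (∑ j, t j • b j) i = 0 := fun i hi => by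
    simp [hsupp _ i hi]
  have h3 : ∑ i ∈ M, (∑ j, t j • b j) i ^ 2 = ∑ j, t j ^ 2 := by
    simp_rw [sq]
    rw [sum_sq_eq_dotProduct h2]
    simp_rw [sum_dotProduct, dotProduct_sum, smul_dotProduct, dotProduct_smul, hb]
    simp
  rw [h3]
  have h4 := integral_char_noiseLaw (Finset.univ : Finset (Fin d)) t
  have h5 : ∀ z : Fin d → ℝ, Complex.exp ((t ⬝ᵥ z : ℝ) * Complex.I) =
      ∏ i, Complex.exp (t i * z i * Complex.I) := fun z => by
    rw [← Complex.exp_sum]; simp [dotProduct, Finset.sum_mul]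
  simp_rw [h5]
  rw [integral_fintype_prod_eq_prod (fun i (y : ℝ) => Complex.exp (t i * y * Complex.I))]
  simp_rw [← charFun_apply_real, charFun_gaussianReal]
  rw [← Complex.exp_sum]
  congr 1
  push_cast
  rw [neg_div, Finset.sum_div, ← Finset.sum_neg_distrib]
  refine Finset.sum_congr rfl fun i hi => ?_
  simp; field_simp

theorem integral_exp_mul_sq_gaussianReal {m : ℕ} (hm : 0 < m) {lam : ℝ} (hl : lam < 1 / 2) :
    ∫ y, Real.exp (lam * (m * y ^ 2)) ∂(gaussianReal 0 (m : ℝ≥0)⁻¹) =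
      (√(1 - 2 * lam))⁻¹ := by
  have hm' : (0 : ℝ) < m := by exact_mod_cast hm
  rw [integral_gaussianReal_eq_integral_smul (by positivity)]
  have h1 : ∀ y : ℝ, gaussianPDFReal 0 (m : ℝ≥0)⁻¹ y • Real.exp (lam * (m * y ^ 2)) =
      (√(2 * Real.pi * (m : ℝ)⁻¹))⁻¹ * Real.exp (-(m * (1 - 2 * lam) / 2) * y ^ 2) := fun y => by
    rw [gaussianPDFReal, smul_eq_mul, mul_assoc, ← Real.exp_add]
    congr 2
    push_cast
    field_simp
    ring
  simp_rw [h1]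
  rw [integral_const_mul, integral_gaussian, ← Real.sqrt_inv, ← Real.sqrt_inv,
    ← Real.sqrt_mul (by positivity)]
  congr 1
  have : 1 - 2 * lam ≠ 0 := by linarith
  have := Real.pi_ne_zero
  field_simp

theorem integral_exp_mul_sum_sq_noiseLaw (M : Finset (Fin n)) (hM : 0 < M.card) {d : ℕ}
    (b : Fin d → Fin n → ℝ)
    (hb : ∀ i j, b i ⬝ᵥ b j = if i = j then 1 else 0) (hsupp : ∀ j, ∀ i, i ∉ M → b j i = 0)
    {lam : ℝ} (hl : lam < 1 / 2) :
    ∫ z, Real.exp (lam * (M.card * ∑ j, (b j ⬝ᵥ z) ^ 2)) ∂(noiseLaw M) =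
      Real.exp (d * (-Real.log (1 - 2 * lam) / 2)) := by
  have hc : Continuous fun (z : Fin n → ℝ) (j : Fin d) => b j ⬝ᵥ z := by
    unfold dotProduct; fun_prop
  have h := integral_map (μ := noiseLaw M) hc.measurable.aemeasurable
    (f := fun y : Fin d → ℝ => Real.exp (lam * (M.card * ∑ j, y j ^ 2)))
    (Continuous.aestronglyMeasurable (by fun_prop))
  rw [noiseLaw_map_orthonormal M b hb hsupp] at h
  rw [← h]
  have h1 : ∀ y : Fin d → ℝ, Real.exp (lam * (M.card * ∑ j, y j ^ 2)) =
      ∏ j, Real.exp (lam * (M.card * y j ^ 2)) := fun y => by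
    rw [← Real.exp_sum, Finset.mul_sum, Finset.mul_sum]
  simp_rw [h1]
  rw [integral_fintype_prod_eq_prod (fun (_ : Fin d) (y : ℝ) => Real.exp (lam * (M.card * y ^ 2)))]
  simp_rw [integral_exp_mul_sq_gaussianReal hM hl]
  rw [Finset.prod_const, Finset.card_univ, Fintype.card_fin, Real.exp_nat_mul]
  congr 1
  have h2 : 0 < 1 - 2 * lam := by linarith
  rw [neg_div, Real.exp_neg, ← Real.log_sqrt h2.le, Real.exp_log (Real.sqrt_pos.2 h2)]

theorem integrable_exp_mul_sum_sq_noiseLaw (M : Finset (Fin n)) (hM : 0 < M.card) {d : ℕ}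
    (b : Fin d → Fin n → ℝ)
    (hb : ∀ i j, b i ⬝ᵥ b j = if i = j then 1 else 0) (hsupp : ∀ j, ∀ i, i ∉ M → b j i = 0)
    {lam : ℝ} (hl : lam < 1 / 2) :
    Integrable (fun z => Real.exp (lam * (M.card * ∑ j, (b j ⬝ᵥ z) ^ 2))) (noiseLaw M) := by
  refine Integrable.of_integral_ne_zero ?_
  rw [integral_exp_mul_sum_sq_noiseLaw M hM b hb hsupp hl]
  positivity

theorem integrable_dotProduct_pow (M : Finset (Fin n)) (x : Fin n → ℝ)
    (hx : ∀ i, i ∉ M → x i = 0) (p : ℕ) :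
    Integrable (fun z => (x ⬝ᵥ z) ^ p) (noiseLaw M) := by
  have hc : Continuous fun z : Fin n → ℝ => x ⬝ᵥ z := by unfold dotProduct; fun_prop
  have h : Integrable (fun y : ℝ => y ^ p) ((noiseLaw M).map (fun z => x ⬝ᵥ z)) := by
    rw [noiseLaw_map_dotProduct M x hx]
    by_cases hp : p = 0
    · simp [hp]
    have := (memLp_id_gaussianReal' (μ := 0) (v := Real.toNNReal (x ⬝ᵥ x / M.card)) (p : ℝ≥0∞)
      (by simp)).integrable_norm_pow hp
    refine (integrable_norm_iff (continuous_pow p).aestronglyMeasurable).1 (this.congr ?_)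
    filter_upwards with y
    simp
  exact (integrable_map_measure (continuous_pow p).aestronglyMeasurable hc.measurable.aemeasurable).1 h

theorem integral_dotProduct_sq (M : Finset (Fin n)) (x : Fin n → ℝ)
    (hx : ∀ i, i ∉ M → x i = 0) :
    ∫ z, (x ⬝ᵥ z) ^ 2 ∂(noiseLaw M) = x ⬝ᵥ x / M.card := by
  have hc : Continuous fun z : Fin n → ℝ => x ⬝ᵥ z := by unfold dotProduct; fun_prop
  have h := integral_map (μ := noiseLaw M) hc.measurable.aemeasurable (f := fun y : ℝ => y ^ 2)
    (by fun_prop)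
  have h2 := variance_fun_id_gaussianReal (μ := 0) (v := Real.toNNReal (x ⬝ᵥ x / M.card))
  rw [variance_eq_integral (by fun_prop)] at h2
  have h0 : 0 ≤ x ⬝ᵥ x / M.card := div_nonneg (Finset.sum_nonneg fun i _ => mul_self_nonneg _)
    (Nat.cast_nonneg _)
  simp only [integral_id_gaussianReal, sub_zero, Real.coe_toNNReal _ h0] at h2
  rw [noiseLaw_map_dotProduct M x hx, h2] at h
  exact h.symm

theorem ae_noiseLaw_eq_zero (M : Finset (Fin n)) :
    ∀ᵐ z ∂(noiseLaw M), ∀ i, i ∉ M → z i = 0 := by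
  rw [ae_all_iff]
  intro i
  by_cases hi : i ∈ M
  · simp [hi]
  · have h : ∀ᵐ y ∂(gaussianReal 0 (if i ∈ M then (M.card : ℝ≥0)⁻¹ else 0)), y = 0 := by
      simp [hi]
    have := (Measure.quasiMeasurePreserving_eval (μ := fun i : Fin n => gaussianReal 0
      (if i ∈ M then (M.card : ℝ≥0)⁻¹ else 0)) i).ae h
    filter_upwards [this] with z hz _ using hz

end Gaussian

/-! ### Tails of the chi-squared distribution -/

section ChiSquared

/-- The logarithm of the moment-generating function of the square of a standard Gaussian. -/
noncomputable def chiLogMGF (lam : ℝ) : ℝ := -Real.log (1 - 2 * lam) / 2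

/-- Second-order Taylor expansion of log(1 - 2λ). The remainder |2λ|³/(1 - |2λ|) is at most 16|λ|³
as |2λ| ≤ 1/2, and it is halved. -/
theorem abs_chiLogMGF_sub_le {lam : ℝ} (h : |lam| ≤ 1 / 4) :
    |chiLogMGF lam - (lam + lam ^ 2)| ≤ 8 * |lam| ^ 3 := by
  have h1 : |2 * lam| ≤ 1 / 2 := by rw [abs_mul, abs_two]; linarith
  have h2 := Real.abs_log_sub_add_sum_range_le (x := 2 * lam) (by linarith) 2
  simp only [Finset.sum_range_succ, Finset.sum_range_zero] at h2
  norm_num at h2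
  have h3 : |2 * lam| ^ 3 / (1 - |2 * lam|) ≤ 16 * |lam| ^ 3 := by
    rw [div_le_iff₀ (by linarith), abs_mul, abs_two]
    rw [abs_mul, abs_two] at h1
    nlinarith [pow_nonneg (abs_nonneg lam) 3]
  have h4 : |2 * lam + (2 * lam) ^ 2 / 2 + Real.log (1 - 2 * lam)| ≤ 16 * |lam| ^ 3 :=
    le_trans (by simpa [abs_mul] using h2) (by simpa [abs_mul] using h3)
  rw [chiLogMGF]
  rw [abs_le] at h4 ⊢
  constructor <;> linarith [h4.1, h4.2]

variable {Ω : Type*} [MeasurableSpace Ω] {P : Measure Ω}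

/-- `Y` has the moment-generating function of the chi-squared distribution with `d` degrees of
freedom. -/
def HasChiMGF (P : Measure Ω) (d : ℕ) (Y : Ω → ℝ) : Prop :=
  Measurable Y ∧ ∀ lam : ℝ, lam < 1 / 2 → Integrable (fun z => Real.exp (lam * Y z)) P ∧
    ∫ z, Real.exp (lam * Y z) ∂P = Real.exp (d * chiLogMGF lam)

/-- A lower bound of the tails from the moment-generating function alone, by a second-moment
argument for exp(λY). The sign of `lam` selects the tail: λ > 0 gives large values of Y, λ < 0 small
ones. -/
theorem HasChiMGF.le_measureReal [IsProbabilityMeasure P] {d : ℕ} {Y : Ω → ℝ} (hY : HasChiMGF P d Y) {lam : ℝ}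
    (h1 : |lam| ≤ 1 / 8) (h2 : 7 ≤ lam ^ 2 * d) (h3 : 80 * d * |lam| ^ 3 ≤ 1) :
    Real.exp (-2 * (lam ^ 2 * d) - 1) / 4 ≤ P.real {z | 0 ≤ lam * (Y z - (d + lam * d))} := by
  have hl : |lam| ≤ 1 / 4 := by linarith
  have hl2 : |2 * lam| ≤ 1 / 4 := by rw [abs_mul, abs_two]; linarith
  have hl3 : |lam / 2| ≤ 1 / 4 := by rw [abs_div, abs_two]; linarith
  have hb := abs_le.1 h1
  obtain ⟨i1, e1⟩ := hY.2 lam (by linarith [hb.2])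
  obtain ⟨i2, e2⟩ := hY.2 (2 * lam) (by linarith [hb.2])
  obtain ⟨i3, e3⟩ := hY.2 (lam / 2) (by linarith [hb.2])
  set E : Set Ω := {z | 0 ≤ lam * (Y z - (d + lam * d))} with hE
  have hEm : MeasurableSet E := measurableSet_le measurable_const
    (measurable_const.mul (hY.1.sub measurable_const))
  set M1 := Real.exp (d * chiLogMGF lam)
  set M2 := Real.exp (d * chiLogMGF (2 * lam))
  set M3 := Real.exp (d * chiLogMGF (lam / 2))
  set r := Real.exp (lam / 2 * (d + lam * d))
  -- Chosen so that the second-moment term below integrates to M1/4.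
  set θ := M1 / (2 * M2) with hθ
  have hM1 : 0 < M1 := Real.exp_pos _
  have hM2 : 0 < M2 := Real.exp_pos _
  have hθ0 : 0 < θ := by positivity
  -- Outside of `E` the factor exp(λY/2) is at most `r`; on `E` this is the arithmetic-geometric
  -- mean inequality with weight `θ`. After integration the first term costs at most M1/2 and the
  -- second M1/4, which leaves M1/4 to `E`, hence P(E) ≥ M1²/(4 M2).
  have key : ∀ z, Real.exp (lam * Y z) ≤ r * Real.exp (lam / 2 * Y z) +
      θ / 2 * Real.exp (2 * lam * Y z) + E.indicator (fun _ => 1 / (2 * θ)) z := by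
    intro z
    have p2 : 0 < Real.exp (2 * lam * Y z) := Real.exp_pos _
    by_cases hz : z ∈ E
    · rw [Set.indicator_of_mem hz]
      have hsq : Real.exp (2 * lam * Y z) = Real.exp (lam * Y z) ^ 2 := by
        rw [← Real.exp_nat_mul]; congr 1; push_cast; ring
      have : 0 ≤ r * Real.exp (lam / 2 * Y z) := by positivity
      have h5 : Real.exp (lam * Y z) ≤ θ / 2 * Real.exp (lam * Y z) ^ 2 + 1 / (2 * θ) := by
        have : θ / 2 * Real.exp (lam * Y z) ^ 2 + 1 / (2 * θ) - Real.exp (lam * Y z) =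
          (θ * Real.exp (lam * Y z) - 1) ^ 2 / (2 * θ) := by field_simp; ring
        have h6 : 0 ≤ (θ * Real.exp (lam * Y z) - 1) ^ 2 / (2 * θ) := by positivity
        linarith
      rw [hsq]; linarith
    · rw [Set.indicator_of_notMem hz]
      have hz' : lam * (Y z - (d + lam * d)) < 0 := not_le.1 hz
      have h5 : Real.exp (lam * Y z) ≤ r * Real.exp (lam / 2 * Y z) := by
        rw [← Real.exp_add]
        exact Real.exp_le_exp.2 (by linarith)
      have : 0 ≤ θ / 2 * Real.exp (2 * lam * Y z) := by positivity
      linarith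
  have hint : ∫ z, (r * Real.exp (lam / 2 * Y z) +
      θ / 2 * Real.exp (2 * lam * Y z) + E.indicator (fun _ => 1 / (2 * θ)) z) ∂P =
      r * M3 + θ / 2 * M2 + P.real E * (1 / (2 * θ)) := by
    have hA : Integrable (fun z => r * Real.exp (lam / 2 * Y z) +
      θ / 2 * Real.exp (2 * lam * Y z)) P := (i3.const_mul _).add (i2.const_mul _)
    rw [integral_add hA ((integrable_const _).indicator hEm), integral_add (i3.const_mul _) (i2.const_mul _),
      integral_const_mul, integral_const_mul, e2, e3, integral_indicator_const _ hEm, smul_eq_mul]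
  have hle := integral_mono i1 (((i3.const_mul r).add (i2.const_mul (θ / 2))).add
    ((integrable_const (1 / (2 * θ))).indicator hEm)) key
  simp only [Pi.add_apply] at hle
  rw [e1, hint] at hle
  have b1 := abs_le.1 (abs_chiLogMGF_sub_le hl)
  have b2 := abs_le.1 (abs_chiLogMGF_sub_le hl2)
  have b3 := abs_le.1 (abs_chiLogMGF_sub_le hl3)
  rw [abs_mul, abs_two] at b2
  rw [abs_div, abs_two] at b3
  have hd : (0 : ℝ) ≤ d := Nat.cast_nonneg d
  have p3 : 0 ≤ d * |lam| ^ 3 := by positivity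
  have hr : r * M3 ≤ M1 / 2 := by
    have : r * M3 = M1 * Real.exp (lam / 2 * (d + lam * d) + d * chiLogMGF (lam / 2) -
        d * chiLogMGF lam) := by
      rw [← Real.exp_add, ← Real.exp_add]; congr 1; ring
    rw [this]
    -- The main terms give -λ²d/4 ≤ -7/4, and the cubic errors are at most (1 + 8) d|λ|³ ≤ 9/80.
    have h7 : lam / 2 * (d + lam * d) + d * chiLogMGF (lam / 2) - d * chiLogMGF lam ≤ -1 := by
      have c3 := mul_le_mul_of_nonneg_left b3.2 hd
      have c1 := mul_le_mul_of_nonneg_left b1.1 hd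
      have e3 : d * (8 * (|lam| / 2) ^ 3) = d * |lam| ^ 3 := by ring
      rw [e3] at c3
      linarith
    have h8 : Real.exp (-1) ≤ 1 / 2 := by
      have := Real.exp_neg_one_lt_half; linarith
    have := mul_le_mul_of_nonneg_left ((Real.exp_le_exp.2 h7).trans h8) hM1.le
    linarith
  have hp : M1 / 4 ≤ P.real E * (1 / (2 * θ)) := by
    have : θ / 2 * M2 = M1 / 4 := by rw [hθ]; field_simp; norm_num
    linarith
  have hp2 : M1 ^ 2 / M2 / 4 ≤ P.real E := by
    have : P.real E * (1 / (2 * θ)) = P.real E * M2 / M1 := by rw [hθ]; field_simp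
    rw [this, le_div_iff₀ hM1] at hp
    rw [div_div, div_le_iff₀ (by positivity)]
    nlinarith
  refine le_trans ?_ hp2
  rw [← Real.exp_nat_mul, ← Real.exp_sub]
  refine div_le_div_of_nonneg_right (Real.exp_le_exp.2 ?_) (by norm_num)
  have c2 := mul_le_mul_of_nonneg_left b2.2 hd
  have c1 := mul_le_mul_of_nonneg_left b1.1 hd
  push_cast
  -- Together with 2 · 8 from the square of M1 this is the 80 of the hypothesis `h3`.
  have e2 : d * (8 * (2 * |lam|) ^ 3) = 64 * (d * |lam| ^ 3) := by ring
  rw [e2] at c2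
  linarith

/-- Chernoff's bound at |λ| = η/4, for both tails at once through the sign of `lam`. The exponent is
at most dη²(1/16 + 1/8 - 1/4) = -dη²/16, and exp(-t) ≤ 1/t is precise enough here. -/
theorem HasChiMGF.measureReal_le {d : ℕ} {Y : Ω → ℝ} (hY : HasChiMGF P d Y) {lam η : ℝ}
    (hη : 0 < η) (hη1 : η < 1) (hd : 0 < d) (hlam : |lam| = η / 4) :
    P.real {z | lam * d + |lam| * η * d ≤ lam * Y z} ≤ 16 / (d * η ^ 2) := by
  have hb := abs_le.1 hlam.le
  obtain ⟨i1, e1⟩ := hY.2 lam (by linarith [hb.2])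
  have h := mul_meas_ge_le_integral_of_nonneg (μ := P)
    (f := fun z => Real.exp (lam * Y z)) (ae_of_all _ fun z => (Real.exp_pos _).le) i1
    (Real.exp (lam * d + |lam| * η * d))
  simp only [Real.exp_le_exp] at h
  rw [e1] at h
  have b1 := abs_le.1 (abs_chiLogMGF_sub_le (lam := lam) (by rw [hlam]; linarith))
  have hd' : (0 : ℝ) < d := by exact_mod_cast hd
  have h2 : P.real {z | lam * d + |lam| * η * d ≤ lam * Y z} ≤
      Real.exp (d * chiLogMGF lam - (lam * d + |lam| * η * d)) := by
    rw [Real.exp_sub, le_div_iff₀ (Real.exp_pos _), mul_comm]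
    exact h
  refine h2.trans ?_
  have h3 : d * chiLogMGF lam - (lam * d + |lam| * η * d) ≤ -(d * η ^ 2 / 16) := by
    have c1 := mul_le_mul_of_nonneg_left b1.2 hd'.le
    have e : lam ^ 2 = η ^ 2 / 16 := by rw [← sq_abs, hlam]; ring
    rw [hlam] at c1 ⊢
    rw [mul_sub, e] at c1
    have : d * η ^ 3 ≤ d * η ^ 2 := by
      refine mul_le_mul_of_nonneg_left ?_ hd'.le
      nlinarith [sq_nonneg η]
    nlinarith
  refine (Real.exp_le_exp.2 h3).trans ?_
  rw [Real.exp_neg]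
  have h4 := Real.add_one_le_exp (d * η ^ 2 / 16)
  have h5 : 0 < d * η ^ 2 / 16 := by positivity
  have h6 : (Real.exp (d * η ^ 2 / 16))⁻¹ ≤ (d * η ^ 2 / 16)⁻¹ :=
    inv_anti₀ h5 (by linarith)
  refine h6.trans (le_of_eq ?_)
  rw [inv_div]

end ChiSquared

/-! ### Chi-squared components of the noise and concentration of its norm -/

theorem hasChiMGF_noiseLaw {n : ℕ} (M : Finset (Fin n)) (hM : 0 < M.card) {d : ℕ}
    (b : Fin d → Fin n → ℝ)
    (hb : ∀ i j, b i ⬝ᵥ b j = if i = j then 1 else 0) (hsupp : ∀ j, ∀ i, i ∉ M → b j i = 0) :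
    HasChiMGF (noiseLaw M) d (fun z => M.card * ∑ j, (b j ⬝ᵥ z) ^ 2) := by
  refine ⟨Continuous.measurable (by unfold dotProduct; fun_prop), fun lam hl => ⟨?_, ?_⟩⟩
  · exact integrable_exp_mul_sum_sq_noiseLaw M hM b hb hsupp hl
  · exact integral_exp_mul_sum_sq_noiseLaw M hM b hb hsupp hl

theorem hasChiMGF_noiseLaw_norm {n : ℕ} (M : Finset (Fin n)) (hM : 0 < M.card) :
    HasChiMGF (noiseLaw M) M.card (fun z => M.card * ∑ i ∈ M, z i ^ 2) := by
  have h := hasChiMGF_noiseLaw M hM (d := M.card)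
    (fun j => Pi.single (M.equivFin.symm j : Fin n) 1) (fun i j => by
      rw [single_dotProduct, one_mul, Pi.single_apply]
      simp [Subtype.ext_iff.symm]) (fun j i hi => by
      rw [Pi.single_apply, if_neg]
      rintro rfl
      exact hi (M.equivFin.symm j).2)
  convert h using 3 with z
  simp only [single_dotProduct, one_mul]
  rw [← Finset.sum_coe_sort M (fun i => z i ^ 2), ← M.equivFin.symm.sum_comp]

theorem measureReal_norm_sq_deviation_le {n : ℕ} (M : Finset (Fin n)) (hM : 0 < M.card) {η : ℝ}
    (hη : 0 < η) (hη1 : η < 1) :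
    (noiseLaw M).real {z | η ≤ |∑ i ∈ M, z i ^ 2 - 1|} ≤ 32 / (M.card * η ^ 2) := by
  have h := hasChiMGF_noiseLaw_norm M hM
  have h1 := h.measureReal_le (lam := η / 4) hη hη1 hM (abs_of_pos (by positivity))
  have h2 := h.measureReal_le (lam := -(η / 4)) hη hη1 hM
    (by rw [abs_neg, abs_of_pos (by positivity)])
  have hm : (0 : ℝ) < M.card := by exact_mod_cast hM
  rw [abs_neg, abs_of_pos (by positivity : 0 < η / 4)] at h2
  rw [abs_of_pos (by positivity : 0 < η / 4)] at h1
  have hsub : {z : Fin n → ℝ | η ≤ |∑ i ∈ M, z i ^ 2 - 1|} ⊆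
      {z | η / 4 * M.card + η / 4 * η * M.card ≤ η / 4 * (M.card * ∑ i ∈ M, z i ^ 2)} ∪
      {z | -(η / 4) * M.card + η / 4 * η * M.card ≤ -(η / 4) * (M.card * ∑ i ∈ M, z i ^ 2)} := by
    intro z hz
    have hpos : 0 < η / 4 * M.card := by positivity
    rcases le_abs.1 (Set.mem_ofPred_eq ▸ hz : η ≤ |_|) with hz | hz
    · left
      simp only [Set.mem_ofPred_eq]
      linarith [mul_le_mul_of_nonneg_left hz hpos.le]
    · right
      simp only [Set.mem_ofPred_eq]
      linarith [mul_le_mul_of_nonneg_left hz hpos.le]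
  exact (measureReal_mono hsub).trans
    ((measureReal_union_le _ _).trans (add_le_add h1 h2) |>.trans (le_of_eq (by ring)))

/-! ### The distribution of the signal weight -/

section Signal

variable {α c : ℝ}

/-- The length of each of the two slopes of the trapezoidal signal density. -/
noncomputable def slopeLength (α c : ℝ) : ℝ := 10 * α / c

/-- The left end of the plateau of the signal density. -/
noncomputable def plateau (c : ℝ) : ℝ := √(1 - c ^ 2)

/-- The height of the signal density. -/
noncomputable def height (α c : ℝ) : ℝ := (α + slopeLength α c)⁻¹

theorem slopeLength_pos (hα : 0 < α) (hc : 0 < c) : 0 < slopeLength α c := by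
  unfold slopeLength; positivity

theorem height_pos (hα : 0 < α) (hc : 0 < c) : 0 < height α c := by
  have := slopeLength_pos hα hc
  unfold height; positivity

/-- The trapezoid as a clipped minimum, symmetric under w ↦ 2l + α - w. In this form continuity is
immediate, and the density at `w` is visibly proportional to the length of the set of u in (l - L,
l] with u ≤ w ≤ 2l + α - u. -/
theorem signalDensity_eq (hα : 0 < α) (hc : 0 < c) (w : ℝ) :
    signalDensity α c w = height α c / slopeLength α c *
      max 0 (min (min (plateau c) w) (2 * plateau c + α - w) -
        (plateau c - slopeLength α c)) := by
  have hL := slopeLength_pos hα hc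
  have hH : 2 / (plateau c + α + slopeLength α c - (plateau c - slopeLength α c) + α) =
      height α c := by
    unfold height
    rw [div_eq_iff (by linarith), inv_mul_eq_div, eq_div_iff (by linarith)]; ring
  have hdef : signalDensity α c w = if w < plateau c - slopeLength α c ∨
      plateau c + α + slopeLength α c < w then 0
    else if w ≤ plateau c then 2 / (plateau c + α + slopeLength α c -
        (plateau c - slopeLength α c) + α) *
        ((w - (plateau c - slopeLength α c)) / (plateau c - (plateau c - slopeLength α c)))
    else if w < plateau c + α then 2 / (plateau c + α + slopeLength α c -
        (plateau c - slopeLength α c) + α)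
    else 2 / (plateau c + α + slopeLength α c - (plateau c - slopeLength α c) + α) *
      ((plateau c + α + slopeLength α c - w) /
        (plateau c + α + slopeLength α c - (plateau c + α))) := rfl
  rw [hdef, hH]
  set l := plateau c
  set L := slopeLength α c
  split_ifs with h1 h2 h3
  · rw [max_eq_left, mul_zero]
    rcases h1 with h1 | h1
    · have : min (min l w) (2 * l + α - w) ≤ w := (min_le_left _ _).trans (min_le_right _ _)
      linarith
    · have : min (min l w) (2 * l + α - w) ≤ 2 * l + α - w := min_le_right _ _
      linarith
  · push Not at h1
    rw [min_eq_right h2, min_eq_left (by linarith), max_eq_right (by linarith), sub_sub_cancel]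
    field_simp
  · rw [min_eq_left (not_le.1 h2).le, min_eq_left (by linarith), max_eq_right (by linarith),
      sub_sub_cancel]
    field_simp
  · push Not at h1
    rw [min_eq_left (not_le.1 h2).le, min_eq_right (by linarith), max_eq_right (by linarith),
      add_sub_cancel_left]
    field_simp; ring

theorem continuous_signalDensity (hα : 0 < α) (hc : 0 < c) : Continuous (signalDensity α c) := by
  rw [funext (signalDensity_eq hα hc)]
  fun_prop

theorem signalDensity_nonneg (hα : 0 < α) (hc : 0 < c) (w : ℝ) : 0 ≤ signalDensity α c w := by
  rw [signalDensity_eq hα hc]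
  have := slopeLength_pos hα hc
  have := height_pos hα hc
  positivity

theorem signalDensity_eq_zero (hα : 0 < α) (hc : 0 < c) {w : ℝ}
    (hw : w ∉ Set.Icc (plateau c - slopeLength α c) (plateau c + α + slopeLength α c)) :
    signalDensity α c w = 0 := by
  rw [signalDensity_eq hα hc, max_eq_left, mul_zero]
  rw [Set.mem_Icc, not_and_or, not_le, not_le] at hw
  rcases hw with h1 | h1
  · have : min (min (plateau c) w) (2 * plateau c + α - w) ≤ w :=
      (min_le_left _ _).trans (min_le_right _ _)
    linarith
  · have : min (min (plateau c) w) (2 * plateau c + α - w) ≤ 2 * plateau c + α - w :=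
      min_le_right _ _
    linarith

/-- The signal law is a mixture of uniform distributions on intervals centred at the middle of the
plateau. -/
theorem integral_signalDensity_mul (hα : 0 < α) (hc : 0 < c) {g : ℝ → ℝ} (hg : Measurable g)
    {B : ℝ} (hB : ∀ w, |g w| ≤ B) :
    ∫ w, signalDensity α c w * g w = height α c / slopeLength α c *
      ∫ u in (plateau c - slopeLength α c)..(plateau c),
        ∫ w in u..(2 * plateau c + α - u), g w := by
  have hL := slopeLength_pos hα hc
  set l := plateau c
  set L := slopeLength α c
  -- Layer-cake: the section of `S` over `w` has the length that the density measures, and the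
  -- section over `u` is the interval [u, 2l + α - u]. Fubini on `S` does the rest.
  set S : Set (ℝ × ℝ) := {p | l - L < p.2 ∧ p.2 ≤ l ∧ p.2 ≤ p.1 ∧ p.2 ≤ 2 * l + α - p.1} with hS
  have hSm : MeasurableSet S := by
    have e : S = {p | l - L < p.2} ∩ ({p | p.2 ≤ l} ∩ ({p | p.2 ≤ p.1} ∩
      {p | p.2 ≤ 2 * l + α - p.1})) := rfl
    rw [e]
    refine MeasurableSet.inter (measurableSet_lt (by fun_prop) (by fun_prop))
      (MeasurableSet.inter (measurableSet_le (by fun_prop) (by fun_prop))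
      (MeasurableSet.inter (measurableSet_le (by fun_prop) (by fun_prop))
        (measurableSet_le (by fun_prop) (by fun_prop))))
  have hSsub : S ⊆ Set.Icc (l - L) (l + α + L) ×ˢ Set.Icc (l - L) l := by
    rintro ⟨w, u⟩ ⟨h1, h2, h3, h4⟩
    simp only at h1 h2 h3 h4
    simp only [Set.mem_prod, Set.mem_Icc]
    refine ⟨⟨by linarith, by linarith⟩, by linarith, by linarith⟩
  have hint : Integrable (Function.uncurry fun w u => S.indicator (fun p => g p.1) (w, u))
      (volume.prod volume) := by
    change Integrable (S.indicator fun p => g p.1) _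
    rw [integrable_indicator_iff hSm]
    refine Measure.integrableOn_of_bounded (M := B) ?_
      (hg.comp measurable_fst).aestronglyMeasurable (ae_of_all _ fun p => hB p.1)
    refine (measure_mono hSsub).trans_lt ?_ |>.ne
    rw [Measure.prod_prod]
    simp [ENNReal.mul_lt_top]
  have h1 : ∀ w, signalDensity α c w * g w = height α c / L *
      ∫ u, S.indicator (fun p => g p.1) (w, u) := fun w => by
    have h2 : (fun u => S.indicator (fun p => g p.1) (w, u)) =
        (Set.Ioc (l - L) (min (min l w) (2 * l + α - w))).indicator fun _ => g w := by
      ext u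
      by_cases hu : u ∈ Set.Ioc (l - L) (min (min l w) (2 * l + α - w))
      · rw [Set.indicator_of_mem hu, Set.indicator_of_mem]
        simp only [Set.mem_Ioc, le_min_iff] at hu
        exact ⟨hu.1, hu.2.1.1, hu.2.1.2, hu.2.2⟩
      · rw [Set.indicator_of_notMem hu, Set.indicator_of_notMem]
        rintro ⟨h1, h2, h3, h4⟩
        exact hu ⟨h1, le_min (le_min h2 h3) h4⟩
    rw [h2, integral_indicator_const _ measurableSet_Ioc, Measure.real, Real.volume_Ioc,
      ENNReal.toReal_ofReal', signalDensity_eq hα hc, smul_eq_mul, max_comm]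
    ring
  simp_rw [h1]
  rw [integral_const_mul, integral_integral_swap hint,
    intervalIntegral.integral_of_le (by linarith), ← integral_indicator measurableSet_Ioc]
  congr 1
  refine integral_congr_ae (ae_of_all _ fun u => ?_)
  simp only
  by_cases hu : u ∈ Set.Ioc (l - L) l
  · rw [Set.indicator_of_mem hu, intervalIntegral.integral_of_le (by linarith [hu.2]),
      ← integral_Icc_eq_integral_Ioc, ← integral_indicator measurableSet_Icc]
    refine integral_congr_ae (ae_of_all _ fun w => ?_)
    simp only
    by_cases hw : w ∈ Set.Icc u (2 * l + α - u)
    · rw [Set.indicator_of_mem hw, Set.indicator_of_mem]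
      exact ⟨hu.1, hu.2, hw.1, by linarith [hw.2]⟩
    · rw [Set.indicator_of_notMem hw, Set.indicator_of_notMem]
      rintro ⟨h1, h2, h3, h4⟩
      simp only at h4
      exact hw ⟨h3, by linarith⟩
  · rw [Set.indicator_of_notMem hu]
    refine (integral_congr_ae (ae_of_all _ fun w => ?_)).trans (integral_zero _ _)
    rw [Set.indicator_of_notMem]
    rintro ⟨h1, h2, h3, h4⟩
    exact hu ⟨h1, h2⟩

theorem integrable_signalDensity_mul (hα : 0 < α) (hc : 0 < c) {g : ℝ → ℝ} (hg : Measurable g)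
    {B : ℝ} (hB : ∀ w, |g w| ≤ B) : Integrable (fun w => signalDensity α c w * g w) := by
  have h1 : Integrable (signalDensity α c) := by
    refine (continuous_signalDensity hα hc).integrable_of_hasCompactSupport ?_
    exact HasCompactSupport.intro (isCompact_Icc (a := plateau c - slopeLength α c)
      (b := plateau c + α + slopeLength α c)) fun w hw => signalDensity_eq_zero hα hc hw
  exact h1.mul_bdd hg.aestronglyMeasurable (ae_of_all _ hB)

theorem integral_signalDensity (hα : 0 < α) (hc : 0 < c) : ∫ w, signalDensity α c w = 1 := by
  have h := integral_signalDensity_mul hα hc (g := fun _ => 1) measurable_const (B := 1)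
    (by simp)
  simp only [mul_one, intervalIntegral.integral_const, smul_eq_mul] at h
  rw [h]
  have hL := slopeLength_pos hα hc
  have hint : ∫ u in (plateau c - slopeLength α c)..(plateau c), (2 * plateau c + α - u - u) =
      slopeLength α c * (α + slopeLength α c) := by
    have : ∀ u : ℝ, 2 * plateau c + α - u - u = (2 * plateau c + α) - 2 * u := fun u => by ring
    simp_rw [this]
    rw [intervalIntegral.integral_sub (by simp) (by
      exact (continuous_const.mul continuous_id).intervalIntegrable _ _),
      intervalIntegral.integral_const_mul, integral_id]
    simp; ring
  rw [hint, height]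
  field_simp

theorem isProbabilityMeasure_signalLaw (hα : 0 < α) (hc : 0 < c) :
    IsProbabilityMeasure (signalLaw α c) := by
  constructor
  have hi : Integrable (signalDensity α c) := by
    simpa using integrable_signalDensity_mul hα hc (g := fun _ => 1) measurable_const (B := 1)
      (by simp)
  rw [signalLaw, withDensity_apply _ MeasurableSet.univ, Measure.restrict_univ,
    ← ofReal_integral_eq_lintegral_ofReal hi (ae_of_all _ (signalDensity_nonneg hα hc)),
    integral_signalDensity hα hc, ENNReal.ofReal_one]

theorem integral_signalLaw (hα : 0 < α) (hc : 0 < c) (f : ℝ → ℝ) :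
    ∫ w, f w ∂(signalLaw α c) = ∫ w, signalDensity α c w * f w := by
  rw [signalLaw, integral_withDensity_eq_integral_toReal_smul
    (continuous_signalDensity hα hc).measurable.ennreal_ofReal (ae_of_all _ fun _ => by simp)]
  refine integral_congr_ae (ae_of_all _ fun w => ?_)
  simp [ENNReal.toReal_ofReal (signalDensity_nonneg hα hc w)]

end Signal

/-! ### Gaussian integration by parts in the direction of the signal -/

section Shift

theorem integral_gaussianReal_add (v : ℝ≥0) (hv : v ≠ 0) (f : ℝ → ℝ) (w : ℝ) :
    ∫ u, f (w + u) ∂(gaussianReal 0 v) = ∫ t, gaussianPDFReal 0 v (t - w) * f t := by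
  rw [integral_gaussianReal_eq_integral_smul hv,
    ← integral_sub_right_eq_self (fun u => gaussianPDFReal 0 v u • f (w + u)) w]
  simp

theorem hasDerivAt_gaussianPDFReal_sub (v : ℝ≥0) (hv : v ≠ 0) (t w : ℝ) :
    HasDerivAt (fun w => gaussianPDFReal 0 v (t - w))
      (gaussianPDFReal 0 v (t - w) * ((t - w) / v)) w := by
  have hv' : (v : ℝ) ≠ 0 := by exact_mod_cast hv
  have h1 : HasDerivAt (fun w : ℝ => -(t - w - 0) ^ 2 / (2 * v)) ((t - w) / v) w := by
    have := ((((hasDerivAt_id w).const_sub t).sub_const 0).pow 2).neg.div_const (2 * (v : ℝ))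
    refine (this.congr_deriv ?_)
    simp; field_simp
  have h2 := (h1.exp).const_mul (√(2 * Real.pi * v))⁻¹
  simp only [gaussianPDFReal]
  exact h2.congr_deriv (by ring)

theorem integrable_fun_id_gaussianReal (v : ℝ≥0) :
    Integrable (fun u : ℝ => u) (gaussianReal 0 v) :=
  (memLp_id_gaussianReal (μ := 0) (v := v) 1).integrable (by simp)

theorem integrable_mul_gaussianPDFReal (v : ℝ≥0) (hv : v ≠ 0) :
    Integrable fun u => gaussianPDFReal 0 v u * (u / v) := by
  have h := integrable_fun_id_gaussianReal v
  rw [gaussianReal_of_var_ne_zero _ hv, integrable_withDensity_iff_integrable_smul'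
    (measurable_gaussianPDF _ _) (ae_of_all _ fun _ => gaussianPDF_lt_top)] at h
  refine (h.div_const (v : ℝ)).congr (ae_of_all _ fun u => ?_)
  simp only [toReal_gaussianPDF, smul_eq_mul]
  ring

/-- Since `s` is only measurable, the derivative in the shift is moved to the Gaussian density,
where it produces the factor u/v. The integrated form follows from the fundamental theorem of
calculus and Fubini. -/
theorem gaussianReal_shift_sub (v : ℝ≥0) (hv : v ≠ 0) {s : ℝ → ℝ} (hs : Measurable s)
    (hb : ∀ t, |s t| ≤ 1) {w₁ w₂ : ℝ} (hw : w₁ ≤ w₂) :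
    ∫ u, s (w₂ + u) ∂(gaussianReal 0 v) - ∫ u, s (w₁ + u) ∂(gaussianReal 0 v) =
      ∫ w in w₁..w₂, ∫ u, s (w + u) * (u / v) ∂(gaussianReal 0 v) := by
  have hv' : (v : ℝ) ≠ 0 := by exact_mod_cast hv
  have hi : ∀ w, Integrable fun t => gaussianPDFReal 0 v (t - w) * s t := fun w =>
    ((integrable_gaussianPDFReal 0 v).comp_sub_right w).mul_bdd hs.aestronglyMeasurable
      (ae_of_all _ hb)
  rw [integral_gaussianReal_add v hv, integral_gaussianReal_add v hv, ← integral_sub (hi _) (hi _)]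
  have h1 : ∀ w, ∫ u, s (w + u) * (u / v) ∂(gaussianReal 0 v) =
      ∫ t, gaussianPDFReal 0 v (t - w) * ((t - w) / v) * s t := fun w => by
    have := integral_gaussianReal_add v hv (fun t => s t * ((t - w) / v)) w
    simp only [add_sub_cancel_left] at this
    rw [this]
    exact integral_congr_ae (ae_of_all _ fun t => by simp only; ring)
  simp_rw [h1]
  have hcont : Continuous (gaussianPDFReal 0 v) := by
    unfold gaussianPDFReal; fun_prop
  have h2 : ∀ t, gaussianPDFReal 0 v (t - w₂) * s t - gaussianPDFReal 0 v (t - w₁) * s t =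
      ∫ w in w₁..w₂, gaussianPDFReal 0 v (t - w) * ((t - w) / v) * s t := fun t => by
    rw [intervalIntegral.integral_mul_const,
      intervalIntegral.integral_eq_sub_of_hasDerivAt
        (fun w _ => hasDerivAt_gaussianPDFReal_sub v hv t w)]
    · ring
    · exact Continuous.intervalIntegrable (by fun_prop) _ _
  simp_rw [h2, intervalIntegral.integral_of_le hw]
  refine integral_integral_swap ?_
  have hK := integrable_mul_gaussianPDFReal v hv
  have h0 : Measurable (Function.uncurry fun t w =>
      gaussianPDFReal 0 v (t - w) * ((t - w) / v) * s t) := by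
    have := hcont.measurable
    unfold Function.uncurry
    fun_prop
  have hm : AEStronglyMeasurable (Function.uncurry fun t w =>
      gaussianPDFReal 0 v (t - w) * ((t - w) / v) * s t)
      (volume.prod (volume.restrict (Set.Ioc w₁ w₂))) := h0.aestronglyMeasurable
  rw [integrable_prod_iff' hm]
  constructor
  · exact ae_of_all _ fun w => (hK.comp_sub_right w).mul_bdd hs.aestronglyMeasurable
      (ae_of_all _ hb)
  -- Translation invariance makes the L¹ norm of the differentiated density the same for all `w`.
  · refine Measure.integrableOn_of_bounded (s := Set.Ioc w₁ w₂)
      (M := ∫ u, ‖gaussianPDFReal 0 v u * (u / v)‖) (by simp) ?_ (ae_of_all _ fun w => ?_)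
    · exact (h0.norm.stronglyMeasurable.integral_prod_left').aestronglyMeasurable
    · rw [Real.norm_of_nonneg (integral_nonneg fun _ => norm_nonneg _),
        ← integral_sub_right_eq_self (fun u => ‖gaussianPDFReal 0 v u * (u / v)‖) w]
      refine integral_mono ((hK.comp_sub_right w).mul_bdd hs.aestronglyMeasurable
        (ae_of_all _ hb)).norm (hK.comp_sub_right w).norm fun t => ?_
      simp only [Function.uncurry_apply_pair]
      rw [norm_mul]
      exact mul_le_of_le_one_right (norm_nonneg _) (hb t)

end Shift

/-! ### Noise along an imitating direction acts as signal -/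

section Direction

variable {n k : ℕ}

/-- The component of `z` orthogonal to `x`. -/
noncomputable def orthPart (x z : Fin n → ℝ) : Fin n → ℝ := z - (x ⬝ᵥ z / x ⬝ᵥ x) • x

theorem continuous_dotProduct_left (x : Fin n → ℝ) : Continuous fun z : Fin n → ℝ => x ⬝ᵥ z := by
  unfold dotProduct; fun_prop

theorem continuous_orthPart (x : Fin n → ℝ) : Continuous (orthPart x) := by
  have := continuous_dotProduct_left x
  unfold orthPart
  fun_prop

theorem dotProduct_self_pos' {x : Fin n → ℝ} (hx0 : x ≠ 0) : 0 < x ⬝ᵥ x := by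
  rcases (Finset.sum_nonneg fun i _ => mul_self_nonneg (x i)).lt_or_eq with h | h
  · exact h
  · exact absurd (dotProduct_self_eq_zero.1 h.symm) hx0

theorem dotProduct_orthPart {x : Fin n → ℝ} (hx0 : x ≠ 0) (z : Fin n → ℝ) :
    x ⬝ᵥ orthPart x z = 0 := by
  have := (dotProduct_self_pos' hx0).ne'
  rw [orthPart, dotProduct_sub, dotProduct_smul, smul_eq_mul, div_mul_cancel₀ _ this, sub_self]

/-- The variance of the estimation error in the direction `x`. -/
noncomputable def dirVar (c : ℝ) (M : Finset (Fin n)) (x : Fin n → ℝ) : ℝ≥0 :=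
  Real.toNNReal (c ^ 2 / x ⬝ᵥ x / M.card)

theorem dirVar_ne_zero {c : ℝ} (hc : 0 < c) {M : Finset (Fin n)} (hM : 0 < M.card)
    {x : Fin n → ℝ} (hx0 : x ≠ 0) : dirVar c M x ≠ 0 := by
  have := dotProduct_self_pos' hx0
  have hm : (0 : ℝ) < M.card := by exact_mod_cast hM
  rw [dirVar, Ne, Real.toNNReal_eq_zero, not_le]
  positivity

theorem coe_dirVar {c : ℝ} (hc : 0 < c) {M : Finset (Fin n)} {x : Fin n → ℝ} (hx0 : x ≠ 0) :
    (dirVar c M x : ℝ) = c ^ 2 / x ⬝ᵥ x / M.card := by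
  have := dotProduct_self_pos' hx0
  exact Real.coe_toNNReal _ (by positivity)

/-- `noiseLaw_map_split` for the projection to the line of `x`. The scalar is normalized as c
(x·z)/(x·x), the amount by which noise along `x` appears to shift the signal when A x = A e_h. -/
theorem noiseLaw_map_direction {c : ℝ} (hc : 0 < c) (M : Finset (Fin n)) {x : Fin n → ℝ}
    (hx : ∀ i, i ∉ M → x i = 0) (hx0 : x ≠ 0) :
    ((gaussianReal 0 (dirVar c M x)).prod (noiseLaw M)).map
      (fun p => (p.1 / c) • x + orthPart x p.2) = noiseLaw M := by
  have hq := dotProduct_self_pos' hx0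
  let Q : (Fin n → ℝ) →ₗ[ℝ] (Fin n → ℝ) :=
    { toFun := fun z => (x ⬝ᵥ z / x ⬝ᵥ x) • x
      map_add' := fun y z => by rw [dotProduct_add, add_div, add_smul]
      map_smul' := fun r z => by
        rw [dotProduct_smul, smul_eq_mul, mul_div_assoc, mul_smul]; rfl }
  have hQ : ∀ z, Q z = (x ⬝ᵥ z / x ⬝ᵥ x) • x := fun z => rfl
  have h1 := noiseLaw_map_split M Q (fun a b => by
      rw [hQ, hQ, smul_dotProduct, dotProduct_smul, dotProduct_comm a x, smul_eq_mul, smul_eq_mul]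
      ring) (fun a => by
      rw [hQ, hQ, dotProduct_smul, smul_eq_mul, div_mul_cancel₀ _ hq.ne'])
      (fun a i hi => by rw [hQ, Pi.smul_apply, hx i hi, smul_zero])
  have h2 := noiseLaw_map_dotProduct M ((c / x ⬝ᵥ x) • x) (fun i hi => by
    rw [Pi.smul_apply, hx i hi, smul_zero])
  have h3 : ((c / x ⬝ᵥ x) • x) ⬝ᵥ ((c / x ⬝ᵥ x) • x) = c ^ 2 / x ⬝ᵥ x := by
    rw [smul_dotProduct, dotProduct_smul, smul_eq_mul, smul_eq_mul]; field_simp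
  rw [h3] at h2
  have hc1 := (continuous_dotProduct_left ((c / x ⬝ᵥ x) • x)).measurable
  have hc2 := (continuous_orthPart x).measurable
  have h4 : noiseLaw M = (noiseLaw M).map id := Measure.map_id.symm
  conv_lhs => rw [dirVar, ← h2]
  nth_rewrite 2 [h4]
  rw [Measure.map_prod_map _ _ hc1 measurable_id, Measure.map_map (by fun_prop) (by fun_prop)]
  convert h1 using 2
  ext1 p
  simp only [Function.comp, Prod.map, hQ, orthPart, id, smul_dotProduct, smul_eq_mul]
  congr 2
  field_simp

theorem mulVec_query (A : Matrix (Fin k) (Fin n) ℝ) (h : Fin n) (c w : ℝ) (z : Fin n → ℝ) :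
    A.mulVec (query h c w z) = w • A.mulVec (Pi.single h 1) + c • A.mulVec z := by
  rw [query, Matrix.mulVec_add, Matrix.mulVec_smul, Matrix.mulVec_smul]

theorem mulVec_query_direction {A : Matrix (Fin k) (Fin n) ℝ} {h : Fin n} {c : ℝ} (hc : c ≠ 0)
    {x : Fin n → ℝ} (hA : A.mulVec x = A.mulVec (Pi.single h 1)) (w u : ℝ) (z : Fin n → ℝ) :
    A.mulVec (query h c w ((u / c) • x + z)) =
      (w + u) • A.mulVec (Pi.single h 1) + c • A.mulVec z := by
  rw [mulVec_query, Matrix.mulVec_add, Matrix.mulVec_smul, hA, smul_add, smul_smul,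
    mul_div_cancel₀ _ hc, add_smul, add_assoc]

theorem measurable_mulVec (A : Matrix (Fin k) (Fin n) ℝ) : Measurable A.mulVec :=
  (LinearMap.continuous_of_finiteDimensional A.mulVecLin).measurable

theorem measurable_query (h : Fin n) (c : ℝ) :
    Measurable fun p : ℝ × (Fin n → ℝ) => query h c p.1 p.2 := by
  unfold query
  fun_prop

variable (A : Matrix (Fin k) (Fin n) ℝ) (h : Fin n) (M : Finset (Fin n)) (c : ℝ)
  (x : Fin n → ℝ) (s : (Fin k → ℝ) → ℝ)

/-- The mean response to a query of signal weight `w`. -/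
noncomputable def meanResponse (w : ℝ) : ℝ :=
  ∫ z, s (A.mulVec (query h c w z)) ∂(noiseLaw M)

/-- The mean of the response to a query of signal weight `w`, multiplied with the component of the
noise in direction `x`. -/
noncomputable def dirResponse (w : ℝ) : ℝ :=
  ∫ z, s (A.mulVec (query h c w z)) * (M.card * (x ⬝ᵥ z) / c) ∂(noiseLaw M)

variable {A h M c x s}

theorem measurable_response_comp (hs : Measurable s) :
    Measurable fun p : ℝ × (Fin n → ℝ) => s (A.mulVec (query h c p.1 p.2)) :=
  hs.comp ((measurable_mulVec A).comp (measurable_query h c))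

theorem measurable_meanResponse (hs : Measurable s) : Measurable (meanResponse A h M c s) :=
  ((measurable_response_comp hs).stronglyMeasurable.integral_prod_right').measurable

theorem measurable_dirResponse (hs : Measurable s) : Measurable (dirResponse A h M c x s) := by
  have := (continuous_dotProduct_left x).measurable
  have h2 : Measurable fun p : ℝ × (Fin n → ℝ) =>
      s (A.mulVec (query h c p.1 p.2)) * (M.card * (x ⬝ᵥ p.2) / c) :=
    (measurable_response_comp hs).mul (by fun_prop)
  exact (h2.stronglyMeasurable.integral_prod_right').measurable

theorem abs_meanResponse_le (hb : ∀ y, |s y| ≤ 1) (w : ℝ) : |meanResponse A h M c s w| ≤ 1 := by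
  have := norm_integral_le_of_norm_le_const (μ := noiseLaw M)
    (f := fun z => s (A.mulVec (query h c w z))) (C := 1) (ae_of_all _ fun z => hb _)
  simpa [meanResponse] using this

theorem integrable_dotProduct (hx : ∀ i, i ∉ M → x i = 0) :
    Integrable (fun z => x ⬝ᵥ z) (noiseLaw M) := by
  simpa using integrable_dotProduct_pow M x hx 1

theorem abs_dirResponse_le (hx : ∀ i, i ∉ M → x i = 0) (hb : ∀ y, |s y| ≤ 1) (w : ℝ) :
    |dirResponse A h M c x s w| ≤ ∫ z, ‖M.card * (x ⬝ᵥ z) / c‖ ∂(noiseLaw M) := by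
  have hi : Integrable (fun z => ‖M.card * (x ⬝ᵥ z) / c‖) (noiseLaw M) :=
    (((integrable_dotProduct hx).const_mul (M.card : ℝ)).div_const c).norm
  rw [dirResponse, ← Real.norm_eq_abs]
  refine norm_integral_le_of_norm_le hi (ae_of_all _ fun z => ?_)
  rw [norm_mul]
  exact mul_le_of_le_one_left (norm_nonneg _) (hb _)

/-- Stein's identity in the direction of the signal. As A x = A e_h, averaging over the noise
orthogonal to `x` turns the response into a function `sbar` of w + u alone, to which
`gaussianReal_shift_sub` applies; the weight m (x·z)/c of `dirResponse` is exactly u/v. -/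
theorem meanResponse_sub (hc : 0 < c) (hM : 0 < M.card) (hx : ∀ i, i ∉ M → x i = 0)
    (hA : A.mulVec x = A.mulVec (Pi.single h 1)) (hs : Measurable s) (hb : ∀ y, |s y| ≤ 1)
    {w₁ w₂ : ℝ} (hw : w₁ ≤ w₂) :
    meanResponse A h M c s w₂ - meanResponse A h M c s w₁ =
      ∫ w in w₁..w₂, dirResponse A h M c x s w := by
  have hm : (0 : ℝ) < M.card := by exact_mod_cast hM
  -- If x = 0 then A e_h = 0: the sketch carries no signal and both sides vanish. This case is
  -- separate because `dirVar` divides by x·x.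
  by_cases hx0 : x = 0
  · subst hx0
    rw [Matrix.mulVec_zero] at hA
    have h1 : ∀ w, dirResponse A h M c 0 s w = 0 := fun w => by simp [dirResponse]
    have h2 : ∀ w, meanResponse A h M c s w = meanResponse A h M c s 0 := fun w => by
      simp only [meanResponse, mulVec_query, ← hA, smul_zero]
    rw [h2 w₁, h2 w₂]; simp [h1]
  set v := dirVar c M x
  have hv : v ≠ 0 := dirVar_ne_zero hc hM hx0
  have hq := dotProduct_self_pos' hx0
  let sbar : ℝ → ℝ := fun t =>
    ∫ z, s (t • A.mulVec (Pi.single h 1) + c • A.mulVec (orthPart x z)) ∂(noiseLaw M)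
  have hmA := measurable_mulVec A
  have hmo := (continuous_orthPart x).measurable
  have hmd := (continuous_dotProduct_left x).measurable
  have hjm : Measurable fun p : ℝ × (Fin n → ℝ) =>
      s (p.1 • A.mulVec (Pi.single h 1) + c • A.mulVec (orthPart x p.2)) := by
    refine hs.comp ?_
    fun_prop
  have hsm : Measurable sbar := (hjm.stronglyMeasurable.integral_prod_right').measurable
  have hsb : ∀ t, |sbar t| ≤ 1 := fun t => by
    have := norm_integral_le_of_norm_le_const (μ := noiseLaw M) (C := 1)
      (f := fun z => s (t • A.mulVec (Pi.single h 1) + c • A.mulVec (orthPart x z)))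
      (ae_of_all _ fun z => hb _)
    simpa [sbar] using this
  have hmap := noiseLaw_map_direction hc M hx hx0
  have hmm : Measurable fun p : ℝ × (Fin n → ℝ) => (p.1 / c) • x + orthPart x p.2 := by fun_prop
  have hmw : ∀ w, Measurable fun z : Fin n → ℝ => s (A.mulVec (query h c w z)) := fun w =>
    (measurable_response_comp hs).comp (measurable_const.prodMk measurable_id)
  have hjw : ∀ w, Measurable fun p : ℝ × (Fin n → ℝ) =>
      s ((w + p.1) • A.mulVec (Pi.single h 1) + c • A.mulVec (orthPart x p.2)) := fun w =>
    hjm.comp ((measurable_const.add measurable_fst).prodMk measurable_snd)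
  have e1 : ∀ w, meanResponse A h M c s w = ∫ u, sbar (w + u) ∂(gaussianReal 0 v) := fun w => by
    rw [meanResponse]
    conv_lhs => rw [← hmap]
    rw [integral_map hmm.aemeasurable (hmw w).aestronglyMeasurable]
    simp_rw [mulVec_query_direction hc.ne' hA]
    rw [integral_prod]
    exact Integrable.of_bound (hjw w).aestronglyMeasurable 1 (ae_of_all _ fun p => hb _)
  have hiu : Integrable (fun u : ℝ => u / v) (gaussianReal 0 v) := by
    exact (integrable_fun_id_gaussianReal v).div_const _
  have e2 : ∀ w, dirResponse A h M c x s w =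
      ∫ u, sbar (w + u) * (u / v) ∂(gaussianReal 0 v) := fun w => by
    rw [dirResponse]
    conv_lhs => rw [← hmap]
    have hmz : Measurable fun z : Fin n → ℝ =>
        s (A.mulVec (query h c w z)) * (M.card * (x ⬝ᵥ z) / c) :=
      (hmw w).mul (by fun_prop)
    rw [integral_map hmm.aemeasurable hmz.aestronglyMeasurable]
    simp_rw [mulVec_query_direction hc.ne' hA, dotProduct_add, dotProduct_orthPart hx0,
      dotProduct_smul, smul_eq_mul, add_zero]
    have e3 : ∀ u : ℝ, M.card * (u / c * x ⬝ᵥ x) / c = u / v := fun u => by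
      rw [coe_dirVar hc hx0]; field_simp
    simp_rw [e3]
    rw [integral_prod]
    · simp_rw [integral_mul_const]
      rfl
    · exact (hiu.comp_fst (noiseLaw M)).bdd_mul (hjw w).aestronglyMeasurable
        (ae_of_all _ fun p => hb _)
  rw [e1, e1, gaussianReal_shift_sub v hv hsm hsb hw]
  simp_rw [e2]

/-- The correlation of the responses with the direction `x` of the noise, in terms of the mean
responses on the slopes of the signal density. -/
theorem integral_signalDensity_mul_dirResponse {α : ℝ} (hα : 0 < α) (hc : 0 < c)
    (hM : 0 < M.card) (hx : ∀ i, i ∉ M → x i = 0)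
    (hA : A.mulVec x = A.mulVec (Pi.single h 1)) (hs : Measurable s) (hb : ∀ y, |s y| ≤ 1) :
    ∫ w, signalDensity α c w * dirResponse A h M c x s w = height α c / slopeLength α c *
      ((∫ w in (plateau c + α)..(plateau c + α + slopeLength α c), meanResponse A h M c s w) -
        ∫ w in (plateau c - slopeLength α c)..(plateau c), meanResponse A h M c s w) := by
  rw [integral_signalDensity_mul hα hc (measurable_dirResponse hs) (abs_dirResponse_le hx hb)]
  have hL := slopeLength_pos hα hc
  have hG : ∀ a b : ℝ, IntervalIntegrable (meanResponse A h M c s) volume a b := fun a b =>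
    (intervalIntegrable_const (c := (1 : ℝ))).mono_fun
      (measurable_meanResponse hs).aestronglyMeasurable
      (ae_of_all _ fun w => by simpa using abs_meanResponse_le hb w)
  congr 1
  -- Each uniform component of the mixture integrates a derivative, so only the mean responses at
  -- its two endpoints, one on each slope, remain.
  have h1 : ∫ u in (plateau c - slopeLength α c)..(plateau c),
      ∫ w in u..(2 * plateau c + α - u), dirResponse A h M c x s w =
      ∫ u in (plateau c - slopeLength α c)..(plateau c),
        (meanResponse A h M c s (2 * plateau c + α - u) - meanResponse A h M c s u) := by
    refine intervalIntegral.integral_congr fun u hu => ?_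
    rw [Set.uIcc_of_le (by linarith)] at hu
    exact (meanResponse_sub hc hM hx hA hs hb (by linarith [hu.2])).symm
  rw [h1, intervalIntegral.integral_sub _ (hG _ _),
    intervalIntegral.integral_comp_sub_left (fun w => meanResponse A h M c s w)]
  · congr 2 <;> ring
  · have := (hG (plateau c + α + slopeLength α c) (plateau c + α)).comp_sub_left
      (2 * plateau c + α)
    convert this using 1 <;> ring

end Direction

/-! ### A single step of the attack for supports of large size -/

section LargeSupport

variable {α c : ℝ}

theorem mul_sub_le_intervalIntegral {f : ℝ → ℝ} {a b m : ℝ} (hab : a ≤ b)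
    (hf : IntervalIntegrable f volume a b) (h : ∀ w ∈ Set.Icc a b, m ≤ f w) :
    m * (b - a) ≤ ∫ w in a..b, f w := by
  have := intervalIntegral.integral_mono_on hab (intervalIntegrable_const (c := m)) hf h
  rwa [intervalIntegral.integral_const, smul_eq_mul, mul_comm] at this

/-- `G` plays the mean response and `p` the error probability. The almost fully controlled upper
slope contributes nearly +L and outweighs the worst case -L of the lower slope, where only a window
of length below α next to the plateau is controlled: further down `w` may be so negative that the
query is long again. -/
theorem slope_gap (hα : 0 < α) (hc : 0 < c) (hc1 : c ≤ 1 / 10) {G p : ℝ → ℝ}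
    (hG : Measurable G) (hGb : ∀ w, |G w| ≤ 1) (hp : Measurable p) (hp0 : ∀ w, 0 ≤ p w)
    (hp2 : ∀ w, p w ≤ 2)
    (hlow : ∀ w ∈ Set.Icc (plateau c - α) (plateau c - α / 20), (1 + G w) / 2 ≤ p w)
    (hhigh : ∀ w ∈ Set.Icc (plateau c + 6 / 5 * α) (plateau c + α + slopeLength α c - α / 10),
      (1 - G w) / 2 ≤ p w) :
    13 / 10 * α ≤ (∫ w in (plateau c + α)..(plateau c + α + slopeLength α c), G w) -
      (∫ w in (plateau c - slopeLength α c)..(plateau c), G w) +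
      200 / (height α c * c) * ∫ w, signalDensity α c w * p w := by
  have hL := slopeLength_pos hα hc
  have hH := height_pos hα hc
  have hLα : 100 * α ≤ slopeLength α c := by
    rw [slopeLength, le_div_iff₀ hc]; nlinarith
  have hLc : slopeLength α c * c = 10 * α := by rw [slopeLength]; field_simp
  set l := plateau c
  set L := slopeLength α c
  set H := height α c
  set F : ℝ → ℝ := fun w => 200 / (H * c) * (signalDensity α c w * p w) with hF
  have hFint : Integrable F := (integrable_signalDensity_mul hα hc hp (B := 2) (fun w => by
    rw [abs_of_nonneg (hp0 w)]; exact hp2 w)).const_mul _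
  have hF0 : ∀ w, 0 ≤ F w := fun w => by
    have := signalDensity_nonneg hα hc w
    have := hp0 w
    simp only [hF]; positivity
  have hFi : ∀ a b : ℝ, IntervalIntegrable F volume a b := fun a b => hFint.intervalIntegrable
  have hGi : ∀ a b : ℝ, IntervalIntegrable G volume a b := fun a b =>
    (intervalIntegrable_const (c := (1 : ℝ))).mono_fun
      hG.aestronglyMeasurable (ae_of_all _ fun w => by simpa using hGb w)
  -- At distance α/10 from the ends of its support the density is at least (H/L)(α/10) = Hc/100, so
  -- the factor 200/(Hc) turns it into at least 2.
  have hdens : ∀ w, l - L + α / 10 ≤ w → w ≤ l + α + L - α / 10 →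
      2 * p w ≤ F w := by
    intro w h1 h2
    have h3 : H * c / 100 ≤ signalDensity α c w := by
      rw [signalDensity_eq hα hc]
      have h4 : α / 10 ≤ min (min l w) (2 * l + α - w) - (l - L) := by
        rw [le_sub_iff_add_le, le_min_iff, le_min_iff]
        refine ⟨⟨by linarith, by linarith⟩, by linarith⟩
      have h5 : H / L * (α / 10) = H * c / 100 := by
        have : α = L * c / 10 := by linarith
        rw [this]; field_simp; norm_num
      rw [← h5]
      exact mul_le_mul_of_nonneg_left (h4.trans (le_max_right _ _)) (by positivity)
    have h6 : 200 / (H * c) * (H * c / 100 * p w) ≤ F w :=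
      mul_le_mul_of_nonneg_left (mul_le_mul_of_nonneg_right h3 (hp0 w)) (by positivity)
    have h7 : 200 / (H * c) * (H * c / 100 * p w) = 2 * p w := by field_simp; ring
    linarith
  have hGl := fun w => (abs_le.1 (hGb w)).1
  have hGu := fun w => (abs_le.1 (hGb w)).2
  have htot : ∫ w in (l - L)..(l + α + L), F w ≤ 200 / (H * c) * ∫ w, signalDensity α c w * p w := by
    rw [← integral_const_mul, intervalIntegral.integral_of_le (by linarith)]
    exact setIntegral_le_integral hFint (ae_of_all _ hF0)
  rw [← intervalIntegral.integral_add_adjacent_intervals (hFi (l - L) l) (hFi l (l + α + L)),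
    ← intervalIntegral.integral_add_adjacent_intervals (hFi l (l + α)) (hFi (l + α) (l + α + L))]
    at htot
  have hmid : 0 ≤ ∫ w in l..(l + α), F w :=
    intervalIntegral.integral_nonneg (by linarith) fun w _ => hF0 w
  have hA : ∫ w in (l - L)..l, (F w - G w) =
      (∫ w in (l - L)..(l - α), (F w - G w)) + (∫ w in (l - α)..(l - α / 20), (F w - G w)) +
      ∫ w in (l - α / 20)..l, (F w - G w) := by
    rw [intervalIntegral.integral_add_adjacent_intervals ((hFi _ _).sub (hGi _ _))
      ((hFi _ _).sub (hGi _ _)), intervalIntegral.integral_add_adjacent_intervals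
      ((hFi _ _).sub (hGi _ _)) ((hFi _ _).sub (hGi _ _))]
  have hB : ∫ w in (l + α)..(l + α + L), (F w + G w) =
      (∫ w in (l + α)..(l + 6 / 5 * α), (F w + G w)) +
      (∫ w in (l + 6 / 5 * α)..(l + α + L - α / 10), (F w + G w)) +
      ∫ w in (l + α + L - α / 10)..(l + α + L), (F w + G w) := by
    rw [intervalIntegral.integral_add_adjacent_intervals ((hFi _ _).add (hGi _ _))
      ((hFi _ _).add (hGi _ _)), intervalIntegral.integral_add_adjacent_intervals
      ((hFi _ _).add (hGi _ _)) ((hFi _ _).add (hGi _ _))]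
  -- The balance: the lower slope gives -(L - α) + 19α/20 - α/20 and the upper slope -α/5 + (L -
  -- 3α/10) - α/10, in total 13α/10.
  have a1 := mul_sub_le_intervalIntegral (m := -1) (by linarith : l - L ≤ l - α)
    ((hFi _ _).sub (hGi _ _)) fun w _ => by linarith [hF0 w, hGu w]
  have a2 := mul_sub_le_intervalIntegral (m := 1) (by linarith : l - α ≤ l - α / 20)
    ((hFi _ _).sub (hGi _ _)) fun w hw => by
      linarith [hlow w hw, hdens w (by linarith [hw.1]) (by linarith [hw.2])]
  have a3 := mul_sub_le_intervalIntegral (m := -1) (by linarith : l - α / 20 ≤ l)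
    ((hFi _ _).sub (hGi _ _)) fun w _ => by linarith [hF0 w, hGu w]
  have b1 := mul_sub_le_intervalIntegral (m := -1) (by linarith : l + α ≤ l + 6 / 5 * α)
    ((hFi _ _).add (hGi _ _)) fun w _ => by linarith [hF0 w, hGl w]
  have b2 := mul_sub_le_intervalIntegral (m := 1)
    (by linarith : l + 6 / 5 * α ≤ l + α + L - α / 10)
    ((hFi _ _).add (hGi _ _)) fun w hw => by
      linarith [hhigh w hw, hdens w (by linarith [hw.1]) (by linarith [hw.2])]
  have b3 := mul_sub_le_intervalIntegral (m := -1) (by linarith : l + α + L - α / 10 ≤ l + α + L)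
    ((hFi _ _).add (hGi _ _)) fun w _ => by linarith [hF0 w, hGl w]
  rw [intervalIntegral.integral_sub (hFi _ _) (hGi _ _)] at hA
  rw [intervalIntegral.integral_add (hFi _ _) (hGi _ _)] at hB
  linarith

variable {n k : ℕ}

theorem l2norm_sq (v : Fin n → ℝ) : l2norm v ^ 2 = ∑ i, v i ^ 2 := by
  rw [l2norm, EuclideanSpace.norm_sq_eq]
  simp

theorem l2norm_nonneg (v : Fin n → ℝ) : 0 ≤ l2norm v := norm_nonneg _

theorem continuous_l2norm : Continuous (l2norm : (Fin n → ℝ) → ℝ) := by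
  unfold l2norm
  exact (PiLp.continuous_toLp 2 _).norm

theorem l2norm_query_sq {h : Fin n} {M : Finset (Fin n)} (hh : h ∉ M) {z : Fin n → ℝ}
    (hz : ∀ i, i ∉ M → z i = 0) (c w : ℝ) :
    l2norm (query h c w z) ^ 2 = w ^ 2 + c ^ 2 * ∑ i ∈ M, z i ^ 2 := by
  rw [l2norm_sq, Finset.sum_subset (Finset.subset_univ M) fun i _ hi => by simp [hz i hi],
    Finset.mul_sum, ← Finset.sum_add_sum_compl {h}, ← Finset.sum_add_sum_compl {h}
      (fun i => c ^ 2 * z i ^ 2)]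
  simp only [Finset.sum_singleton, query, Pi.add_apply, Pi.smul_apply, smul_eq_mul,
    Pi.single_eq_same, hz h hh]
  rw [Finset.sum_congr rfl fun i hi => ?_]
  rotate_left
  · exact fun i => c ^ 2 * z i ^ 2
  · have : i ≠ h := by simpa using hi
    rw [Pi.single_eq_of_ne this]; ring
  ring

/-- The pairs of a signal weight and a noise vector on whose query the responder `s` errs. -/
def errorSet (A : Matrix (Fin k) (Fin n) ℝ) (h : Fin n) (α c : ℝ) (s : (Fin k → ℝ) → ℝ) :
    Set (ℝ × (Fin n → ℝ)) :=
  {p | ¬ IsGapAnswer 1 α (l2norm (query h c p.1 p.2)) (s (A.mulVec (query h c p.1 p.2)))}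

variable {A : Matrix (Fin k) (Fin n) ℝ} {h : Fin n} {M : Finset (Fin n)}
  {x : Fin n → ℝ} {s : (Fin k → ℝ) → ℝ}

theorem measurableSet_gap {Z : Type*} [MeasurableSpace Z] {f g : Z → ℝ} (hf : Measurable f)
    (hg : Measurable g) (y : ℝ) : MeasurableSet {z | ¬ IsGapAnswer y α (f z) (g z)} := by
  have e : {z | IsGapAnswer y α (f z) (g z)} = ({z | g z = -1} ∪ {z | g z = 1}) ∩
      (({z | y < f z} ∪ {z | g z = -1}) ∩ ({z | f z < y + α} ∪ {z | g z = 1})) := by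
    ext z
    simp only [IsGapAnswer, Set.mem_ofPred_eq, Set.mem_inter_iff, Set.mem_union, ← not_le,
      imp_iff_not_or]
  have h1 : ∀ a : ℝ, MeasurableSet {z | g z = a} := fun a => hg (measurableSet_singleton a)
  have h2 : MeasurableSet {z | IsGapAnswer y α (f z) (g z)} := by
    rw [e]
    exact ((h1 _).union (h1 _)).inter (((measurableSet_lt measurable_const hf).union (h1 _)).inter
      ((measurableSet_lt hf measurable_const).union (h1 _)))
  exact h2.compl

theorem measurableSet_errorSet (hs : Measurable s) : MeasurableSet (errorSet A h α c s) :=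
  measurableSet_gap (continuous_l2norm.measurable.comp (measurable_query h c))
    (measurable_response_comp hs) 1

theorem plateau_bounds (hc : 0 < c) (hc1 : c ≤ 1 / 10) :
    99 / 100 ≤ plateau c ∧ plateau c ≤ 1 ∧ plateau c ^ 2 = 1 - c ^ 2 := by
  have h1 : 0 ≤ 1 - c ^ 2 := by nlinarith
  refine ⟨Real.le_sqrt_of_sq_le (by nlinarith), Real.sqrt_le_one.2 (by nlinarith),
    Real.sq_sqrt h1⟩

/-- Lowering the weight by α/20 lowers its square by about lα/10, which covers the excess c²α of the
noise. The bound w ≥ l - α keeps `w` away from large negative values, so that the upper bound may be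
squared. -/
theorem mem_errorSet_of_low (hα : 0 < α) (hα1 : α < 1) (hc : 0 < c) (hc1 : c ≤ 1 / 10)
    (hh : h ∉ M) {z : Fin n → ℝ} (hz : ∀ i, i ∉ M → z i = 0)
    (hdev : |∑ i ∈ M, z i ^ 2 - 1| < α) {w : ℝ}
    (hw : w ∈ Set.Icc (plateau c - α) (plateau c - α / 20))
    (hs : s (A.mulVec (query h c w z)) = 1) : (w, z) ∈ errorSet A h α c s := by
  intro hgap
  obtain ⟨hl, hl1, hlsq⟩ := plateau_bounds hc hc1
  have h1 : l2norm (query h c w z) ≤ 1 := by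
    rw [← sq_le_one_iff₀ (l2norm_nonneg _), l2norm_query_sq hh hz]
    have h2 := (abs_lt.1 hdev).2
    have h3 : c ^ 2 * ∑ i ∈ M, z i ^ 2 ≤ c ^ 2 * (1 + α) :=
      mul_le_mul_of_nonneg_left (by linarith) (sq_nonneg c)
    have h4 : w ^ 2 ≤ (plateau c - α / 20) ^ 2 :=
      sq_le_sq' (by linarith [hw.1]) hw.2
    have h5 : c ^ 2 ≤ 1 / 100 := by nlinarith
    have h6 := mul_le_mul_of_nonneg_right h5 hα.le
    have h7 := mul_le_mul_of_nonneg_right hl hα.le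
    have h8 : α ^ 2 ≤ α := by nlinarith
    have h9 : (plateau c - α / 20) ^ 2 = plateau c ^ 2 - plateau c * α / 10 + α ^ 2 / 400 := by
      ring
    linarith
  have := hgap.2.1 h1
  simp only at this
  rw [hs] at this
  norm_num at this

/-- The shift 6α/5 instead of α pays for l < 1 and for the deficit c²α of the noise: 12l/5 ≥ 2 + c².
-/
theorem mem_errorSet_of_high (hα : 0 < α) (hc : 0 < c) (hc1 : c ≤ 1 / 10)
    (hh : h ∉ M) {z : Fin n → ℝ} (hz : ∀ i, i ∉ M → z i = 0)
    (hdev : |∑ i ∈ M, z i ^ 2 - 1| < α) {w : ℝ} (hw : plateau c + 6 / 5 * α ≤ w)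
    (hs : s (A.mulVec (query h c w z)) = -1) : (w, z) ∈ errorSet A h α c s := by
  intro hgap
  obtain ⟨hl, hl1, hlsq⟩ := plateau_bounds hc hc1
  have h1 : 1 + α ≤ l2norm (query h c w z) := by
    rw [← sq_le_sq₀ (by linarith) (l2norm_nonneg _), l2norm_query_sq hh hz]
    have h2 := (abs_lt.1 hdev).1
    have h3 : c ^ 2 * (1 - α) ≤ c ^ 2 * ∑ i ∈ M, z i ^ 2 :=
      mul_le_mul_of_nonneg_left (by linarith) (sq_nonneg c)
    have h4 : (plateau c + 6 / 5 * α) ^ 2 ≤ w ^ 2 := by gcongr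
    have h5 : c ^ 2 ≤ 1 / 100 := by nlinarith
    have h6 := mul_le_mul_of_nonneg_right h5 hα.le
    have h7 := mul_le_mul_of_nonneg_right hl hα.le
    have h9 : (plateau c + 6 / 5 * α) ^ 2 = plateau c ^ 2 + 12 / 5 * (plateau c * α) +
      36 / 25 * α ^ 2 := by ring
    have h10 : 0 ≤ α ^ 2 := sq_nonneg α
    linarith
  have := hgap.2.2 h1
  simp only at this
  rw [hs] at this
  norm_num at this

/-- The dichotomy for one step: either errors are frequent or the response correlates with x·z.
`slope_gap` is applied with p = error probability + probability `ε` of an atypical noise norm,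
because for typical norms a wrong sign near the plateau is an error. -/
theorem errorRate_large (hα : 0 < α) (hα1 : α < 1) (hc : 0 < c) (hc1 : c ≤ 1 / 10)
    (hh : h ∉ M) (hM : 0 < M.card) (hx : ∀ i, i ∉ M → x i = 0)
    (hA : A.mulVec x = A.mulVec (Pi.single h 1))
    (hlarge : 320000 / c ^ 2 ≤ M.card * α ^ 2)
    (hs : Measurable s) (hs1 : ∀ y, s y = -1 ∨ s y = 1) :
    c ^ 2 / (110 * α) ≤ ∫ p, (s (A.mulVec (query h c p.1 p.2)) * (M.card * (x ⬝ᵥ p.2) / c) +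
      20 / α * (errorSet A h α c s).indicator (fun _ => 1) p)
        ∂((signalLaw α c).prod (noiseLaw M)) := by
  have hL := slopeLength_pos hα hc
  have hH := height_pos hα hc
  have hLc : slopeLength α c * c = 10 * α := by rw [slopeLength]; field_simp
  have hprob := isProbabilityMeasure_signalLaw hα hc
  have hb : ∀ y, |s y| ≤ 1 := fun y => by rcases hs1 y with h | h <;> simp [h]
  have hE := measurableSet_errorSet (A := A) (h := h) (α := α) (c := c) hs
  set bad : Set (Fin n → ℝ) := {z | α ≤ |∑ i ∈ M, z i ^ 2 - 1|} with hbad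
  have hbadm : MeasurableSet bad := measurableSet_le measurable_const
    (Continuous.measurable (by fun_prop))
  have hdot := (continuous_dotProduct_left x).measurable
  have hEi : Integrable ((errorSet A h α c s).indicator fun _ => (1 : ℝ))
      ((signalLaw α c).prod (noiseLaw M)) := (integrable_const _).indicator hE
  have hXi : Integrable (fun p : ℝ × (Fin n → ℝ) => s (A.mulVec (query h c p.1 p.2)) *
      (M.card * (x ⬝ᵥ p.2) / c)) ((signalLaw α c).prod (noiseLaw M)) :=
    ((((integrable_dotProduct hx).const_mul (M.card : ℝ)).div_const c).comp_snd _).bdd_mul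
      (measurable_response_comp hs).aestronglyMeasurable (ae_of_all _ fun p => hb _)
  rw [integral_add hXi (hEi.const_mul _), integral_const_mul, integral_prod _ hXi,
    integral_prod _ hEi, integral_signalLaw hα hc, integral_signalLaw hα hc]
  change _ ≤ (∫ w, signalDensity α c w * dirResponse A h M c x s w) + _
  rw [integral_signalDensity_mul_dirResponse hα hc hM hx hA hs hb]
  set e : ℝ → ℝ := fun w => ∫ z, (errorSet A h α c s).indicator (fun _ => (1 : ℝ)) (w, z)
    ∂(noiseLaw M) with he
  set ε := (noiseLaw M).real bad with hε
  have hem : Measurable e :=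
    ((measurable_const.indicator hE).stronglyMeasurable.integral_prod_right').measurable
  have hεle : ε ≤ c ^ 2 / 10000 := by
    refine (measureReal_norm_sq_deviation_le M hM hα hα1).trans ?_
    have : 0 < 320000 / c ^ 2 := by positivity
    rw [div_le_iff₀ (by linarith)]
    have := mul_le_mul_of_nonneg_left hlarge (by positivity : 0 ≤ c ^ 2 / 10000)
    have e2 : c ^ 2 / 10000 * (320000 / c ^ 2) = 32 := by field_simp; norm_num
    linarith
  have hε0 : 0 ≤ ε := measureReal_nonneg
  have hε1 : ε ≤ 1 := measureReal_le_one
  have he0 : ∀ w, 0 ≤ e w := fun w => integral_nonneg fun z => Set.indicator_nonneg (by simp) _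
  have hslice : ∀ w, Measurable fun z : Fin n → ℝ =>
      (errorSet A h α c s).indicator (fun _ => (1 : ℝ)) (w, z) := fun w =>
    (measurable_const.indicator hE).comp (measurable_const.prodMk measurable_id)
  have hslicei : ∀ w, Integrable (fun z : Fin n → ℝ =>
      (errorSet A h α c s).indicator (fun _ => (1 : ℝ)) (w, z)) (noiseLaw M) := fun w =>
    Integrable.of_bound (hslice w).aestronglyMeasurable 1 (ae_of_all _ fun z =>
      (norm_indicator_le_norm_self _ _).trans (by simp))
  have he1 : ∀ w, e w ≤ 1 := fun w => by
    have := integral_mono (hslicei w) (integrable_const (1 : ℝ)) fun z =>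
      Set.indicator_le_self' (s := errorSet A h α c s) (fun _ _ => zero_le_one) (w, z)
    simpa using this
  have hsi : ∀ w, Integrable (fun z => s (A.mulVec (query h c w z))) (noiseLaw M) := fun w =>
    Integrable.of_bound ((measurable_response_comp hs).comp
      (measurable_const.prodMk measurable_id)).aestronglyMeasurable 1 (ae_of_all _ fun z => hb _)
  have hbadi : Integrable (bad.indicator fun _ => (1 : ℝ)) (noiseLaw M) :=
    (integrable_const _).indicator hbadm
  have hsum : ∀ w, ∫ z, ((errorSet A h α c s).indicator (fun _ => (1 : ℝ)) (w, z) +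
      bad.indicator (fun _ => (1 : ℝ)) z) ∂(noiseLaw M) = e w + ε := fun w => by
    rw [integral_add (hslicei w) hbadi, integral_indicator_const _ hbadm, smul_eq_mul, mul_one]
  have hae := ae_noiseLaw_eq_zero M
  have key := slope_gap hα hc hc1 (measurable_meanResponse (A := A) (h := h) (M := M) (c := c) hs)
    (abs_meanResponse_le hb) (p := fun w => e w + ε) (hem.add_const _)
    (fun w => by linarith [he0 w]) (fun w => by linarith [he1 w])
    (fun w hw => by
      rw [← hsum]
      have : (1 + meanResponse A h M c s w) / 2 =
          ∫ z, (1 + s (A.mulVec (query h c w z))) / 2 ∂(noiseLaw M) := by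
        rw [integral_div, integral_add (integrable_const _) (hsi w)]; simp [meanResponse]
      rw [this]
      refine integral_mono_ae (((integrable_const _).add (hsi w)).div_const 2)
        ((hslicei w).add hbadi) ?_
      filter_upwards [hae] with z hz
      have i1 : 0 ≤ (errorSet A h α c s).indicator (fun _ => (1 : ℝ)) (w, z) :=
        Set.indicator_nonneg (by simp) _
      have i2 : 0 ≤ bad.indicator (fun _ => (1 : ℝ)) z := Set.indicator_nonneg (by simp) _
      show _ ≤ (errorSet A h α c s).indicator (fun _ => (1 : ℝ)) (w, z) +
        bad.indicator (fun _ => (1 : ℝ)) z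
      rcases hs1 (A.mulVec (query h c w z)) with h1 | h1
      · rw [h1]; linarith
      · rw [h1]
        by_cases hz2 : z ∈ bad
        · rw [Set.indicator_of_mem hz2]; linarith
        · rw [Set.indicator_of_mem (mem_errorSet_of_low hα hα1 hc hc1 hh hz (not_le.1 hz2) hw h1)]
          linarith)
    (fun w hw => by
      rw [← hsum]
      have : (1 - meanResponse A h M c s w) / 2 =
          ∫ z, (1 - s (A.mulVec (query h c w z))) / 2 ∂(noiseLaw M) := by
        rw [integral_div, integral_sub (integrable_const _) (hsi w)]; simp [meanResponse]
      rw [this]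
      refine integral_mono_ae (((integrable_const _).sub (hsi w)).div_const 2)
        ((hslicei w).add hbadi) ?_
      filter_upwards [hae] with z hz
      have i1 : 0 ≤ (errorSet A h α c s).indicator (fun _ => (1 : ℝ)) (w, z) :=
        Set.indicator_nonneg (by simp) _
      have i2 : 0 ≤ bad.indicator (fun _ => (1 : ℝ)) z := Set.indicator_nonneg (by simp) _
      show _ ≤ (errorSet A h α c s).indicator (fun _ => (1 : ℝ)) (w, z) +
        bad.indicator (fun _ => (1 : ℝ)) z
      rcases hs1 (A.mulVec (query h c w z)) with h1 | h1
      · rw [h1]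
        by_cases hz2 : z ∈ bad
        · rw [Set.indicator_of_mem hz2]; linarith
        · rw [Set.indicator_of_mem (mem_errorSet_of_high hα hc hc1 hh hz (not_le.1 hz2) hw.1 h1)]
          linarith
      · rw [h1]; linarith)
  have hden := integrable_signalDensity_mul hα hc hem (B := 1) (fun w => by
    rw [abs_of_nonneg (he0 w)]; exact he1 w)
  have hd1 : Integrable (signalDensity α c) := by
    simpa using integrable_signalDensity_mul hα hc (g := fun _ => 1) measurable_const (B := 1)
      (by simp)
  have hsplit : ∫ w, signalDensity α c w * (e w + ε) = (∫ w, signalDensity α c w * e w) + ε := by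
    simp_rw [mul_add]
    rw [integral_add hden (hd1.mul_const _), integral_mul_const, integral_signalDensity hα hc,
      one_mul]
  rw [hsplit] at key
  set D := (∫ w in (plateau c + α)..(plateau c + α + slopeLength α c), meanResponse A h M c s w) -
    ∫ w in (plateau c - slopeLength α c)..(plateau c), meanResponse A h M c s w
  set I := ∫ w, signalDensity α c w * e w
  have hmul := mul_le_mul_of_nonneg_left key
    (by positivity : 0 ≤ height α c / slopeLength α c)
  -- The price of an error: (H/L) · 200/(Hc) = 200/(Lc) = 20/α.
  have e3 : height α c / slopeLength α c * (D + 200 / (height α c * c) * (I + ε)) =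
      height α c / slopeLength α c * D + 20 / α * I + 20 / α * ε := by
    have : α = slopeLength α c * c / 10 := by linarith
    have h20 : height α c / slopeLength α c * (200 / (height α c * c)) = 20 / α := by
      nth_rewrite 4 [this]; field_simp; norm_num
    rw [mul_add, ← mul_assoc, h20]; ring
  rw [e3] at hmul
  have e4 : height α c / slopeLength α c * (13 / 10 * α) = 13 * c ^ 2 / (100 * α * (c + 10)) := by
    rw [height, slopeLength]; field_simp; norm_num
  rw [e4] at hmul
  have e5 : 20 / α * ε ≤ c ^ 2 / (500 * α) := by
    calc 20 / α * ε ≤ 20 / α * (c ^ 2 / 10000) := by gcongr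
      _ = c ^ 2 / (500 * α) := by field_simp; norm_num
  -- The gain of `slope_gap` covers the claimed rate and the loss c²/(500α) due to atypical norms;
  -- this uses c + 10 ≤ 10.1.
  have e6 : c ^ 2 / (110 * α) + c ^ 2 / (500 * α) ≤ 13 * c ^ 2 / (100 * α * (c + 10)) := by
    have : c ^ 2 / (110 * α) + c ^ 2 / (500 * α) = (61 / 5500) * (c ^ 2 / α) := by
      field_simp; norm_num
    have h2 : 13 * c ^ 2 / (100 * α * (c + 10)) = 13 / (100 * (c + 10)) * (c ^ 2 / α) := by
      field_simp
    rw [this, h2]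
    refine mul_le_mul_of_nonneg_right ?_ (by positivity)
    rw [le_div_iff₀ (by linarith)]; linarith
  linarith

/-- By (a + b)² ≤ 2a² + 2b² and s² = 1 the bound does not depend on the responder; the Gaussian part
is 2m²/c² times (x·x)/m. -/
theorem secondMoment_large (hα : 0 < α) (hc : 0 < c)
    (hM : 0 < M.card) (hx : ∀ i, i ∉ M → x i = 0)
    (hs : Measurable s) (hs1 : ∀ y, s y = -1 ∨ s y = 1) :
    Integrable (fun p : ℝ × (Fin n → ℝ) =>
      (s (A.mulVec (query h c p.1 p.2)) * (M.card * (x ⬝ᵥ p.2) / c) +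
      20 / α * (errorSet A h α c s).indicator (fun _ => 1) p) ^ 2)
        ((signalLaw α c).prod (noiseLaw M)) ∧
    ∫ p, (s (A.mulVec (query h c p.1 p.2)) * (M.card * (x ⬝ᵥ p.2) / c) +
      20 / α * (errorSet A h α c s).indicator (fun _ => 1) p) ^ 2
        ∂((signalLaw α c).prod (noiseLaw M)) ≤
      2 * (M.card * x ⬝ᵥ x) / c ^ 2 + 800 / α ^ 2 := by
  have hprob := isProbabilityMeasure_signalLaw hα hc
  have hm : (0 : ℝ) < M.card := by exact_mod_cast hM
  have hE := measurableSet_errorSet (A := A) (h := h) (α := α) (c := c) hs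
  have hdot := (continuous_dotProduct_left x).measurable
  have hmeas : Measurable fun p : ℝ × (Fin n → ℝ) =>
      (s (A.mulVec (query h c p.1 p.2)) * (M.card * (x ⬝ᵥ p.2) / c) +
      20 / α * (errorSet A h α c s).indicator (fun _ => 1) p) ^ 2 := by
    have h1 := measurable_response_comp (A := A) (h := h) (c := c) hs
    have h2 : Measurable ((errorSet A h α c s).indicator fun _ => (1 : ℝ)) :=
      measurable_const.indicator hE
    exact ((h1.mul (by fun_prop)).add (h2.const_mul _)).pow_const 2
  set B : ℝ × (Fin n → ℝ) → ℝ := fun p => 2 * M.card ^ 2 / c ^ 2 * (x ⬝ᵥ p.2) ^ 2 + 800 / α ^ 2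
  have hle : ∀ p : ℝ × (Fin n → ℝ), (s (A.mulVec (query h c p.1 p.2)) * (M.card * (x ⬝ᵥ p.2) / c) +
      20 / α * (errorSet A h α c s).indicator (fun _ => 1) p) ^ 2 ≤ B p := by
    intro p
    have h1 : s (A.mulVec (query h c p.1 p.2)) ^ 2 = 1 := by
      rcases hs1 (A.mulVec (query h c p.1 p.2)) with h | h <;> simp [h]
    have h2 : ((errorSet A h α c s).indicator (fun _ => (1 : ℝ)) p) ^ 2 ≤ 1 := by
      by_cases hp : p ∈ errorSet A h α c s <;> simp [hp]
    refine (add_sq_le).trans ?_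
    rw [mul_pow, mul_pow, h1, one_mul]
    have h3 : (20 / α) ^ 2 * ((errorSet A h α c s).indicator (fun _ => (1 : ℝ)) p) ^ 2 ≤
        (20 / α) ^ 2 * 1 := mul_le_mul_of_nonneg_left h2 (sq_nonneg _)
    have h4 : (20 / α) ^ 2 * 1 * 2 = 800 / α ^ 2 := by ring
    have h5 : 2 * (M.card * (x ⬝ᵥ p.2) / c) ^ 2 = 2 * M.card ^ 2 / c ^ 2 * (x ⬝ᵥ p.2) ^ 2 := by
      ring
    simp only [B]
    linarith
  have hBi : Integrable B ((signalLaw α c).prod (noiseLaw M)) :=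
    (((integrable_dotProduct_pow M x hx 2).comp_snd _).const_mul _).add (integrable_const _)
  have hi := hBi.mono' hmeas.aestronglyMeasurable (ae_of_all _ fun p => by
    rw [Real.norm_of_nonneg (sq_nonneg _)]; exact hle p)
  refine ⟨hi, (integral_mono hi hBi hle).trans (le_of_eq ?_)⟩
  simp only [B]
  rw [integral_add (((integrable_dotProduct_pow M x hx 2).comp_snd _).const_mul _)
    (integrable_const _), integral_const_mul, integral_fun_snd (fun z => (x ⬝ᵥ z) ^ 2),
    integral_dotProduct_sq M x hx]
  simp
  field_simp

end LargeSupport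

/-! ### Orthonormal bases of the kernel of the sketch -/

section Kernel

variable {n k : ℕ}

/-- The vectors supported on `S` in the kernel of `A`. -/
def supportedKer (A : Matrix (Fin k) (Fin n) ℝ) (S : Finset (Fin n)) :
    Submodule ℝ (EuclideanSpace ℝ (Fin n)) where
  carrier := {x | (∀ i, i ∉ S → x i = 0) ∧ A.mulVec (WithLp.ofLp x) = 0}
  add_mem' := fun {x y} hx hy => ⟨fun i hi => by simp [hx.1 i hi, hy.1 i hi], by
    rw [WithLp.ofLp_add, Matrix.mulVec_add, hx.2, hy.2, add_zero]⟩
  zero_mem' := ⟨fun i _ => by simp, by simp⟩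
  smul_mem' := fun r x hx => ⟨fun i hi => by simp [hx.1 i hi], by
    rw [WithLp.ofLp_smul, Matrix.mulVec_smul, hx.2, smul_zero]⟩

/-- Extension by zero from `S`. -/
noncomputable def extendZero (S : Finset (Fin n)) : (S → ℝ) →ₗ[ℝ] (Fin n → ℝ) where
  toFun y i := if hi : i ∈ S then y ⟨i, hi⟩ else 0
  map_add' y z := by ext i; by_cases hi : i ∈ S <;> simp [hi]
  map_smul' r y := by ext i; by_cases hi : i ∈ S <;> simp [hi]

theorem finrank_supportedKer_le (A : Matrix (Fin k) (Fin n) ℝ) (S : Finset (Fin n)) :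
    Module.finrank ℝ (supportedKer A S) ≤ S.card := by
  let f : supportedKer A S →ₗ[ℝ] (S → ℝ) :=
    { toFun := fun x i => (x : EuclideanSpace ℝ (Fin n)) i
      map_add' := fun x y => by ext i; simp
      map_smul' := fun r x => by ext i; simp }
  have hf : Function.Injective f := by
    intro x y hxy
    ext i
    by_cases hi : i ∈ S
    · exact congrFun hxy ⟨i, hi⟩
    · rw [x.2.1 i hi, y.2.1 i hi]
  have := LinearMap.finrank_le_finrank_of_injective hf
  simpa using this

theorem card_le_finrank_supportedKer_add (A : Matrix (Fin k) (Fin n) ℝ) (S : Finset (Fin n)) :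
    S.card ≤ Module.finrank ℝ (supportedKer A S) + k := by
  let φ : (S → ℝ) →ₗ[ℝ] (Fin k → ℝ) := A.mulVecLin ∘ₗ extendZero S
  have h1 := LinearMap.finrank_range_add_finrank_ker φ
  have h2 : Module.finrank ℝ (LinearMap.range φ) ≤ k := by
    simpa using Submodule.finrank_le (LinearMap.range φ)
  let f : LinearMap.ker φ →ₗ[ℝ] supportedKer A S :=
    { toFun := fun y => ⟨WithLp.toLp 2 (extendZero S y), fun i hi => by simp [extendZero, hi],
        y.2⟩
      map_add' := fun x y => by ext i; simp
      map_smul' := fun r x => by ext i; simp }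
  have hf : Function.Injective f := by
    intro x y hxy
    ext i
    have := congrArg (fun v : supportedKer A S => (v : EuclideanSpace ℝ (Fin n)) i) hxy
    simpa [f, extendZero] using this
  have h3 := LinearMap.finrank_le_finrank_of_injective hf
  rw [Module.finrank_fintype_fun_eq_card, Fintype.card_coe] at h1
  omega

/-- By rank-nullity the sketch sees at most `k` of the |S| dimensions. The family is an orthonormal
basis of the invisible vectors on `S`. -/
theorem exists_orthonormal_kernel (A : Matrix (Fin k) (Fin n) ℝ) (S : Finset (Fin n)) :
    ∃ (d : ℕ) (b : Fin d → Fin n → ℝ), (∀ i j, b i ⬝ᵥ b j = if i = j then 1 else 0) ∧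
      (∀ j, ∀ i, i ∉ S → b j i = 0) ∧ (∀ j, A.mulVec (b j) = 0) ∧
      (∀ v : Fin n → ℝ, (∀ i, i ∉ S → v i = 0) → A.mulVec v = 0 → v = ∑ j, (b j ⬝ᵥ v) • b j) ∧
      S.card ≤ d + k ∧ d ≤ S.card := by
  set N := supportedKer A S
  let B := stdOrthonormalBasis ℝ N
  have hdot : ∀ x y : EuclideanSpace ℝ (Fin n),
      WithLp.ofLp x ⬝ᵥ WithLp.ofLp y = inner ℝ x y := fun x y => by
    simp [PiLp.inner_apply, dotProduct, mul_comm]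
  refine ⟨Module.finrank ℝ N, fun j => WithLp.ofLp (B j : EuclideanSpace ℝ (Fin n)), ?_, ?_, ?_,
    ?_, card_le_finrank_supportedKer_add A S, finrank_supportedKer_le A S⟩
  · intro i j
    rw [hdot, ← Submodule.coe_inner]
    exact orthonormal_iff_ite.1 B.orthonormal i j
  · exact fun j => (B j).2.1
  · exact fun j => (B j).2.2
  · intro v hv hAv
    let v' : N := ⟨WithLp.toLp 2 v, hv, hAv⟩
    have h1 := congrArg (fun u : N => WithLp.ofLp (u : EuclideanSpace ℝ (Fin n)))
      (B.sum_repr' v')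
    simp only [AddSubmonoidClass.coe_finsetSum, Submodule.coe_smul] at h1
    rw [WithLp.ofLp_sum] at h1
    simp only [WithLp.ofLp_smul] at h1
    refine (Eq.trans ?_ h1.symm).trans ?_
    · rfl
    · refine Finset.sum_congr rfl fun j _ => ?_
      simp only
      rw [show v = WithLp.ofLp (WithLp.toLp 2 v) from rfl, hdot]
      rfl

end Kernel

/-! ### Orthogonal projection to the span of an orthonormal family -/

section Projection

variable {n k d : ℕ} {b : Fin d → Fin n → ℝ}

/-- The orthogonal projection onto the span of an orthonormal family. -/
def familyProj (b : Fin d → Fin n → ℝ) : (Fin n → ℝ) →ₗ[ℝ] (Fin n → ℝ) where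
  toFun z := ∑ j, (b j ⬝ᵥ z) • b j
  map_add' y z := by simp only [dotProduct_add, add_smul, Finset.sum_add_distrib]
  map_smul' r z := by
    simp only [dotProduct_smul, smul_eq_mul, mul_smul, Finset.smul_sum, RingHom.id_apply]

theorem familyProj_apply (z : Fin n → ℝ) : familyProj b z = ∑ j, (b j ⬝ᵥ z) • b j := rfl

theorem familyProj_dotProduct (y z : Fin n → ℝ) :
    familyProj b y ⬝ᵥ z = ∑ j, (b j ⬝ᵥ y) * (b j ⬝ᵥ z) := by
  simp [familyProj_apply, sum_dotProduct, smul_dotProduct]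

theorem familyProj_symm (y z : Fin n → ℝ) : familyProj b y ⬝ᵥ z = y ⬝ᵥ familyProj b z := by
  rw [dotProduct_comm y, familyProj_dotProduct, familyProj_dotProduct]
  exact Finset.sum_congr rfl fun j _ => mul_comm _ _

theorem dotProduct_familyProj (hb : ∀ i j, b i ⬝ᵥ b j = if i = j then 1 else 0) (j : Fin d)
    (z : Fin n → ℝ) : b j ⬝ᵥ familyProj b z = b j ⬝ᵥ z := by
  simp [familyProj_apply, dotProduct_sum, dotProduct_smul, hb]

theorem familyProj_idem (hb : ∀ i j, b i ⬝ᵥ b j = if i = j then 1 else 0) (z : Fin n → ℝ) :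
    familyProj b (familyProj b z) = familyProj b z := by
  rw [familyProj_apply]
  simp_rw [dotProduct_familyProj hb]
  rfl

/-- Pythagoras for a vector whose kernel part comes from `y` and whose visible part comes from `z`;
it is used when the kernel part of the noise is resampled. -/
theorem familyProj_split_sq (hb : ∀ i j, b i ⬝ᵥ b j = if i = j then 1 else 0)
    (y z : Fin n → ℝ) :
    (familyProj b y + (z - familyProj b z)) ⬝ᵥ (familyProj b y + (z - familyProj b z)) =
      ∑ j, (b j ⬝ᵥ y) ^ 2 + (z ⬝ᵥ z - ∑ j, (b j ⬝ᵥ z) ^ 2) := by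
  have h1 : familyProj b y ⬝ᵥ (z - familyProj b z) = 0 := by
    rw [familyProj_symm, map_sub, familyProj_idem hb, sub_self, dotProduct_zero]
  have h2 : ∀ u : Fin n → ℝ, familyProj b u ⬝ᵥ familyProj b u = ∑ j, (b j ⬝ᵥ u) ^ 2 := fun u => by
    rw [familyProj_dotProduct]
    simp_rw [dotProduct_familyProj hb, sq]
  have h3 : z ⬝ᵥ familyProj b z = ∑ j, (b j ⬝ᵥ z) ^ 2 := by
    rw [dotProduct_comm, familyProj_dotProduct]; simp_rw [sq]
  rw [dotProduct_add, add_dotProduct, add_dotProduct, h1, dotProduct_comm (z - familyProj b z) (familyProj b y), h1,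
    h2, sub_dotProduct, dotProduct_sub, dotProduct_sub, dotProduct_comm (familyProj b z) z, h2, h3]
  ring

end Projection

/-! ### A single step of the attack for supports of small size -/

section SmallSupport

variable {n k : ℕ} {α c : ℝ} {A : Matrix (Fin k) (Fin n) ℝ} {h : Fin n} {M : Finset (Fin n)}
  {s : (Fin k → ℝ) → ℝ}

theorem integral_dotProduct_self (hM : 0 < M.card) :
    Integrable (fun z => z ⬝ᵥ z) (noiseLaw M) ∧ ∫ z, z ⬝ᵥ z ∂(noiseLaw M) = 1 := by
  have hm : (M.card : ℝ) ≠ 0 := by exact_mod_cast hM.ne'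
  have hae : (fun z => ∑ i ∈ M, (Pi.single i (1 : ℝ) ⬝ᵥ z) ^ 2) =ᵐ[noiseLaw M]
      fun z => z ⬝ᵥ z := by
    filter_upwards [ae_noiseLaw_eq_zero M] with z hz
    rw [← sum_sq_eq_dotProduct hz]
    simp [sq]
  have hsup : ∀ i ∈ M, ∀ j, j ∉ M → (Pi.single i (1 : ℝ) : Fin n → ℝ) j = 0 := by
    intro i hi j hj
    rw [Pi.single_eq_of_ne]
    rintro rfl
    exact hj hi
  have hi : ∀ i ∈ M, Integrable (fun z => (Pi.single i (1 : ℝ) ⬝ᵥ z) ^ 2) (noiseLaw M) :=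
    fun i hi => integrable_dotProduct_pow M _ (hsup i hi) 2
  refine ⟨(integrable_finsetSum M hi).congr hae, ?_⟩
  rw [← integral_congr_ae hae, integral_finsetSum M hi,
    Finset.sum_congr rfl fun i hi => integral_dotProduct_sq M _ (hsup i hi)]
  simp [hm]

theorem integral_residual {d : ℕ} {b : Fin d → Fin n → ℝ} (hM : 0 < M.card)
    (hb : ∀ i j, b i ⬝ᵥ b j = if i = j then 1 else 0) (hsupp : ∀ j, ∀ i, i ∉ M → b j i = 0) :
    Integrable (fun z => z ⬝ᵥ z - ∑ j, (b j ⬝ᵥ z) ^ 2) (noiseLaw M) ∧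
      ∫ z, (z ⬝ᵥ z - ∑ j, (b j ⬝ᵥ z) ^ 2) ∂(noiseLaw M) = 1 - d / M.card := by
  obtain ⟨h1, h2⟩ := integral_dotProduct_self hM
  have hi : ∀ j ∈ (Finset.univ : Finset (Fin d)),
      Integrable (fun z => (b j ⬝ᵥ z) ^ 2) (noiseLaw M) :=
    fun j _ => integrable_dotProduct_pow M _ (hsupp j) 2
  refine ⟨h1.sub (integrable_finsetSum _ hi), ?_⟩
  rw [integral_sub h1 (integrable_finsetSum _ hi), h2, integral_finsetSum _ hi,
    Finset.sum_congr rfl fun j _ => integral_dotProduct_sq M _ (hsupp j)]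
  simp [hb, div_eq_mul_inv]

theorem residual_nonneg {d : ℕ} {b : Fin d → Fin n → ℝ}
    (hb : ∀ i j, b i ⬝ᵥ b j = if i = j then 1 else 0) (z : Fin n → ℝ) :
    0 ≤ z ⬝ᵥ z - ∑ j, (b j ⬝ᵥ z) ^ 2 := by
  have h := familyProj_split_sq hb 0 z
  have h2 : (0 : ℝ) ≤ (familyProj b 0 + (z - familyProj b z)) ⬝ᵥ
      (familyProj b 0 + (z - familyProj b z)) :=
    Finset.sum_nonneg fun i _ => mul_self_nonneg _
  rw [h] at h2
  simpa using h2

/-- The constant in the deviation of the noise of a support of small size. -/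
noncomputable def smallDev (c : ℝ) : ℝ := 2000 / c ^ 3

/-- A lower bound of the rate of errors on supports of small size. -/
noncomputable def smallRate (c : ℝ) : ℝ := c / 22 * (Real.exp (-2 * smallDev c ^ 2 - 1) / 4)

theorem smallRate_pos (hc : 0 < c) : 0 < smallRate c := by
  unfold smallRate
  positivity

/-- On the plateau w² ≤ l² + 2α + α² ≤ l² + 3α, which a deficit of 3α in the noise compensates. -/
theorem mem_errorSet_of_norm_small (hα : 0 < α) (hα1 : α < 1) (hc : 0 < c) (hc1 : c ≤ 1 / 10)
    (hh : h ∉ M) {z : Fin n → ℝ} (hz : ∀ i, i ∉ M → z i = 0)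
    (hdev : 3 * α ≤ c ^ 2 * (1 - z ⬝ᵥ z)) {w : ℝ}
    (hw : w ∈ Set.Icc (plateau c) (plateau c + α))
    (hs : s (A.mulVec (query h c w z)) = 1) : (w, z) ∈ errorSet A h α c s := by
  intro hgap
  obtain ⟨hl, hl1, hlsq⟩ := plateau_bounds hc hc1
  have h1 : l2norm (query h c w z) ≤ 1 := by
    rw [← sq_le_one_iff₀ (l2norm_nonneg _), l2norm_query_sq hh hz]
    have h4 : w ^ 2 ≤ (plateau c + α) ^ 2 := by
      have : 0 ≤ w := by linarith [hw.1]
      have := hw.2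
      gcongr
    have e : ∑ i ∈ M, z i ^ 2 = z ⬝ᵥ z := by
      rw [← sum_sq_eq_dotProduct hz]; simp_rw [sq]
    rw [e]
    have h5 := mul_le_mul_of_nonneg_right hl1 hα.le
    have h6 : α ^ 2 ≤ α := by nlinarith
    have h7 : (plateau c + α) ^ 2 = plateau c ^ 2 + 2 * (plateau c * α) + α ^ 2 := by ring
    linarith
  have := hgap.2.1 h1
  simp only at this
  rw [hs] at this
  norm_num at this

/-- Here 3α comes from (1 + α)² ≤ 1 + 3α. -/
theorem mem_errorSet_of_norm_large (hα : 0 < α) (hα1 : α < 1) (hc : 0 < c) (hc1 : c ≤ 1 / 10)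
    (hh : h ∉ M) {z : Fin n → ℝ} (hz : ∀ i, i ∉ M → z i = 0)
    (hdev : 3 * α ≤ c ^ 2 * (z ⬝ᵥ z - 1)) {w : ℝ} (hw : plateau c ≤ w)
    (hs : s (A.mulVec (query h c w z)) = -1) : (w, z) ∈ errorSet A h α c s := by
  intro hgap
  obtain ⟨hl, hl1, hlsq⟩ := plateau_bounds hc hc1
  have h1 : 1 + α ≤ l2norm (query h c w z) := by
    rw [← sq_le_sq₀ (by linarith) (l2norm_nonneg _), l2norm_query_sq hh hz]
    have h4 : plateau c ^ 2 ≤ w ^ 2 := by gcongr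
    have e : ∑ i ∈ M, z i ^ 2 = z ⬝ᵥ z := by
      rw [← sum_sq_eq_dotProduct hz]; simp_rw [sq]
    rw [e]
    have h6 : α ^ 2 ≤ α := by nlinarith
    have h7 : (1 + α) ^ 2 = 1 + 2 * α + α ^ 2 := by ring
    linarith
  have := hgap.2.2 h1
  simp only at this
  rw [hs] at this
  norm_num at this

/-- The tilt is κ/√m with κ = `smallDev c`: then λ²d lies between κ²/2 and κ², so the tails have
constant probability, while a relative deviation λ of the squared norm still exceeds the gap, since
α√m ≤ 600/c and c²κ = 2000/c. -/
theorem exists_tilt (hc : 0 < c) (hc1 : c ≤ 1 / 10) {m d : ℕ}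
    (hkm : (k : ℝ) ^ 2 ≤ m) (hm : 6400 * smallDev c ^ 6 ≤ m)
    (hsmall : m * α ^ 2 ≤ 320000 / c ^ 2) (hd1 : m ≤ d + k) (hd2 : d ≤ m) :
    ∃ lam : ℝ, 0 < lam ∧ lam ≤ 1 / 8 ∧ 7 ≤ lam ^ 2 * d ∧ lam ^ 2 * d ≤ smallDev c ^ 2 ∧
      80 * d * lam ^ 3 ≤ 1 ∧ 3 * α ≤ c ^ 2 * (lam - 2 * (k / m)) := by
  set κ := smallDev c with hκ
  have hκ1 : 2000000 ≤ κ := by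
    rw [hκ, smallDev, le_div_iff₀ (by positivity)]
    have : c ^ 3 ≤ (1 / 10) ^ 3 := by gcongr
    linarith
  have hmpos : (0 : ℝ) < m := lt_of_lt_of_le (by positivity) hm
  set t := √(m : ℝ) with ht
  have ht0 : 0 < t := Real.sqrt_pos.2 hmpos
  have htt : t ^ 2 = m := Real.sq_sqrt hmpos.le
  have htκ : 80 * κ ^ 3 ≤ t := Real.le_sqrt_of_sq_le (by
    rw [mul_pow, ← pow_mul]; norm_num; exact hm)
  have hκ3 : κ ≤ κ ^ 3 := le_self_pow₀ (by linarith) (by norm_num)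
  have hkt : (k : ℝ) ≤ t := Real.le_sqrt_of_sq_le hkm
  have hd1' : t ^ 2 ≤ d + k := by rw [htt]; exact_mod_cast hd1
  have hd2' : (d : ℝ) ≤ t ^ 2 := by rw [htt]; exact_mod_cast hd2
  have hdhalf : t ^ 2 / 2 ≤ d := by
    have : 2 * t ≤ t ^ 2 := by rw [sq]; exact mul_le_mul_of_nonneg_right (by linarith) ht0.le
    linarith
  have hαt : α * t * c ≤ 600 := by
    refine abs_le_of_sq_le_sq' ?_ (by norm_num) |>.2
    rw [← htt, le_div_iff₀ (by positivity)] at hsmall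
    have : (α * t * c) ^ 2 = t ^ 2 * α ^ 2 * c ^ 2 := by ring
    rw [this]; linarith
  set lam := κ / t with hlam
  have hlam0 : 0 < lam := by positivity
  have hlt : lam * t = κ := by rw [hlam]; field_simp
  have hl2 : lam ^ 2 * t ^ 2 = κ ^ 2 := by rw [← mul_pow, hlt]
  refine ⟨lam, hlam0, ?_, ?_, ?_, ?_, ?_⟩
  · rw [hlam, div_le_iff₀ ht0]; linarith
  · have h1 := mul_le_mul_of_nonneg_left hdhalf (sq_nonneg lam)
    have h2 : 14 ≤ κ ^ 2 := by nlinarith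
    linarith
  · rw [← hl2]; exact mul_le_mul_of_nonneg_left hd2' (sq_nonneg lam)
  · have h1 : 80 * d * lam ^ 3 ≤ 80 * t ^ 2 * lam ^ 3 := by gcongr
    have h2 : 80 * t ^ 2 * lam ^ 3 = 80 * κ ^ 3 / t := by rw [hlam]; field_simp
    have h3 : 80 * κ ^ 3 / t ≤ 1 := (div_le_one ht0).2 htκ
    linarith
  · rw [← htt]
    have h1 : k / t ^ 2 ≤ 1 / t := by
      rw [div_le_div_iff₀ (by positivity) ht0, sq, one_mul]
      exact mul_le_mul_of_nonneg_right hkt ht0.le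
    have h2 : lam - 2 * (k / t ^ 2) ≥ (κ - 2) / t := by
      rw [hlam, sub_div]; linarith [show 2 / t = 2 * (1 / t) by ring]
    have h3 : 3 * α ≤ c ^ 2 * ((κ - 2) / t) := by
      rw [← mul_div_assoc, le_div_iff₀ ht0]
      have h4 : c ^ 2 * κ = 2000 / c := by rw [hκ, smallDev]; field_simp
      have h5 : α * t ≤ 600 / c := by rw [le_div_iff₀ hc]; exact hαt
      have h6 : c ^ 2 * 2 ≤ 200 / c := by
        rw [le_div_iff₀ hc]
        have := pow_le_one₀ hc.le (by linarith : c ≤ 1) (n := 3)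
        have e : c ^ 2 * 2 * c = 2 * c ^ 3 := by ring
        linarith
      have h7 : 3 * (600 / c) + 200 / c = 2000 / c := by ring
      rw [mul_sub]
      linarith
    exact h3.trans (mul_le_mul_of_nonneg_left h2 (sq_nonneg c))

theorem measureReal_le_integral_indicator {Z Z' : Type*} [MeasurableSpace Z] [MeasurableSpace Z']
    {P : Measure Z} [IsProbabilityMeasure P] {E : Set Z'} (hE : MeasurableSet E) {f : Z → Z'}
    (hf : Measurable f) {U : Set Z} (hsub : ∀ z ∈ U, f z ∈ E) :
    P.real U ≤ ∫ z, E.indicator (fun _ => (1 : ℝ)) (f z) ∂P := by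
  have e1 : ∫ z, E.indicator (fun _ => (1 : ℝ)) (f z) ∂P = P.real (f ⁻¹' E) := by
    have : (fun z => E.indicator (fun _ => (1 : ℝ)) (f z)) =
        (f ⁻¹' E).indicator fun _ => (1 : ℝ) := by
      funext z; rfl
    rw [this, integral_indicator_const _ (hf hE), smul_eq_mul, mul_one]
  rw [e1]
  exact measureReal_mono hsub

/-- Markov's inequality: the visible part of the squared norm has mean 1 - d/m ≤ k/m. -/
theorem half_le_measureReal_residual {d : ℕ} {b : Fin d → Fin n → ℝ} (hM : 0 < M.card)
    (hb : ∀ i j, b i ⬝ᵥ b j = if i = j then 1 else 0) (hsupp : ∀ j, ∀ i, i ∉ M → b j i = 0)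
    (hk : 0 < k) (hd1 : M.card ≤ d + k) :
    1 / 2 ≤ (noiseLaw M).real {z | z ⬝ᵥ z - ∑ j, (b j ⬝ᵥ z) ^ 2 < 2 * (k / M.card)} := by
  obtain ⟨hri, hre⟩ := integral_residual hM hb hsupp
  set res : (Fin n → ℝ) → ℝ := fun z => z ⬝ᵥ z - ∑ j, (b j ⬝ᵥ z) ^ 2 with hres
  have hm : (0 : ℝ) < M.card := by exact_mod_cast hM
  have hresm : Measurable res := Continuous.measurable (by
    simp only [hres]; unfold dotProduct; fun_prop)
  have hgoodm : MeasurableSet {z | res z < 2 * ((k : ℝ) / M.card)} :=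
    measurableSet_lt hresm measurable_const
  have hk' : (0 : ℝ) < k := by exact_mod_cast hk
  have h1 := mul_meas_ge_le_integral_of_nonneg (ae_of_all (noiseLaw M) (residual_nonneg hb)) hri
    (2 * (k / M.card))
  rw [hre] at h1
  have h2 : 1 - (d : ℝ) / M.card ≤ k / M.card := by
    rw [sub_le_iff_le_add, ← add_div, le_div_iff₀ hm, one_mul, add_comm]; exact_mod_cast hd1
  have h4 := probReal_compl_eq_one_sub (μ := noiseLaw M) hgoodm
  have h3 : {z | res z < 2 * ((k : ℝ) / M.card)}ᶜ = {z | 2 * ((k : ℝ) / M.card) ≤ res z} := by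
    ext z; simp
  rw [h3] at h4
  have h5 : 0 < (k : ℝ) / M.card := by positivity
  have h6 : (noiseLaw M).real {z | 2 * ((k : ℝ) / M.card) ≤ res z} ≤ 1 / 2 := by
    have h7 := h1.trans h2
    by_contra hcon
    push Not at hcon
    have := mul_lt_mul_of_pos_left hcon h5
    have h8 : 2 * ((k : ℝ) / M.card) * (noiseLaw M).real {z | 2 * ((k : ℝ) / M.card) ≤ res z} ≤
      (k : ℝ) / M.card := h7
    linarith
  linarith

/-- The visible part z₂ of the noise fixes the answer before the independent kernel part z₁ is
drawn. If the answer is -1, a long z₁ makes it wrong; if it is 1, a short z₁ does, provided that the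
visible part is short too. Both tails have probability at least `τ`, and z₂ is good with probability
at least 1/2. -/
theorem errorRate_slice_small (hα : 0 < α) (hα1 : α < 1) (hc : 0 < c) (hc1 : c ≤ 1 / 10)
    (hh : h ∉ M) (hk : 0 < k) (hkm : (k : ℝ) ^ 2 ≤ M.card)
    (hm : 6400 * smallDev c ^ 6 ≤ M.card) (hsmall : M.card * α ^ 2 ≤ 320000 / c ^ 2)
    (hs : Measurable s) (hs1 : ∀ y, s y = -1 ∨ s y = 1) {w : ℝ}
    (hw : w ∈ Set.Icc (plateau c) (plateau c + α)) :
    Real.exp (-2 * smallDev c ^ 2 - 1) / 8 ≤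
      ∫ z, (errorSet A h α c s).indicator (fun _ => (1 : ℝ)) (w, z) ∂(noiseLaw M) := by
  obtain ⟨d, b, hb, hsupp, hker, -, hd1, hd2⟩ := exists_orthonormal_kernel A M
  have hmpos : (0 : ℝ) < M.card := by
    refine lt_of_lt_of_le ?_ hm
    unfold smallDev; positivity
  have hM : 0 < M.card := by exact_mod_cast hmpos
  obtain ⟨lam, hlam0, hl8, hld, hld2, hcube, hdev⟩ :=
    exists_tilt hc hc1 hkm hm hsmall hd1 hd2
  have hchi := hasChiMGF_noiseLaw M hM b hb hsupp
  set τ := Real.exp (-2 * smallDev c ^ 2 - 1) / 4 with hτ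
  have hτle : τ ≤ Real.exp (-2 * (lam ^ 2 * d) - 1) / 4 := by
    rw [hτ]
    refine div_le_div_of_nonneg_right (Real.exp_le_exp.2 (by linarith)) (by norm_num)
  have hup := hτle.trans (hchi.le_measureReal (lam := lam) (by rwa [abs_of_pos hlam0]) hld
    (by rwa [abs_of_pos hlam0]))
  have hdown := hchi.le_measureReal (lam := -lam) (by rwa [abs_neg, abs_of_pos hlam0])
    (by rwa [neg_sq]) (by rwa [abs_neg, abs_of_pos hlam0])
  rw [neg_sq] at hdown
  replace hdown := hτle.trans hdown
  have hE := measurableSet_errorSet (A := A) (h := h) (α := α) (c := c) hs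
  have hQm : Measurable (familyProj b) :=
    (LinearMap.continuous_of_finiteDimensional (familyProj b)).measurable
  have hsplit := noiseLaw_map_split M (familyProj b) familyProj_symm (familyProj_idem hb)
    (fun a i hi => by simp [familyProj_apply, hsupp _ i hi])
  set ψ : (Fin n → ℝ) × (Fin n → ℝ) → Fin n → ℝ := fun p =>
    familyProj b p.1 + (p.2 - familyProj b p.2) with hψ
  have hmm : Measurable ψ := by fun_prop
  have hslice : Measurable fun z : Fin n → ℝ =>
      (errorSet A h α c s).indicator (fun _ => (1 : ℝ)) (w, z) :=
    (measurable_const.indicator hE).comp (measurable_const.prodMk measurable_id)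
  conv_rhs => rw [← hsplit]
  rw [integral_map hmm.aemeasurable hslice.aestronglyMeasurable]
  have hci : Integrable (fun p => (errorSet A h α c s).indicator (fun _ => (1 : ℝ)) (w, ψ p))
      ((noiseLaw M).prod (noiseLaw M)) :=
    Integrable.of_bound (hslice.comp hmm).aestronglyMeasurable 1 (ae_of_all _ fun z =>
      (norm_indicator_le_norm_self _ _).trans (by simp))
  rw [integral_prod_symm _ hci]
  have hPgood := half_le_measureReal_residual hM hb hsupp hk hd1
  set res : (Fin n → ℝ) → ℝ := fun z => z ⬝ᵥ z - ∑ j, (b j ⬝ᵥ z) ^ 2 with hres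
  set good : Set (Fin n → ℝ) := {z | res z < 2 * ((k : ℝ) / M.card)} with hgood
  have hresm : Measurable res := Continuous.measurable (by
    simp only [hres]; unfold dotProduct; fun_prop)
  have hgoodm : MeasurableSet good := measurableSet_lt hresm measurable_const
  have hinner : ∀ᵐ z₂ ∂(noiseLaw M), good.indicator (fun _ => τ) z₂ ≤
      ∫ z₁, (errorSet A h α c s).indicator (fun _ => (1 : ℝ)) (w, ψ (z₁, z₂)) ∂(noiseLaw M) := by
    filter_upwards [ae_noiseLaw_eq_zero M] with z₂ hz₂
    by_cases hg : z₂ ∈ good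
    swap
    · rw [Set.indicator_of_notMem hg]
      exact integral_nonneg fun z => Set.indicator_nonneg (by simp) _
    rw [Set.indicator_of_mem hg]
    have hg' : res z₂ < 2 * ((k : ℝ) / M.card) := hg
    have hr0 : 0 ≤ res z₂ := residual_nonneg hb z₂
    have hAz : ∀ z₁, A.mulVec (query h c w (ψ (z₁, z₂))) = A.mulVec (query h c w z₂) :=
      fun z₁ => by
      have h0 : ∀ z, A.mulVec (familyProj b z) = 0 := fun z => by
        rw [familyProj_apply, Matrix.mulVec_sum]
        simp [Matrix.mulVec_smul, hker]
      rw [mulVec_query, mulVec_query, hψ, Matrix.mulVec_add, Matrix.mulVec_sub, h0, h0,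
        sub_zero, zero_add]
    have hzs : ∀ z₁, ∀ i, i ∉ M → ψ (z₁, z₂) i = 0 :=
      fun z₁ i hi => by simp [hψ, familyProj_apply, hsupp _ i hi, hz₂ i hi]
    have hsq : ∀ z₁, ψ (z₁, z₂) ⬝ᵥ ψ (z₁, z₂) = ∑ j, (b j ⬝ᵥ z₁) ^ 2 + res z₂ :=
      fun z₁ => familyProj_split_sq hb z₁ z₂
    have hψ2 : Measurable fun z₁ : Fin n → ℝ => ((w, ψ (z₁, z₂)) : ℝ × (Fin n → ℝ)) :=
      measurable_const.prodMk (hmm.comp (measurable_id.prodMk measurable_const))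
    have hkt2 : (M.card : ℝ) * (k / M.card) = k := by field_simp
    have hdt : (M.card : ℝ) ≤ d + k := by exact_mod_cast hd1
    have hd2' : (d : ℝ) ≤ M.card := by exact_mod_cast hd2
    have hk0 : (0 : ℝ) ≤ k := Nat.cast_nonneg k
    rcases hs1 (A.mulVec (query h c w z₂)) with h1 | h1
    · refine hup.trans (measureReal_le_integral_indicator hE hψ2 fun z₁ hz₁ => ?_)
      refine mem_errorSet_of_norm_large hα hα1 hc hc1 hh (hzs z₁) (hdev.trans ?_) hw.1
        (by rw [hAz]; exact h1)
      refine mul_le_mul_of_nonneg_left ?_ (sq_nonneg c)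
      rw [hsq]
      have hz₁' : (0 : ℝ) ≤ lam * (M.card * ∑ j, (b j ⬝ᵥ z₁) ^ 2 - (d + lam * d)) := hz₁
      have h2 := nonneg_of_mul_nonneg_right hz₁' hlam0
      -- The right side is at least (1 + λ)d - m ≥ λ(m - k) - k ≥ λm - 2k; the visible part can only
      -- help.
      have h3 : M.card * (lam - 2 * (k / M.card)) ≤ M.card * (∑ j, (b j ⬝ᵥ z₁) ^ 2 - 1) := by
        have i1 : lam * k ≤ 1 * k := mul_le_mul_of_nonneg_right (by linarith) hk0
        have i2 : lam * M.card ≤ lam * (d + k) := mul_le_mul_of_nonneg_left hdt hlam0.le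
        have i3 : M.card * (lam - 2 * (k / M.card)) = lam * M.card - 2 * k := by
          rw [mul_sub, mul_left_comm, hkt2]; ring
        rw [i3, mul_sub, mul_one]
        linarith
      have := le_of_mul_le_mul_left h3 hmpos
      linarith
    · refine hdown.trans (measureReal_le_integral_indicator hE hψ2 fun z₁ hz₁ => ?_)
      refine mem_errorSet_of_norm_small hα hα1 hc hc1 hh (hzs z₁) (hdev.trans ?_) hw
        (by rw [hAz]; exact h1)
      refine mul_le_mul_of_nonneg_left ?_ (sq_nonneg c)
      rw [hsq]
      have h2 : (0 : ℝ) ≤ -lam * (M.card * ∑ j, (b j ⬝ᵥ z₁) ^ 2 - (d + -lam * d)) := hz₁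
      rw [neg_mul, ← mul_neg] at h2
      replace h2 := nonneg_of_mul_nonneg_right h2 hlam0
      have h3 : M.card * ∑ j, (b j ⬝ᵥ z₁) ^ 2 ≤ M.card * (1 - lam) := by
        have : d * (1 - lam) ≤ M.card * (1 - lam) :=
          mul_le_mul_of_nonneg_right hd2' (by linarith)
        linarith
      have := le_of_mul_le_mul_left h3 hmpos
      linarith
  have hfin := integral_mono_ae ((integrable_const τ).indicator hgoodm) hci.integral_prod_right
    hinner
  rw [integral_indicator_const _ hgoodm, smul_eq_mul] at hfin
  refine le_trans ?_ hfin
  have hτ0 : 0 < τ := by rw [hτ]; positivity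
  have : Real.exp (-2 * smallDev c ^ 2 - 1) / 8 = 1 / 2 * τ := by rw [hτ]; ring
  rw [this]
  exact mul_le_mul_of_nonneg_right hPgood hτ0.le

/-- Only signal weights on the plateau are counted; their probability is Hα = c/(c + 10) ≥ c/11. -/
theorem errorRate_small (hα : 0 < α) (hα1 : α < 1) (hc : 0 < c) (hc1 : c ≤ 1 / 10)
    (hh : h ∉ M) (hk : 0 < k) (hkm : (k : ℝ) ^ 2 ≤ M.card)
    (hm : 6400 * smallDev c ^ 6 ≤ M.card) (hsmall : M.card * α ^ 2 ≤ 320000 / c ^ 2)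
    (hs : Measurable s) (hs1 : ∀ y, s y = -1 ∨ s y = 1) :
    smallRate c ≤ ∫ p, (errorSet A h α c s).indicator (fun _ => (1 : ℝ)) p
      ∂((signalLaw α c).prod (noiseLaw M)) := by
  have hL := slopeLength_pos hα hc
  have hH := height_pos hα hc
  have hprob := isProbabilityMeasure_signalLaw hα hc
  have hE := measurableSet_errorSet (A := A) (h := h) (α := α) (c := c) hs
  have hEi : Integrable ((errorSet A h α c s).indicator fun _ => (1 : ℝ))
      ((signalLaw α c).prod (noiseLaw M)) := (integrable_const _).indicator hE
  rw [integral_prod _ hEi, integral_signalLaw hα hc]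
  set e : ℝ → ℝ := fun w => ∫ z, (errorSet A h α c s).indicator (fun _ => (1 : ℝ)) (w, z)
    ∂(noiseLaw M) with he
  have hem : Measurable e :=
    ((measurable_const.indicator hE).stronglyMeasurable.integral_prod_right').measurable
  have he0 : ∀ w, 0 ≤ e w := fun w => integral_nonneg fun z => Set.indicator_nonneg (by simp) _
  have he1 : ∀ w, |e w| ≤ 1 := fun w => by
    have := norm_integral_le_of_norm_le_const (μ := noiseLaw M) (C := 1)
      (f := fun z => (errorSet A h α c s).indicator (fun _ => (1 : ℝ)) (w, z))
      (ae_of_all _ fun z => (norm_indicator_le_norm_self _ _).trans (by simp))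
    simpa [he] using this
  have hi := integrable_signalDensity_mul hα hc hem he1
  have h1 : ∫ w in (plateau c)..(plateau c + α), signalDensity α c w * e w ≤
      ∫ w, signalDensity α c w * e w := by
    rw [intervalIntegral.integral_of_le (by linarith)]
    exact setIntegral_le_integral hi (ae_of_all _ fun w =>
      mul_nonneg (signalDensity_nonneg hα hc w) (he0 w))
  refine le_trans ?_ h1
  have h2 := mul_sub_le_intervalIntegral
    (m := height α c * (Real.exp (-2 * smallDev c ^ 2 - 1) / 8))
    (by linarith : plateau c ≤ plateau c + α) hi.intervalIntegrable fun w hw => by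
      have h3 : signalDensity α c w = height α c := by
        rw [signalDensity_eq hα hc, min_eq_left hw.1, min_eq_left (by linarith [hw.2]),
          sub_sub_cancel, max_eq_right hL.le, div_mul_cancel₀ _ hL.ne']
      rw [h3]
      exact mul_le_mul_of_nonneg_left
        (errorRate_slice_small hα hα1 hc hc1 hh hk hkm hm hsmall hs hs1 hw) hH.le
  refine le_trans ?_ h2
  have h4 : c / 11 ≤ height α c * α := by
    rw [height, slopeLength]
    have : (α + 10 * α / c)⁻¹ * α = c / (c + 10) := by field_simp
    rw [this, div_le_div_iff_of_pos_left hc (by norm_num) (by linarith)]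
    linarith
  have h5 : 0 < Real.exp (-2 * smallDev c ^ 2 - 1) / 8 := by positivity
  rw [smallRate]
  nlinarith [mul_le_mul_of_nonneg_right h4 h5.le]

end SmallSupport

/-! ### The optimal estimator of the signal -/

section Completeness

theorem gaussianPDFReal_shift (v : ℝ≥0) (hv : v ≠ 0) (t y : ℝ) :
    gaussianPDFReal (v * t) v y =
      Real.exp (-(v * t ^ 2 / 2)) * (gaussianPDFReal 0 v y * Real.exp (t * y)) := by
  have hv' : (v : ℝ) ≠ 0 := by exact_mod_cast hv
  simp only [gaussianPDFReal]
  have h : -(y - v * t) ^ 2 / (2 * v) = -(v * t ^ 2 / 2) + (-(y - 0) ^ 2 / (2 * v) + t * y) := by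
    field_simp
    ring
  rw [h, Real.exp_add, Real.exp_add]
  ring

/-- The likelihood ratio of N(vt, v) to N(0, v) is exp(ty - vt²/2). -/
theorem integral_mul_exp_of_shift {v : ℝ≥0} (hv : v ≠ 0) {g : ℝ → ℝ} (t : ℝ)
    (hi : Integrable g (gaussianReal (v * t) v)) :
    Integrable (fun y => g y * Real.exp (t * y)) (gaussianReal 0 v) ∧
      ∫ y, g y * Real.exp (t * y) ∂(gaussianReal 0 v) =
        Real.exp (v * t ^ 2 / 2) * ∫ y, g y ∂(gaussianReal (v * t) v) := by
  have e : ∀ y, gaussianPDFReal 0 v y • (g y * Real.exp (t * y)) =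
      Real.exp (v * t ^ 2 / 2) * (gaussianPDFReal (v * t) v y • g y) := fun y => by
    rw [gaussianPDFReal_shift v hv, smul_eq_mul, smul_eq_mul, Real.exp_neg]
    field_simp
  constructor
  · rw [gaussianReal_of_var_ne_zero _ hv, integrable_withDensity_iff_integrable_smul'
      (measurable_gaussianPDF _ _) (ae_of_all _ fun _ => gaussianPDF_lt_top)] at hi ⊢
    simp only [toReal_gaussianPDF] at hi ⊢
    simp_rw [e]
    exact hi.const_mul _
  · rw [integral_gaussianReal_eq_integral_smul hv, integral_gaussianReal_eq_integral_smul hv,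
      ← integral_const_mul]
    simp_rw [e]

/-- Completeness of the Gaussian location family. -/
theorem gaussianReal_complete {v : ℝ≥0} (hv : v ≠ 0) {g : ℝ → ℝ} (hg : Measurable g)
    (hi : ∀ w, Integrable g (gaussianReal w v)) (h0 : ∀ w, ∫ y, g y ∂(gaussianReal w v) = 0) :
    ∀ᵐ y ∂(gaussianReal 0 v), g y = 0 := by
  -- Choosing the mean w = vt translates vanishing means into a vanishing two-sided Laplace
  -- transform.
  have hexp : ∀ t, Integrable (fun y => g y * Real.exp (t * y)) (gaussianReal 0 v) ∧
      ∫ y, g y * Real.exp (t * y) ∂(gaussianReal 0 v) = 0 := fun t => by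
    have := integral_mul_exp_of_shift hv t (hi _)
    rwa [h0, mul_zero] at this
  set P := gaussianReal 0 v
  have hpart : ∀ f : ℝ → ℝ, Measurable f → (∀ t, Integrable (fun y => f y * Real.exp (t * y)) P) →
      ∀ t, Integrable (fun y => Real.exp (t * y)) (P.withDensity fun y => ENNReal.ofReal (f y)) ∧
        ∫ y, Real.exp (t * y) ∂(P.withDensity fun y => ENNReal.ofReal (f y)) =
          ∫ y, max (f y) 0 * Real.exp (t * y) ∂P ∧
        Integrable (fun y => max (f y) 0 * Real.exp (t * y)) P := by
    intro f hf hfi t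
    have h1 : Integrable (fun y => max (f y) 0 * Real.exp (t * y)) P := by
      refine (hfi t).norm.mono' (Measurable.aestronglyMeasurable (by fun_prop))
        (ae_of_all _ fun y => ?_)
      rw [norm_mul, norm_mul]
      refine mul_le_mul_of_nonneg_right ?_ (norm_nonneg _)
      rw [Real.norm_of_nonneg (le_max_right _ _), Real.norm_eq_abs]
      exact max_le (le_abs_self _) (abs_nonneg _)
    refine ⟨?_, ?_, h1⟩
    · rw [integrable_withDensity_iff_integrable_smul' hf.ennreal_ofReal
        (ae_of_all _ fun _ => by simp)]
      simpa [ENNReal.toReal_ofReal'] using h1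
    · rw [integral_withDensity_eq_integral_toReal_smul hf.ennreal_ofReal
        (ae_of_all _ fun _ => by simp)]
      simp [ENNReal.toReal_ofReal']
  have hp := hpart g hg fun t => (hexp t).1
  have hn := hpart (fun y => -g y) hg.neg fun t => by
    simpa using (hexp t).1.neg
  set μ₁ := P.withDensity fun y => ENNReal.ofReal (g y)
  set μ₂ := P.withDensity fun y => ENNReal.ofReal (-g y)
  have hf1 : IsFiniteMeasure μ₁ := isFiniteMeasure_withDensity_ofReal (hi 0).2
  have hf2 : IsFiniteMeasure μ₂ := isFiniteMeasure_withDensity_ofReal (hi 0).neg.2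
  -- The positive and the negative part of `g`, as densities, define finite measures with the same
  -- everywhere finite moment-generating function. Analytic continuation makes the measures equal,
  -- so the two parts agree and both vanish.
  have hmgf : mgf id μ₁ = mgf id μ₂ := by
    ext t
    simp only [mgf, id]
    rw [(hp t).2.1, (hn t).2.1, ← sub_eq_zero, ← integral_sub (hp t).2.2 (hn t).2.2]
    refine Eq.trans ?_ (hexp t).2
    refine integral_congr_ae (ae_of_all _ fun y => ?_)
    simp only
    rw [← sub_mul, max_zero_sub_max_neg_zero_eq_self]
  have hz : μ₁ = 0 ↔ μ₂ = 0 := by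
    have h1 := congrFun hmgf 0
    simp only [mgf_zero'] at h1
    rw [← Measure.measure_univ_eq_zero, ← Measure.measure_univ_eq_zero,
      ← measureReal_eq_zero_iff, ← measureReal_eq_zero_iff, h1]
  have hset : integrableExpSet id μ₁ = Set.univ := by
    ext t
    simpa [integrableExpSet] using (hp t).1
  have hC : complexMGF id μ₁ = complexMGF id μ₂ := by
    ext z
    refine eqOn_complexMGF_of_mgf' hmgf hz ?_
    simp [hset]
  have heq := Measure.ext_of_complexMGF_id_eq hC
  have hae := (withDensity_eq_iff hg.ennreal_ofReal.aemeasurable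
    hg.neg.ennreal_ofReal.aemeasurable (by
      have := hf1.measure_univ_lt_top
      rw [withDensity_apply _ MeasurableSet.univ, Measure.restrict_univ] at this
      exact this.ne)).1 heq
  filter_upwards [hae] with y hy
  change ENNReal.ofReal (g y) = ENNReal.ofReal (-g y) at hy
  rcases le_total 0 (g y) with h | h
  · rw [ENNReal.ofReal_of_nonpos (by simpa using h : -g y ≤ 0), ENNReal.ofReal_eq_zero] at hy
    exact le_antisymm hy h
  · rw [ENNReal.ofReal_of_nonpos h, eq_comm, ENNReal.ofReal_eq_zero] at hy
    linarith

end Completeness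

/-! ### Existence and optimality of the linear estimator -/

section Estimator

variable {n k : ℕ} {c : ℝ} {A : Matrix (Fin k) (Fin n) ℝ} {h : Fin n} {M : Finset (Fin n)}
  {x : Fin n → ℝ}

/-- The functional v ↦ x·v/(x·x) on vectors supported on `M` vanishes on the kernel of the sketch,
so it factors through `A`. -/
theorem exists_linear_estimator
    (horth : ∀ v : Fin n → ℝ, (∀ i, i ∉ M → v i = 0) → A.mulVec v = 0 → x ⬝ᵥ v = 0) :
    ∃ T : (Fin k → ℝ) →ₗ[ℝ] ℝ, ∀ v : Fin n → ℝ, (∀ i, i ∉ M → v i = 0) →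
      T (A.mulVec v) = x ⬝ᵥ v / x ⬝ᵥ x := by
  let φ : (M → ℝ) →ₗ[ℝ] (Fin k → ℝ) := A.mulVecLin ∘ₗ extendZero M
  let f : Module.Dual ℝ (M → ℝ) :=
    { toFun := fun y => x ⬝ᵥ extendZero M y / x ⬝ᵥ x
      map_add' := fun y z => by rw [map_add, dotProduct_add, add_div]
      map_smul' := fun r y => by
        rw [map_smul, dotProduct_smul, smul_eq_mul, mul_div_assoc]; rfl }
  have hf : f ∈ (LinearMap.ker φ).dualAnnihilator := by
    rw [Submodule.mem_dualAnnihilator]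
    intro y hy
    change x ⬝ᵥ extendZero M y / x ⬝ᵥ x = 0
    rw [horth (extendZero M y) (fun i hi => by simp [extendZero, hi]) hy, zero_div]
  rw [← LinearMap.range_dualMap_eq_dualAnnihilator_ker] at hf
  obtain ⟨T, hT⟩ := hf
  refine ⟨T, fun v hv => ?_⟩
  have h1 := LinearMap.congr_fun hT (fun i : M => v i)
  have h2 : extendZero M (fun i : M => v i) = v := by
    ext i
    by_cases hi : i ∈ M
    · simp [extendZero, hi]
    · simp [extendZero, hi, hv i hi]
  change T (A.mulVec (extendZero M fun i : M => v i)) = x ⬝ᵥ extendZero M (fun i : M => v i) / _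
    at h1
  rwa [h2] at h1

theorem sketchLaw_eq_map (hc : 0 < c) (hx : ∀ i, i ∉ M → x i = 0) (hx0 : x ≠ 0)
    (hA : A.mulVec x = A.mulVec (Pi.single h 1)) (w : ℝ) :
    sketchLaw A h M c w = ((gaussianReal 0 (dirVar c M x)).prod (noiseLaw M)).map
      (fun p => (w + p.1) • A.mulVec (Pi.single h 1) + c • A.mulVec (orthPart x p.2)) := by
  have hmA := measurable_mulVec A
  have hmo := (continuous_orthPart x).measurable
  rw [sketchLaw]
  conv_lhs => rw [← noiseLaw_map_direction hc M hx hx0]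
  have hmq : Measurable fun z => A.mulVec (query h c w z) :=
    hmA.comp ((measurable_query h c).comp (measurable_const.prodMk measurable_id))
  rw [Measure.map_map hmq (by fun_prop)]
  congr 1
  ext1 p
  exact mulVec_query_direction hc.ne' hA w p.1 _

/-- Almost surely `T` recovers w + u, which has law N(w, v), and the sketch is a function of w + u
and of the independent orthogonal noise. Unbiasedness is clear, and completeness is that of the
Gaussian location family. -/
theorem isOptimalEstimator_of_linear (hc : 0 < c) (hM : 0 < M.card)
    (hx : ∀ i, i ∉ M → x i = 0) (hx0 : x ≠ 0) (hA : A.mulVec x = A.mulVec (Pi.single h 1))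
    (T : (Fin k → ℝ) →ₗ[ℝ] ℝ) (hT : ∀ v : Fin n → ℝ, (∀ i, i ∉ M → v i = 0) →
      T (A.mulVec v) = x ⬝ᵥ v / x ⬝ᵥ x) : IsOptimalEstimator A h M c T := by
  have hTc : Continuous T := LinearMap.continuous_of_finiteDimensional T
  have hTm := hTc.measurable
  have hq := dotProduct_self_pos' hx0
  have hTh : T (A.mulVec (Pi.single h 1)) = 1 := by rw [← hA, hT x hx, div_self hq.ne']
  set v := dirVar c M x
  have hv : v ≠ 0 := dirVar_ne_zero hc hM hx0
  have hmA := measurable_mulVec A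
  have hmo := (continuous_orthPart x).measurable
  set ρ := (gaussianReal 0 v).prod (noiseLaw M)
  let F : ℝ → (Fin n → ℝ) → Fin k → ℝ := fun t z =>
    t • A.mulVec (Pi.single h 1) + c • A.mulVec (orthPart x z)
  have hF : Measurable fun p : ℝ × (Fin n → ℝ) => F p.1 p.2 := by fun_prop
  have hFw : ∀ w, Measurable fun p : ℝ × (Fin n → ℝ) => F (w + p.1) p.2 := fun w =>
    hF.comp ((measurable_const.add measurable_fst).prodMk measurable_snd)
  have hlaw : ∀ w, sketchLaw A h M c w = ρ.map fun p => F (w + p.1) p.2 :=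
    fun w => sketchLaw_eq_map hc hx hx0 hA w
  have hTF : ∀ w, ∀ᵐ p ∂ρ, T (F (w + p.1) p.2) = w + p.1 := fun w => by
    have h1 : ∀ᵐ p ∂ρ, ∀ i, i ∉ M → p.2 i = 0 :=
      Measure.quasiMeasurePreserving_snd.ae (ae_noiseLaw_eq_zero M)
    filter_upwards [h1] with p hp
    have h2 : T (A.mulVec (orthPart x p.2)) = 0 := by
      rw [hT _ fun i hi => by simp [orthPart, hp i hi, hx i hi], dotProduct_orthPart hx0, zero_div]
    simp only [F]
    rw [map_add, map_smul, map_smul, h2, hTh]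
    simp
  have hg : ∀ w, (gaussianReal 0 v).map (fun u => w + u) = gaussianReal w v := fun w => by
    rw [gaussianReal_map_const_add, zero_add]
  have hTlaw : ∀ w, (sketchLaw A h M c w).map T = gaussianReal w v := fun w => by
    rw [hlaw, Measure.map_map hTm (hFw w), ← hg w]
    rw [show (T ∘ fun p : ℝ × (Fin n → ℝ) => F (w + p.1) p.2) =
      fun p => T (F (w + p.1) p.2) from rfl, Measure.map_congr (hTF w)]
    have h2 : (fun p : ℝ × (Fin n → ℝ) => w + p.1) = (fun u => w + u) ∘ Prod.fst := rfl
    rw [h2, ← Measure.map_map (by fun_prop) measurable_fst]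
    congr 1
    exact (measurePreserving_fst (μ := gaussianReal 0 v) (ν := noiseLaw M)).map_eq
  refine ⟨hTc, fun w => ?_, ?_, ?_⟩
  · have hid : Integrable (fun y : ℝ => y) (gaussianReal w v) :=
      (memLp_id_gaussianReal (μ := w) (v := v) 1).integrable (by simp)
    rw [← hTlaw w] at hid
    refine ⟨(integrable_map_measure (by fun_prop) hTm.aemeasurable).1 hid, ?_⟩
    have := integral_map (μ := sketchLaw A h M c w) hTm.aemeasurable (f := fun y : ℝ => y)
      (by fun_prop)
    rw [← this, hTlaw, integral_id_gaussianReal]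
  -- Sufficiency: given T = t, the sketch is distributed as F(t, z) with fresh noise z, and `w` no
  -- longer enters.
  · let κ : Kernel ℝ (Fin k → ℝ) :=
      (Kernel.id ×ₖ Kernel.const ℝ (noiseLaw M)).map fun p => F p.1 p.2
    have hκ : IsMarkovKernel κ := Kernel.IsMarkovKernel.map _ hF
    refine ⟨κ, hκ, fun w => ?_⟩
    rw [hTlaw]
    refine Measure.ext_of_lintegral _ fun f hf => ?_
    have hκl : ∀ t (f' : (Fin k → ℝ) → ℝ≥0∞), Measurable f' →
        ∫⁻ y, f' y ∂(κ t) = ∫⁻ z, f' (F t z) ∂(noiseLaw M) := fun t f' hf' => by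
      have hfF : Measurable fun p : ℝ × (Fin n → ℝ) => f' (F p.1 p.2) := hf'.comp hF
      rw [Kernel.lintegral_map _ hF _ hf', Kernel.prod_apply, lintegral_prod _ hfF.aemeasurable,
        Kernel.id_apply, lintegral_dirac' _ (Measurable.lintegral_prod_right' hfF),
        Kernel.const_apply]
    have hTp : Measurable fun y => (T y, y) := hTm.prodMk measurable_id
    have hfT : Measurable fun y => f (T y, y) := hf.comp hTp
    rw [Measure.lintegral_compProd hf, lintegral_map hf hTp, hlaw, lintegral_map hfT (hFw w)]
    have e1 : ∫⁻ p, f (T (F (w + p.1) p.2), F (w + p.1) p.2) ∂ρ =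
        ∫⁻ p, f (w + p.1, F (w + p.1) p.2) ∂ρ := by
      refine lintegral_congr_ae ?_
      filter_upwards [hTF w] with p hp
      rw [hp]
    refine e1.trans ?_
    have hfF : Measurable fun p : ℝ × (Fin n → ℝ) => f (p.1, F p.1 p.2) :=
      hf.comp (measurable_fst.prodMk hF)
    have hfs : Measurable fun p : ℝ × (Fin n → ℝ) => f (w + p.1, F (w + p.1) p.2) :=
      hfF.comp ((measurable_const.add measurable_fst).prodMk measurable_snd)
    rw [lintegral_prod _ hfs.aemeasurable, ← hg w,
      lintegral_map (f := fun a => ∫⁻ b, f (a, b) ∂(κ a)) _ (by fun_prop)]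
    · refine lintegral_congr fun u => ?_
      exact (hκl (w + u) (fun b => f (w + u, b)) (hf.comp measurable_prodMk_left)).symm
    · have : (fun a => ∫⁻ b, f (a, b) ∂(κ a)) = fun a => ∫⁻ z, f (a, F a z) ∂(noiseLaw M) := by
        ext a
        exact hκl a _ (hf.comp measurable_prodMk_left)
      rw [this]
      exact Measurable.lintegral_prod_right' hfF
  · intro g hgm hg0 w
    have hint : ∀ w, Integrable g (gaussianReal w v) ∧ ∫ y, g y ∂(gaussianReal w v) = 0 :=
      fun w => by
      rw [← hTlaw w]
      refine ⟨(integrable_map_measure hgm.aestronglyMeasurable hTm.aemeasurable).2 (hg0 w).1, ?_⟩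
      rw [integral_map hTm.aemeasurable hgm.aestronglyMeasurable]
      exact (hg0 w).2
    have h0 := gaussianReal_complete hv hgm (fun w => (hint w).1) fun w => (hint w).2
    have hac : gaussianReal w v ≪ gaussianReal 0 v :=
      (gaussianReal_absolutelyContinuous w hv).trans (gaussianReal_absolutelyContinuous' 0 hv)
    have h1 := hac.ae_le h0
    rw [← hTlaw w] at h1
    exact ae_of_ae_map hTm.aemeasurable h1

end Estimator

/-! ### A random signal index is well captured by the kernel -/

section Leverage

variable {n k : ℕ}

/-- `p h` is the squared length of the projection y of `e_h` to the kernel on `S`. These numbers add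
up over `S` to the dimension of the kernel, at least |S| - k. -/
theorem exists_leverage (A : Matrix (Fin k) (Fin n) ℝ) (S : Finset (Fin n)) :
    ∃ p : Fin n → ℝ, (∀ h, p h ≤ 1) ∧ ∑ h ∈ S, (1 - p h) ≤ k ∧ ∀ h ∈ S, 0 < p h →
      ∃ x : Fin n → ℝ, (∀ i, i ∉ S.erase h → x i = 0) ∧
        A.mulVec x = A.mulVec (Pi.single h 1) ∧
        (∀ v : Fin n → ℝ, (∀ i, i ∉ S.erase h → v i = 0) → A.mulVec v = 0 → x ⬝ᵥ v = 0) ∧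
        x ⬝ᵥ x * p h = 1 - p h := by
  obtain ⟨d, b, hb, hbS, hbA, hexp, hd, -⟩ := exists_orthonormal_kernel A S
  have hy : ∀ h, familyProj b (Pi.single h 1) = ∑ j, b j h • b j := fun h => by
    simp [familyProj_apply]
  have hyh : ∀ h, familyProj b (Pi.single h 1) h = ∑ j, b j h ^ 2 := fun h => by
    simp [hy, sq]
  have hyy : ∀ h, familyProj b (Pi.single h 1) ⬝ᵥ familyProj b (Pi.single h 1) =
      ∑ j, b j h ^ 2 := fun h => by
    rw [familyProj_symm, familyProj_idem hb, single_dotProduct, one_mul, hyh]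
  refine ⟨fun h => ∑ j, b j h ^ 2, fun h => ?_, ?_, fun h hh hp => ?_⟩
  · have h1 : (∑ j, b j h ^ 2) ^ 2 ≤ ∑ j, b j h ^ 2 := by
      nth_rw 1 [← hyh]
      rw [← hyy, sq]
      exact Finset.single_le_sum (f := fun i => familyProj b (Pi.single h 1) i *
        familyProj b (Pi.single h 1) i) (fun i _ => mul_self_nonneg _) (Finset.mem_univ h)
    nlinarith
  · have h1 : ∑ h ∈ S, ∑ j, b j h ^ 2 = d := by
      rw [Finset.sum_comm]
      have : ∀ j, ∑ h ∈ S, b j h ^ 2 = 1 := fun j => by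
        have h2 := sum_sq_eq_dotProduct (y := b j) (hbS j)
        rw [hb, if_pos rfl] at h2
        simpa [sq] using h2
      simp [this]
    rw [Finset.sum_sub_distrib, h1]
    have : (S.card : ℝ) ≤ d + k := by exact_mod_cast hd
    simp only [Finset.sum_const, nsmul_eq_mul, mul_one]
    linarith
  · have hp : 0 < ∑ j, b j h ^ 2 := hp
    have hyh' := hyh h
    have hyy' := hyy h
    set p := ∑ j, b j h ^ 2
    set y := familyProj b (Pi.single h 1)
    have hAy : A.mulVec y = 0 := by
      simp only [y, familyProj_apply, Matrix.mulVec_sum, Matrix.mulVec_smul, hbA, smul_zero,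
        Finset.sum_const_zero]
    have hyS : ∀ i, i ∉ S → y i = 0 := fun i hi => by
      simp [y, familyProj_apply, hbS _ i hi]
    -- Since y h = p, subtracting y/p cancels the coordinate `h`; the sketch is unchanged because A
    -- y = 0, and the squared length is 1 - 2 + 1/p.
    refine ⟨Pi.single h 1 - p⁻¹ • y, fun i hi => ?_, ?_, fun v hv hAv => ?_, ?_⟩
    · by_cases hih : i = h
      · subst hih
        simp [hyh', hp.ne']
      · rw [Finset.mem_erase, not_and] at hi
        simp [hih, hyS i (hi hih)]
    · rw [Matrix.mulVec_sub, Matrix.mulVec_smul, hAy, smul_zero, sub_zero]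
    · have hvh : v h = 0 := hv h (Finset.notMem_erase h S)
      have hPv : familyProj b v = v :=
        (hexp v (fun i hi => hv i fun h' => hi (Finset.mem_of_mem_erase h')) hAv).symm
      rw [sub_dotProduct, smul_dotProduct, familyProj_symm, hPv, single_dotProduct, hvh]
      simp
    · have e1 : (Pi.single h 1 : Fin n → ℝ) ⬝ᵥ y = p := by
        rw [single_dotProduct, one_mul, hyh']
      have e2 : y ⬝ᵥ (Pi.single h 1 : Fin n → ℝ) = p := by rw [dotProduct_comm, e1]
      have e3 : y ⬝ᵥ y = p := hyy'
      simp only [sub_dotProduct, dotProduct_sub, smul_dotProduct, dotProduct_smul, e1, e2, e3,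
        single_dotProduct, smul_eq_mul, Pi.single_eq_same]
      field_simp
      ring

/-- The signal index is imitated on the sketch by a short vector supported on `M` and orthogonal
to the kernel of the sketch. -/
def HasShortImitation (A : Matrix (Fin k) (Fin n) ℝ) (h : Fin n) (M : Finset (Fin n)) : Prop :=
  ∃ x : Fin n → ℝ, (∀ i, i ∉ M → x i = 0) ∧ A.mulVec x = A.mulVec (Pi.single h 1) ∧
    (∀ v : Fin n → ℝ, (∀ i, i ∉ M → v i = 0) → A.mulVec v = 0 → x ⬝ᵥ v = 0) ∧
    M.card * x ⬝ᵥ x ≤ 100 * k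

open Classical in
-- Markov's inequality for 1 - p: at most |S|/50 indices have 1 - p ≥ 50k/|S|. For all others p ≥
-- 1/2, since |S| ≥ 100k, and so x·x ≤ 2(1 - p) < 100k/|S|.
theorem card_not_hasShortImitation_le (A : Matrix (Fin k) (Fin n) ℝ) (hk : 0 < k)
    (S : Finset (Fin n)) (hS : 100 * k ≤ S.card) :
    50 * (S.filter fun h => ¬ HasShortImitation A h (S.erase h)).card ≤ S.card := by
  obtain ⟨p, hp1, hpk, hp⟩ := exists_leverage A S
  have hk' : (0 : ℝ) < k := by exact_mod_cast hk
  have hS' : (100 * k : ℝ) ≤ S.card := by exact_mod_cast hS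
  have hbad : ∀ h ∈ S.filter fun h => ¬ HasShortImitation A h (S.erase h),
      50 * (k : ℝ) ≤ S.card * (1 - p h) := by
    intro h hh
    rw [Finset.mem_filter] at hh
    by_contra! hlt
    have hph : 1 / 2 ≤ p h := by nlinarith
    obtain ⟨x, hx, hA, ho, hq⟩ := hp h hh.1 (by linarith)
    refine hh.2 ⟨x, hx, hA, ho, ?_⟩
    have hq0 : 0 ≤ x ⬝ᵥ x := Finset.sum_nonneg fun i _ => mul_self_nonneg _
    have hc : ((S.erase h).card : ℝ) ≤ S.card := by
      exact_mod_cast Finset.card_le_card (Finset.erase_subset h S)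
    have h1 : x ⬝ᵥ x ≤ 2 * (1 - p h) := by nlinarith
    calc ((S.erase h).card : ℝ) * x ⬝ᵥ x ≤ S.card * (2 * (1 - p h)) := by gcongr
      _ ≤ 100 * k := by linarith
  have h1 : ∑ h ∈ S.filter fun h => ¬ HasShortImitation A h (S.erase h), (1 - p h) ≤ k :=
    (Finset.sum_le_sum_of_subset_of_nonneg (Finset.filter_subset _ _)
      fun h _ _ => by linarith [hp1 h]).trans hpk
  have h2 := Finset.card_nsmul_le_sum _ _ _ hbad
  rw [← Finset.mul_sum, nsmul_eq_mul] at h2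
  have h3 : (((S.filter fun h => ¬ HasShortImitation A h (S.erase h)).card : ℝ) * 50) * k ≤
      S.card * k := by
    have := mul_le_mul_of_nonneg_left h1 (Nat.cast_nonneg S.card)
    linarith
  have h4 := le_of_mul_le_mul_right h3 hk'
  have : (((S.filter fun h => ¬ HasShortImitation A h (S.erase h)).card * 50 : ℕ) : ℝ) ≤
      (S.card : ℝ) := by exact_mod_cast h4
  have := Nat.cast_le.1 this
  omega

open Classical in
-- Choosing (h, M) amounts to choosing S = M ∪ {h} first and then an element `h` of `S`; the bound
-- for fixed `S` is summed over the fibres.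
theorem card_choices_not_hasShortImitation_le (A : Matrix (Fin k) (Fin n) ℝ) (hk : 0 < k)
    {m : ℕ} (hm : 100 * k ≤ m + 1) :
    50 * ((choices n m).filter fun p => ¬ HasShortImitation A p.1 p.2).card ≤
      (choices n m).card := by
  have hmem : ∀ p ∈ choices n m, insert p.1 p.2 ∈ Finset.powersetCard (m + 1) Finset.univ := by
    intro p hp
    simp only [choices, Finset.mem_filter, Finset.mem_univ, true_and] at hp
    simp [Finset.card_insert_of_notMem hp.1, hp.2]
  rw [Finset.card_eq_sum_card_fiberwise (s := choices n m) (f := fun p => insert p.1 p.2) (fun p hp => hmem p hp),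
    Finset.card_eq_sum_card_fiberwise
      (s := (choices n m).filter fun p => ¬ HasShortImitation A p.1 p.2)
      (f := fun p => insert p.1 p.2) fun p hp => hmem p (Finset.mem_of_mem_filter p hp),
    Finset.mul_sum]
  refine Finset.sum_le_sum fun S hS => ?_
  have hSc : S.card = m + 1 := (Finset.mem_powersetCard.1 hS).2
  refine le_trans (Nat.mul_le_mul_left 50 ?_)
    ((card_not_hasShortImitation_le A hk S (hSc ▸ hm)).trans ?_)
  · refine Finset.card_le_card_of_injOn Prod.fst (fun p hp => ?_) fun p hp q hq hpq => ?_
    · simp only [choices, Finset.coe_filter, Finset.mem_filter, Finset.mem_univ, true_and,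
        Set.mem_ofPred_eq] at hp ⊢
      obtain ⟨⟨⟨h1, -⟩, h2⟩, rfl⟩ := hp
      exact ⟨Finset.mem_insert_self _ _, by rwa [Finset.erase_insert h1]⟩
    · simp only [choices, Finset.coe_filter, Finset.mem_filter, Finset.mem_univ, true_and,
        Set.mem_ofPred_eq] at hp hq
      refine Prod.ext hpq ?_
      rw [← Finset.erase_insert hp.1.1.1, ← Finset.erase_insert hq.1.1.1, hp.2, hq.2, hpq]
  · refine Finset.card_le_card_of_injOn (fun h => (h, S.erase h)) (fun h hh => ?_)
      fun h _ h' _ hhh => (Prod.ext_iff.1 hhh).1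
    have hh : h ∈ S := hh
    simp only [choices, Finset.coe_filter, Finset.mem_filter, Finset.mem_univ, true_and,
      Set.mem_ofPred_eq]
    exact ⟨⟨Finset.notMem_erase h S, by rw [Finset.card_erase_of_mem hh, hSc]; rfl⟩,
      Finset.insert_erase hh⟩

theorem choices_card_pos {m : ℕ} (hm : m < n) : 0 < (choices n m).card := by
  obtain ⟨M, hM, hMc⟩ := Finset.exists_subset_card_eq
    (s := (Finset.univ : Finset (Fin n)).erase ⟨m, hm⟩) (n := m) (by
      rw [Finset.card_erase_of_mem (Finset.mem_univ _), Finset.card_univ, Fintype.card_fin]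
      omega)
  refine Finset.card_pos.2 ⟨(⟨m, hm⟩, M), ?_⟩
  simp only [choices, Finset.mem_filter, Finset.mem_univ, true_and]
  exact ⟨fun h => (Finset.mem_erase.1 (hM h)).1 rfl, hMc⟩

end Leverage

/-! ### Adaptive sums along independent draws -/

section Adaptive

variable {E V : Type*}

/-- The sum of increments that depend on the past draws and the current one. -/
def adaptiveSum [AddCommMonoid V] (f : (t : ℕ) → (Fin t → E) → E → V) {r : ℕ} (x : Fin r → E) :
    V :=
  ∑ t : Fin r, f t (fun j : Fin (t : ℕ) => x ⟨j, j.isLt.trans t.isLt⟩) (x t)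

theorem adaptiveSum_snoc [AddCommMonoid V] (f : (t : ℕ) → (Fin t → E) → E → V) {r : ℕ}
    (x : Fin r → E) (y : E) :
    adaptiveSum f (Fin.snoc x y : Fin (r + 1) → E) = adaptiveSum f x + f r x y := by
  have h : ∀ t : Fin r, ∀ j : Fin (t : ℕ),
      (Fin.snoc x y : Fin (r + 1) → E) ⟨j, (j.isLt.trans t.isLt).trans (Nat.lt_succ_self r)⟩ =
        x ⟨j, j.isLt.trans t.isLt⟩ := fun t j =>
    Fin.snoc_castSucc (α := fun _ => E) y x ⟨j, j.isLt.trans t.isLt⟩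
  have h' : ∀ j : Fin r, (Fin.snoc x y : Fin (r + 1) → E) ⟨j, j.isLt.trans (Nat.lt_succ_self r)⟩ =
      x j := fun j => Fin.snoc_castSucc (α := fun _ => E) y x j
  simp only [adaptiveSum, Fin.sum_univ_castSucc, Fin.snoc_castSucc, Fin.snoc_last]
  congr 1
  · exact Finset.sum_congr rfl fun t _ => congrArg (fun u => f t u (x t)) (funext (h t))
  · exact congrArg (fun u => f r u y) (funext h')

variable [MeasurableSpace E]

theorem lintegral_pi_snoc (P : Measure E) [IsProbabilityMeasure P] {r : ℕ}
    {f : (Fin (r + 1) → E) → ℝ≥0∞} (hf : Measurable f) :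
    ∫⁻ x, f x ∂(Measure.pi fun _ : Fin (r + 1) => P) =
      ∫⁻ x, ∫⁻ y, f (Fin.snoc x y) ∂P ∂(Measure.pi fun _ : Fin r => P) := by
  have h := (measurePreserving_piFinSuccAbove (fun _ : Fin (r + 1) => P) (Fin.last r)).symm
  have hm : Measurable fun p =>
      f ((MeasurableEquiv.piFinSuccAbove (fun _ => E) (Fin.last r)).symm p) :=
    hf.comp h.measurable
  rw [← h.lintegral_comp hf, lintegral_prod_symm _ hm.aemeasurable]
  refine lintegral_congr fun x => lintegral_congr fun y => ?_
  rw [← Fin.insertNth_last']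
  rfl

/-- The growth of a potential along independent draws. -/
theorem lintegral_pi_potential_le (P : Measure E) [IsProbabilityMeasure P]
    {Ψ : (t : ℕ) → (Fin t → E) → ℝ≥0∞} (hΨ : ∀ t, Measurable (Ψ t)) (h0 : ∀ x, Ψ 0 x = 0)
    {a b : ℝ≥0∞} (ha : 1 ≤ a)
    (hstep : ∀ t x, ∫⁻ y, Ψ (t + 1) (Fin.snoc x y) ∂P ≤ a * Ψ t x + b) (r : ℕ) :
    ∫⁻ x, Ψ r x ∂(Measure.pi fun _ : Fin r => P) ≤ r * b * a ^ r := by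
  induction r with
  | zero => simp [h0]
  | succ r ih =>
    rw [lintegral_pi_snoc P (hΨ _)]
    refine (lintegral_mono fun x => hstep r x).trans ?_
    rw [lintegral_add_left ((hΨ r).const_mul a), lintegral_const_mul _ (hΨ r), lintegral_const,
      measure_univ, mul_one]
    have h1 : b ≤ b * a ^ (r + 1) := le_mul_of_one_le_right (zero_le) (one_le_pow₀ ha)
    calc a * ∫⁻ x, Ψ r x ∂(Measure.pi fun _ : Fin r => P) + b
        ≤ a * (r * b * a ^ r) + b * a ^ (r + 1) := by gcongr
      _ = ((r + 1 : ℕ) : ℝ≥0∞) * b * a ^ (r + 1) := by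
        push_cast
        ring

theorem measurable_adaptiveSum [AddCommMonoid V] [MeasurableSpace V] [MeasurableAdd₂ V]
    {Ω : Type*} [MeasurableSpace Ω] {f : (t : ℕ) → Ω → (Fin t → E) → E → V}
    (hf : ∀ t, Measurable fun p : Ω × (Fin t → E) × E => f t p.1 p.2.1 p.2.2) (r : ℕ) :
    Measurable fun p : Ω × (Fin r → E) => adaptiveSum (fun t => f t p.1) p.2 := by
  unfold adaptiveSum
  refine Finset.measurable_sum _ fun t _ => ?_
  exact (hf t).comp (measurable_fst.prodMk ((measurable_pi_lambda _ fun j =>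
    (measurable_pi_apply _).comp measurable_snd).prodMk
      ((measurable_pi_apply t).comp measurable_snd)))

theorem measurable_adaptiveSum' [AddCommMonoid V] [MeasurableSpace V] [MeasurableAdd₂ V]
    {f : (t : ℕ) → (Fin t → E) → E → V}
    (hf : ∀ t, Measurable fun p : (Fin t → E) × E => f t p.1 p.2) (r : ℕ) :
    Measurable fun x : Fin r → E => adaptiveSum f x := by
  have := measurable_adaptiveSum (Ω := Unit) (f := fun t _ => f t)
    (fun t => (hf t).comp measurable_snd) r
  exact this.comp (measurable_const (a := ()) |>.prodMk measurable_id)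

/-- Chebyshev's inequality for an adaptive sum whose increments have large conditional means. -/
theorem measure_adaptiveSum_lt_le (P : Measure E) [IsProbabilityMeasure P]
    {f : (t : ℕ) → (Fin t → E) → E → ℝ}
    (hf : ∀ t, Measurable fun p : (Fin t → E) × E => f t p.1 p.2) {μ₀ V₀ : ℝ} (hμ : 0 < μ₀)
    (hmean : ∀ t x, μ₀ ≤ ∫ y, f t x y ∂P) (hint : ∀ t x, Integrable (fun y => f t x y ^ 2) P)
    (hsq : ∀ t x, ∫ y, f t x y ^ 2 ∂P ≤ V₀) {r : ℕ} (hr : 0 < r) :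
    (Measure.pi fun _ : Fin r => P) {x | adaptiveSum f x < r * μ₀ / 2} ≤
      ENNReal.ofReal (4 * V₀ / (r * μ₀ ^ 2)) := by
  have hft : ∀ t x, Measurable fun y => f t x y := fun t x => (hf t).comp measurable_prodMk_left
  have hr' : (0 : ℝ) < r := by exact_mod_cast hr
  have hV : 0 ≤ V₀ := (integral_nonneg fun y => sq_nonneg (f 0 Fin.elim0 y)).trans (hsq 0 Fin.elim0)
  -- The squared deficit with respect to the line tμ₀. The positive part is needed because the
  -- conditional means are bounded only from below; one step then increases the potential by at most
  -- V₀ on average.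
  let Ψ : (t : ℕ) → (Fin t → E) → ℝ≥0∞ := fun t x =>
    ENNReal.ofReal ((max (t * μ₀ - adaptiveSum f x) 0) ^ 2)
  have hΨ : ∀ t, Measurable (Ψ t) := fun t =>
    ((((measurable_adaptiveSum' hf t).const_sub _).max measurable_const).pow_const 2).ennreal_ofReal
  have hstep : ∀ t x, ∫⁻ y, Ψ (t + 1) (Fin.snoc x y) ∂P ≤ 1 * Ψ t x + ENNReal.ofReal V₀ := by
    intro t x
    set u := max (t * μ₀ - adaptiveSum f x) 0 with hu
    have hu0 : 0 ≤ u := le_max_right _ _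
    have hi1 : Integrable (fun y => f t x y) P :=
      ((memLp_two_iff_integrable_sq (hft t x).aestronglyMeasurable).2 (hint t x)).integrable
        (by norm_num)
    have hi2 : Integrable (fun y => (u + (μ₀ - f t x y)) ^ 2) P := by
      have : (fun y => (u + (μ₀ - f t x y)) ^ 2) =
          fun y => (u + μ₀) ^ 2 - 2 * (u + μ₀) * f t x y + f t x y ^ 2 := by
        ext y
        ring
      rw [this]
      exact ((integrable_const _).sub (hi1.const_mul _)).add (hint t x)
    have hle : ∀ y, Ψ (t + 1) (Fin.snoc x y) ≤ ENNReal.ofReal ((u + (μ₀ - f t x y)) ^ 2) := by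
      intro y
      simp only [Ψ, adaptiveSum_snoc]
      refine ENNReal.ofReal_le_ofReal ?_
      rw [sq_le_sq, abs_of_nonneg (le_max_right _ _)]
      refine max_le (le_trans ?_ (le_abs_self _)) (abs_nonneg _)
      have := le_max_left (t * μ₀ - adaptiveSum f x) 0
      push_cast
      linarith
    refine (lintegral_mono hle).trans ?_
    rw [← ofReal_integral_eq_lintegral_ofReal hi2 (ae_of_all _ fun y => sq_nonneg _), one_mul,
      ← ENNReal.ofReal_add (sq_nonneg _) hV]
    refine ENNReal.ofReal_le_ofReal ?_
    have hcalc : ∫ y, (u + (μ₀ - f t x y)) ^ 2 ∂P =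
        (u + μ₀) ^ 2 - 2 * (u + μ₀) * ∫ y, f t x y ∂P + ∫ y, f t x y ^ 2 ∂P := by
      have : (fun y => (u + (μ₀ - f t x y)) ^ 2) =
          fun y => ((u + μ₀) ^ 2 - 2 * (u + μ₀) * f t x y) + f t x y ^ 2 := by
        ext y
        ring
      have hi3 : Integrable (fun y => (u + μ₀) ^ 2 - 2 * (u + μ₀) * f t x y) P :=
        (integrable_const _).sub (hi1.const_mul _)
      rw [this, integral_add hi3 (hint t x), integral_sub (integrable_const _) (hi1.const_mul _), integral_const_mul]
      simp
    rw [hcalc]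
    have h1 := hmean t x
    have h2 := hsq t x
    nlinarith [mul_nonneg (by positivity : 0 ≤ u + μ₀) (sub_nonneg.2 h1)]
  have hpot := lintegral_pi_potential_le P hΨ (fun x => by simp [Ψ, adaptiveSum]) le_rfl hstep r
  rw [one_pow, mul_one] at hpot
  have hsub : {x : Fin r → E | adaptiveSum f x < r * μ₀ / 2} ⊆
      {x | ENNReal.ofReal ((r * μ₀ / 2) ^ 2) ≤ Ψ r x} := by
    intro x hx
    have hx : adaptiveSum f x < r * μ₀ / 2 := hx
    refine ENNReal.ofReal_le_ofReal (pow_le_pow_left₀ (by positivity) ?_ 2)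
    exact le_max_of_le_left (by linarith)
  refine (measure_mono hsub).trans ((meas_ge_le_lintegral_div (hΨ r).aemeasurable
    (ENNReal.ofReal_pos.2 (by positivity)).ne' ENNReal.ofReal_ne_top).trans ?_)
  refine (ENNReal.div_le_div_right hpot _).trans ?_
  rw [← ENNReal.ofReal_natCast, ← ENNReal.ofReal_mul (by positivity),
    ← ENNReal.ofReal_div_of_pos (by positivity)]
  refine ENNReal.ofReal_le_ofReal (le_of_eq ?_)
  field_simp
  ring

end Adaptive

/-! ### Length of a sum of noise vectors with adaptive signs -/

section SignedSum

variable {n : ℕ} {M : Finset (Fin n)} {α c : ℝ}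

/-- This form allows arbitrary `x`, because the partial sums to which it is applied are supported on
`M` only almost surely. -/
theorem integral_dotProduct_sq_le (M : Finset (Fin n)) (x : Fin n → ℝ) :
    Integrable (fun z => (x ⬝ᵥ z) ^ 2) (noiseLaw M) ∧
      ∫ z, (x ⬝ᵥ z) ^ 2 ∂(noiseLaw M) ≤ x ⬝ᵥ x / M.card := by
  let x' : Fin n → ℝ := fun i => if i ∈ M then x i else 0
  have hx' : ∀ i, i ∉ M → x' i = 0 := fun i hi => if_neg hi
  have hae : (fun z => (x' ⬝ᵥ z) ^ 2) =ᵐ[noiseLaw M] fun z => (x ⬝ᵥ z) ^ 2 := by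
    filter_upwards [ae_noiseLaw_eq_zero M] with z hz
    congr 1
    refine Finset.sum_congr rfl fun i _ => ?_
    by_cases hi : i ∈ M
    · simp [x', hi]
    · simp [hz i hi]
  refine ⟨(integrable_dotProduct_pow M x' hx' 2).congr hae, ?_⟩
  rw [← integral_congr_ae hae, integral_dotProduct_sq M x' hx']
  refine div_le_div_of_nonneg_right (Finset.sum_le_sum fun i _ => ?_) (Nat.cast_nonneg _)
  by_cases hi : i ∈ M
  · simp [x', hi]
  · simpa [x', hi] using mul_self_nonneg (x i)

/-- The signed sum of the noise vectors is short, for arbitrary adaptive signs. -/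
theorem measure_signedSum_gt_le (hα : 0 < α) (hc : 0 < c) (hM : 0 < M.card)
    {f : (t : ℕ) → (Fin t → ℝ × (Fin n → ℝ)) → ℝ × (Fin n → ℝ) → ℝ}
    (hf : ∀ t, Measurable fun p : (Fin t → ℝ × (Fin n → ℝ)) × (ℝ × (Fin n → ℝ)) => f t p.1 p.2)
    (hf1 : ∀ t x y, f t x y = -1 ∨ f t x y = 1) {r : ℕ} (hr : 0 < r) :
    (Measure.pi fun _ : Fin r => (signalLaw α c).prod (noiseLaw M))
      {x | 150 * (r * (r / M.card + 1)) < adaptiveSum (fun t x y => f t x y • y.2) x ⬝ᵥ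
        adaptiveSum (fun t x y => f t x y • y.2) x} ≤ ENNReal.ofReal (1 / 50) := by
  have hprob := isProbabilityMeasure_signalLaw hα hc
  have hr' : (0 : ℝ) < r := by exact_mod_cast hr
  have hm : (0 : ℝ) < M.card := by exact_mod_cast hM
  set P := (signalLaw α c).prod (noiseLaw M)
  let F : (t : ℕ) → (Fin t → ℝ × (Fin n → ℝ)) → ℝ × (Fin n → ℝ) → (Fin n → ℝ) :=
    fun t x y => f t x y • y.2
  have hF : ∀ t, Measurable fun p : (Fin t → ℝ × (Fin n → ℝ)) × (ℝ × (Fin n → ℝ)) =>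
      F t p.1 p.2 := fun t => (hf t).smul (measurable_snd.comp measurable_snd)
  have hdot : Measurable fun v : Fin n → ℝ => v ⬝ᵥ v := by
    unfold dotProduct
    fun_prop
  have hdot0 : ∀ v : Fin n → ℝ, 0 ≤ v ⬝ᵥ v := fun v =>
    Finset.sum_nonneg fun i _ => mul_self_nonneg _
  let Ψ : (t : ℕ) → (Fin t → ℝ × (Fin n → ℝ)) → ℝ≥0∞ := fun t x =>
    ENNReal.ofReal (adaptiveSum F x ⬝ᵥ adaptiveSum F x)
  have hΨ : ∀ t, Measurable (Ψ t) := fun t =>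
    (hdot.comp (measurable_adaptiveSum' hF t)).ennreal_ofReal
  have hstep : ∀ t x, ∫⁻ y, Ψ (t + 1) (Fin.snoc x y) ∂P ≤
      ENNReal.ofReal (1 + 1 / r) * Ψ t x + ENNReal.ofReal (r / M.card + 1) := by
    intro t x
    set S := adaptiveSum F x
    -- The sign may depend on the current noise, so the cross term 2 s (S·z) need not average out.
    -- It is bounded by (m/r)(S·z)² + r/m, whose mean is at most (S·S)/r + r/m.
    let g : (Fin n → ℝ) → ℝ := fun z =>
      S ⬝ᵥ S + M.card / r * (S ⬝ᵥ z) ^ 2 + r / M.card + z ⬝ᵥ z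
    have hS := integral_dotProduct_sq_le M S
    have hz := integral_dotProduct_self hM
    have hg : Integrable g (noiseLaw M) :=
      (((integrable_const _).add (hS.1.const_mul _)).add (integrable_const _)).add hz.1
    have hg0 : ∀ z, 0 ≤ g z := fun z => by
      have h1 := hdot0 S
      have h2 := hdot0 z
      positivity
    have hle : ∀ y : ℝ × (Fin n → ℝ), Ψ (t + 1) (Fin.snoc x y) ≤ ENNReal.ofReal (g y.2) := by
      intro y
      simp only [Ψ, adaptiveSum_snoc]
      refine ENNReal.ofReal_le_ofReal ?_
      change (S + f t x y • y.2) ⬝ᵥ (S + f t x y • y.2) ≤ g y.2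
      have hs2 : f t x y * f t x y = 1 := by rcases hf1 t x y with h | h <;> simp [h]
      have e : (S + f t x y • y.2) ⬝ᵥ (S + f t x y • y.2) =
          S ⬝ᵥ S + 2 * (f t x y * (S ⬝ᵥ y.2)) + f t x y * f t x y * (y.2 ⬝ᵥ y.2) := by
        simp only [add_dotProduct, dotProduct_add, smul_dotProduct, dotProduct_smul, smul_eq_mul,
          dotProduct_comm y.2 S]
        ring
      have h3 : 2 * (f t x y * (S ⬝ᵥ y.2)) ≤
          M.card / r * (S ⬝ᵥ y.2) ^ 2 + r / M.card := by
        have h4 : M.card / r * (S ⬝ᵥ y.2) ^ 2 + r / M.card - 2 * (f t x y * (S ⬝ᵥ y.2)) =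
            M.card / r * (f t x y * (S ⬝ᵥ y.2) - r / M.card) ^ 2 := by
          have h5 : (f t x y * (S ⬝ᵥ y.2) - r / M.card) ^ 2 =
              f t x y * f t x y * (S ⬝ᵥ y.2) ^ 2 - 2 * (f t x y * (S ⬝ᵥ y.2)) * (r / M.card) +
                (r / M.card) ^ 2 := by ring
          rw [h5, hs2]
          field_simp
          ring
        have h6 : 0 ≤ M.card / r * (f t x y * (S ⬝ᵥ y.2) - r / M.card) ^ 2 := by positivity
        linarith
      rw [e, hs2, one_mul]
      simp only [g]
      linarith
    refine (lintegral_mono hle).trans ?_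
    have hgm : Measurable g := by
      simp only [g]
      unfold dotProduct
      fun_prop
    have hsnd : ∫⁻ y, ENNReal.ofReal (g y.2) ∂P = ∫⁻ z, ENNReal.ofReal (g z) ∂(noiseLaw M) :=
      (measurePreserving_snd (μ := signalLaw α c) (ν := noiseLaw M)).lintegral_comp
        hgm.ennreal_ofReal
    rw [hsnd, ← ofReal_integral_eq_lintegral_ofReal hg (ae_of_all _ hg0),
      ← ENNReal.ofReal_mul (by positivity), ← ENNReal.ofReal_add
        (mul_nonneg (by positivity) (hdot0 S)) (by positivity)]
    refine ENNReal.ofReal_le_ofReal ?_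
    have hcalc : ∫ z, g z ∂(noiseLaw M) =
        S ⬝ᵥ S + M.card / r * (∫ z, (S ⬝ᵥ z) ^ 2 ∂(noiseLaw M)) + r / M.card + 1 := by
      have hi1 : Integrable (fun z => S ⬝ᵥ S + M.card / r * (S ⬝ᵥ z) ^ 2) (noiseLaw M) :=
        (integrable_const _).add (hS.1.const_mul _)
      have hi2 : Integrable (fun z => S ⬝ᵥ S + M.card / r * (S ⬝ᵥ z) ^ 2 + r / M.card)
        (noiseLaw M) := hi1.add (integrable_const _)
      simp only [g]
      rw [integral_add hi2 hz.1, integral_add hi1 (integrable_const _), integral_add (integrable_const _) (hS.1.const_mul _), integral_const_mul, hz.2]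
      simp
    have h7 : M.card / r * (∫ z, (S ⬝ᵥ z) ^ 2 ∂(noiseLaw M)) ≤ 1 / r * (S ⬝ᵥ S) := by
      refine (mul_le_mul_of_nonneg_left hS.2 (by positivity)).trans (le_of_eq ?_)
      field_simp
    rw [hcalc]
    change _ ≤ (1 + 1 / (r : ℝ)) * (S ⬝ᵥ S) + _
    linarith
  have ha : (1 : ℝ≥0∞) ≤ ENNReal.ofReal (1 + 1 / r) := by
    rw [ENNReal.one_le_ofReal]
    have : 0 ≤ 1 / (r : ℝ) := by positivity
    linarith
  have hpot := lintegral_pi_potential_le P hΨ (fun x => by simp [Ψ, adaptiveSum]) ha hstep r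
  -- The weight m/r above was chosen to keep this accumulated factor bounded; 150 is 3 times the 50
  -- of Markov's inequality.
  have hexp : (1 + 1 / (r : ℝ)) ^ r ≤ 3 := by
    have h1 : 1 + 1 / (r : ℝ) ≤ Real.exp (1 / r) := by
      have := Real.add_one_le_exp (1 / (r : ℝ))
      linarith
    calc (1 + 1 / (r : ℝ)) ^ r ≤ Real.exp (1 / r) ^ r := by gcongr
      _ = Real.exp 1 := by
        rw [← Real.exp_nat_mul]
        congr 1
        field_simp
      _ ≤ 3 := Real.exp_one_lt_three.le
  have hpot' : ∫⁻ x, Ψ r x ∂(Measure.pi fun _ : Fin r => P) ≤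
      ENNReal.ofReal (r * (r / M.card + 1) * 3) := by
    refine hpot.trans ?_
    rw [← ENNReal.ofReal_natCast, ← ENNReal.ofReal_pow (by positivity),
      ← ENNReal.ofReal_mul (by positivity), ← ENNReal.ofReal_mul (by positivity)]
    gcongr
  have hsub : {x : Fin r → ℝ × (Fin n → ℝ) | 150 * (r * (r / M.card + 1)) <
      adaptiveSum F x ⬝ᵥ adaptiveSum F x} ⊆
      {x | ENNReal.ofReal (150 * (r * (r / M.card + 1))) ≤ Ψ r x} := fun x hx =>
    ENNReal.ofReal_le_ofReal (le_of_lt hx)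
  refine (measure_mono hsub).trans ((meas_ge_le_lintegral_div (hΨ r).aemeasurable
    (ENNReal.ofReal_pos.2 (by positivity)).ne' ENNReal.ofReal_ne_top).trans ?_)
  refine (ENNReal.div_le_div_right hpot' _).trans ?_
  rw [← ENNReal.ofReal_div_of_pos (by positivity)]
  refine ENNReal.ofReal_le_ofReal (le_of_eq ?_)
  field_simp
  norm_num

end SignedSum

/-! ### Success of the attack for a good signal index -/

section Output

variable {n k : ℕ} {c γ : ℝ} {A : Matrix (Fin k) (Fin n) ℝ} {h : Fin n} {M : Finset (Fin n)}
  {x : Fin n → ℝ}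

theorem l2norm_smul (a : ℝ) (v : Fin n → ℝ) : l2norm (a • v) = |a| * l2norm v := by
  rw [l2norm, l2norm, WithLp.toLp_smul, norm_smul, Real.norm_eq_abs]

/-- By linearity the signal cancels, and the deviation of the estimator is (x·Z)/((x·x)‖Z‖) for
every `w`. -/
theorem isAdversarial_of_signedSum (hc : 0 < c) (hM : 0 < M.card)
    (hx : ∀ i, i ∉ M → x i = 0) (hA : A.mulVec x = A.mulVec (Pi.single h 1))
    (horth : ∀ v : Fin n → ℝ, (∀ i, i ∉ M → v i = 0) → A.mulVec v = 0 → x ⬝ᵥ v = 0)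
    {Z : Fin n → ℝ} (hZ : ∀ i, i ∉ M → Z i = 0)
    (hlt : γ * (x ⬝ᵥ x) * √(Z ⬝ᵥ Z) < x ⬝ᵥ Z) :
    IsAdversarial A h M c γ ((l2norm Z)⁻¹ • Z) := by
  have hx0 : x ≠ 0 := by
    rintro rfl
    simp at hlt
  have hZ0 : Z ≠ 0 := by
    rintro rfl
    simp at hlt
  have hq := dotProduct_self_pos' hx0
  have hD : l2norm Z = √(Z ⬝ᵥ Z) := by
    rw [eq_comm, Real.sqrt_eq_iff_eq_sq (dotProduct_self_pos' hZ0).le (l2norm_nonneg Z),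
      l2norm_sq]
    exact Finset.sum_congr rfl fun i _ => (sq (Z i)).symm
  have hDpos : 0 < l2norm Z := hD ▸ Real.sqrt_pos.2 (dotProduct_self_pos' hZ0)
  obtain ⟨T, hT⟩ := exists_linear_estimator horth
  have hu : ∀ i, i ∉ M → ((l2norm Z)⁻¹ • Z) i = 0 := fun i hi => by simp [hZ i hi]
  refine ⟨?_, hu, T, isOptimalEstimator_of_linear hc hM hx hx0 hA T hT, fun w => ?_⟩
  · rw [l2norm_smul, abs_of_pos (inv_pos.2 hDpos), inv_mul_cancel₀ hDpos.ne']
  · have hTh : T (A.mulVec (Pi.single h 1)) = 1 := by rw [← hA, hT x hx, div_self hq.ne']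
    have e : T (A.mulVec (query h 1 w ((l2norm Z)⁻¹ • Z))) - w =
        x ⬝ᵥ Z / (x ⬝ᵥ x * l2norm Z) := by
      rw [query, one_smul, Matrix.mulVec_add, map_add, hT _ hu, Matrix.mulVec_smul, map_smul, hTh,
        dotProduct_smul]
      simp only [smul_eq_mul]
      field_simp
      ring
    rw [e]
    refine lt_of_lt_of_le ?_ (le_abs_self _)
    rw [lt_div_iff₀ (mul_pos hq hDpos), hD, ← mul_assoc]
    exact hlt

end Output

/-! ### Probability of success for fixed signal index and support -/

section Run

variable {n k : ℕ} {α c γ δ : ℝ} {A : Matrix (Fin k) (Fin n) ℝ} {h : Fin n}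
  {M : Finset (Fin n)} {Ω : Type*} [MeasurableSpace Ω] {μ : Measure Ω} {R : Responder k n Ω} {r : ℕ}

theorem measurable_answer_query (R : Responder k n Ω) (A : Matrix (Fin k) (Fin n) ℝ) (h : Fin n)
    (M : Finset (Fin n)) (c : ℝ) (t : ℕ) :
    Measurable fun p : Ω × (Fin t → ℝ × (Fin n → ℝ)) × (ℝ × (Fin n → ℝ)) =>
      R.answer h M t p.1 p.2.1 (A.mulVec (query h c p.2.2.1 p.2.2.2)) :=
  (R.measurable_answer h M t).comp (measurable_fst.prodMk
    ((measurable_fst.comp measurable_snd).prodMk ((measurable_mulVec A).comp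
      ((measurable_query h c).comp (measurable_snd.comp measurable_snd)))))

theorem measurable_answer_right (R : Responder k n Ω) (h : Fin n) (M : Finset (Fin n)) (t : ℕ)
    (ω : Ω) (past : Fin t → ℝ × (Fin n → ℝ)) : Measurable (R.answer h M t ω past) :=
  (R.measurable_answer h M t).comp (measurable_const.prodMk
    (measurable_const.prodMk measurable_id))

theorem measurable_errorIndicator (R : Responder k n Ω) (A : Matrix (Fin k) (Fin n) ℝ)
    (h : Fin n) (M : Finset (Fin n)) (α c : ℝ) (t : ℕ) :
    Measurable fun p : Ω × (Fin t → ℝ × (Fin n → ℝ)) × (ℝ × (Fin n → ℝ)) =>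
      (errorSet A h α c (R.answer h M t p.1 p.2.1)).indicator (fun _ => (1 : ℝ)) p.2.2 := by
  have hS : MeasurableSet {p : Ω × (Fin t → ℝ × (Fin n → ℝ)) × (ℝ × (Fin n → ℝ)) |
      ¬ IsGapAnswer 1 α (l2norm (query h c p.2.2.1 p.2.2.2))
        (R.answer h M t p.1 p.2.1 (A.mulVec (query h c p.2.2.1 p.2.2.2)))} :=
    measurableSet_gap (continuous_l2norm.measurable.comp ((measurable_query h c).comp
      (measurable_snd.comp measurable_snd))) (measurable_answer_query R A h M c t) 1
  exact measurable_const.indicator hS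

theorem errorCount_eq_adaptiveSum (ω : Ω) (x : Fin r → ℝ × (Fin n → ℝ)) :
    (errorCount R A h M α c ω x : ℝ) = adaptiveSum (fun t past y =>
      (errorSet A h α c (R.answer h M t ω past)).indicator (fun _ => (1 : ℝ)) y) x := by
  classical
  rw [errorCount, Set.ncard_eq_toFinset_card', Set.toFinset_ofPred, Finset.card_filter,
    Nat.cast_sum]
  refine Finset.sum_congr rfl fun t _ => ?_
  rw [Nat.cast_ite, Nat.cast_one, Nat.cast_zero]
  beta_reduce
  rw [Set.indicator_apply]
  exact if_congr Iff.rfl rfl rfl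

theorem ae_runLaw_eq_zero (hα : 0 < α) (hc : 0 < c) :
    ∀ᵐ p ∂(runLaw r μ M α c), ∀ t i, i ∉ M → (p.2 t).2 i = 0 := by
  have hprob := isProbabilityMeasure_signalLaw hα hc
  rw [ae_all_iff]
  intro t
  have h1 : ∀ᵐ y ∂((signalLaw α c).prod (noiseLaw M)), ∀ i, i ∉ M → y.2 i = 0 :=
    Measure.quasiMeasurePreserving_snd.ae (ae_noiseLaw_eq_zero M)
  have h2 := (Measure.quasiMeasurePreserving_eval
    (μ := fun _ : Fin r => (signalLaw α c).prod (noiseLaw M)) t).ae h1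
  exact Measure.quasiMeasurePreserving_snd.ae h2

variable [IsProbabilityMeasure μ]

theorem prod_measure_le_of_forall {X : Type*} [MeasurableSpace X] {ν : Measure X}
    [IsProbabilityMeasure ν] {F : Set (Ω × X)} (hF : MeasurableSet F) {ε : ℝ≥0∞}
    (hle : ∀ ω, ν {x | (ω, x) ∈ F} ≤ ε) : (μ.prod ν) F ≤ ε := by
  rw [Measure.prod_apply hF]
  exact (lintegral_mono hle).trans (by simp)

/-- Only the bad event `F` has to be measurable. The success event involves the existence of an
estimator and is bounded from below through the complement of `F`. -/
theorem measureReal_ge_of_ae_compl_le {X : Type*} [MeasurableSpace X] {ν : Measure X}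
    [IsProbabilityMeasure ν] {F G : Set X} (hF : MeasurableSet F) {ε : ℝ} (hε : 0 ≤ ε)
    (hle : ν F ≤ ENNReal.ofReal ε) (hG : ∀ᵐ p ∂ν, p ∉ F → p ∈ G) : 1 - ε ≤ ν.real G := by
  have h1 : ν.real F ≤ ε := ENNReal.toReal_le_of_le_ofReal hε hle
  have h2 : ν.real Fᶜ ≤ ν.real G :=
    ENNReal.toReal_mono (measure_ne_top _ _) (measure_mono_ae hG)
  rw [probReal_compl_eq_one_sub hF] at h2
  linarith

theorem measurable_errorCount (R : Responder k n Ω) (A : Matrix (Fin k) (Fin n) ℝ) (h : Fin n)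
    (M : Finset (Fin n)) (α c : ℝ) (r : ℕ) :
    Measurable fun p : Ω × (Fin r → ℝ × (Fin n → ℝ)) => (errorCount R A h M α c p.1 p.2 : ℝ) := by
  simp_rw [errorCount_eq_adaptiveSum]
  exact measurable_adaptiveSum (f := fun t ω past y =>
    (errorSet A h α c (R.answer h M t ω past)).indicator (fun _ => (1 : ℝ)) y)
    (measurable_errorIndicator R A h M α c) r

theorem measure_errorCount_lt_le (hα : 0 < α) (hα1 : α < 1) (hc : 0 < c) (hc1 : c ≤ 1 / 10)
    (hh : h ∉ M) (hk : 0 < k) (hkm : (k : ℝ) ^ 2 ≤ M.card)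
    (hm : 6400 * smallDev c ^ 6 ≤ M.card) (hsmall : M.card * α ^ 2 ≤ 320000 / c ^ 2)
    (hr : 0 < r) (ω : Ω) :
    (Measure.pi fun _ : Fin r => (signalLaw α c).prod (noiseLaw M))
      {x | (errorCount R A h M α c ω x : ℝ) < r * smallRate c / 2} ≤
        ENNReal.ofReal (4 * 1 / (r * smallRate c ^ 2)) := by
  have hprob := isProbabilityMeasure_signalLaw hα hc
  have hp0 := smallRate_pos hc
  simp_rw [errorCount_eq_adaptiveSum]
  have hs := measurable_answer_right R h M
  have hE : ∀ t past, MeasurableSet (errorSet A h α c (R.answer h M t ω past)) :=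
    fun t past => measurableSet_errorSet (hs t ω past)
  have e : ∀ t past, (fun y => (errorSet A h α c (R.answer h M t ω past)).indicator
      (fun _ => (1 : ℝ)) y ^ 2) =
      (errorSet A h α c (R.answer h M t ω past)).indicator fun _ => (1 : ℝ) := by
    intro t past
    ext y
    by_cases hy : y ∈ errorSet A h α c (R.answer h M t ω past)
    · rw [Set.indicator_of_mem hy, one_pow]
    · rw [Set.indicator_of_notMem hy, sq, mul_zero]
  refine measure_adaptiveSum_lt_le ((signalLaw α c).prod (noiseLaw M))
    (f := fun t past y =>
      (errorSet A h α c (R.answer h M t ω past)).indicator (fun _ => (1 : ℝ)) y)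
    (fun t => ?_) hp0 (fun t past => ?_) (fun t past => ?_) (fun t past => ?_) hr
  · have h1 := measurable_errorIndicator R A h M α c t
    have h2 : Measurable fun p : (Fin t → ℝ × (Fin n → ℝ)) × (ℝ × (Fin n → ℝ)) => (ω, p) :=
      measurable_prodMk_left
    have h3 := h1.comp h2
    rw [Function.comp_def] at h3
    exact h3
  · exact errorRate_small hα hα1 hc hc1 hh hk hkm hm hsmall (hs t ω past) (R.answer_eq h M t ω past)
  · rw [e]
    exact (integrable_const _).indicator (hE t past)
  · rw [e, integral_indicator_const _ (hE t past), smul_eq_mul, mul_one]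
    exact measureReal_le_one

theorem successEvent_ge_of_small (hα : 0 < α) (hα1 : α < 1) (hc : 0 < c) (hc1 : c ≤ 1 / 10)
    (hh : h ∉ M) (hk : 0 < k) (hkm : (k : ℝ) ^ 2 ≤ M.card)
    (hm : 6400 * smallDev c ^ 6 ≤ M.card) (hsmall : M.card * α ^ 2 ≤ 320000 / c ^ 2)
    (hδ : δ ≤ smallRate c / 4) (hr : 200 / smallRate c ^ 2 ≤ r) :
    24 / 25 ≤ (runLaw r μ M α c).real (successEvent r R A h M α c γ δ) := by
  have hprob := isProbabilityMeasure_signalLaw hα hc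
  have hp0 := smallRate_pos hc
  have hr0 : (0 : ℝ) < r := lt_of_lt_of_le (by positivity) hr
  set F : Set (Ω × (Fin r → ℝ × (Fin n → ℝ))) :=
    {p | (errorCount R A h M α c p.1 p.2 : ℝ) < r * smallRate c / 2}
  have hF : MeasurableSet F :=
    measurableSet_lt (measurable_errorCount R A h M α c r) measurable_const
  have hFle : runLaw r μ M α c F ≤ ENNReal.ofReal (1 / 50) := by
    refine prod_measure_le_of_forall hF fun ω => ?_
    refine (measure_errorCount_lt_le hα hα1 hc hc1 hh hk hkm hm hsmall (by exact_mod_cast hr0)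
      ω).trans (ENNReal.ofReal_le_ofReal ?_)
    rw [div_le_iff₀ (by positivity)] at hr ⊢
    linarith
  have hprobr : IsProbabilityMeasure (runLaw r μ M α c) := by
    unfold runLaw
    infer_instance
  have := measureReal_ge_of_ae_compl_le (G := successEvent r R A h M α c γ δ) hF (by norm_num)
    hFle (ae_of_all _ fun p hp => Or.inl ?_)
  · linarith
  · have hp' : ¬ (errorCount R A h M α c p.1 p.2 : ℝ) < r * smallRate c / 2 := hp
    rw [not_lt] at hp'
    nlinarith

/-- With q = x·x, D = ‖Z‖², Y = x·Z and g = γk it suffices that √D < c³r/(44000αg). The two terms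
r²/m and r of the bound on D are controlled by `hmg` and `hrg`; 150 · 44000² · 2/10¹² is about 0.58
< 1. -/
theorem signedSum_dominates {m q D Y g r α c : ℝ} (hα : 0 < α) (hα1 : α < 1) (hc : 0 < c)
    (hg : 0 < g) (hr : 0 < r) (hm : 0 < m)
    (hrg : 10 ^ 12 * g ^ 2 ≤ c ^ 6 * r) (hmg : 10 ^ 12 * g ^ 2 ≤ c ^ 6 * m)
    (hq : γ * (m * q) ≤ 100 * g) (hD : D ≤ 150 * (r * (r / m + 1)))
    (hY : r * (c ^ 2 / (110 * α)) / 4 ≤ m * Y / c) : γ * q * √D < Y := by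
  have h1 : D < (c ^ 3 * r / (44000 * α * g)) ^ 2 := by
    refine lt_of_le_of_lt hD ?_
    rw [div_pow, lt_div_iff₀ (by positivity)]
    have h2 : g ^ 2 / m ≤ c ^ 6 / 10 ^ 12 := by
      rw [div_le_div_iff₀ hm (by norm_num)]
      linarith
    have hα2 : α ^ 2 ≤ 1 := by nlinarith
    have e : 150 * (r * (r / m + 1)) * (44000 * α * g) ^ 2 =
        290400000000 * (α ^ 2 * (r ^ 2 * (g ^ 2 / m) + r * g ^ 2)) := by
      field_simp
      ring
    rw [e]
    have h3 : r ^ 2 * (g ^ 2 / m) ≤ r ^ 2 * (c ^ 6 / 10 ^ 12) := by gcongr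
    have h4 : r * g ^ 2 ≤ r * (c ^ 6 * r / 10 ^ 12) := by
      refine mul_le_mul_of_nonneg_left ?_ hr.le
      linarith
    have h5 : α ^ 2 * (r ^ 2 * (g ^ 2 / m) + r * g ^ 2) ≤
        1 * (r ^ 2 * (c ^ 6 / 10 ^ 12) + r * (c ^ 6 * r / 10 ^ 12)) := by
      gcongr
    have h6 : 0 < c ^ 6 * r ^ 2 := by positivity
    calc 290400000000 * (α ^ 2 * (r ^ 2 * (g ^ 2 / m) + r * g ^ 2))
        ≤ 290400000000 * (1 * (r ^ 2 * (c ^ 6 / 10 ^ 12) + r * (c ^ 6 * r / 10 ^ 12))) := by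
          gcongr
      _ = 5808 / 10000 * (c ^ 6 * r ^ 2) := by ring
      _ < (c ^ 3 * r) ^ 2 := by nlinarith
  have h2 : √D < c ^ 3 * r / (44000 * α * g) := (Real.sqrt_lt' (by positivity)).2 h1
  have h3 : γ * (m * q) * √D < 100 * g * (c ^ 3 * r / (44000 * α * g)) := by
    refine lt_of_le_of_lt (mul_le_mul_of_nonneg_right hq (Real.sqrt_nonneg D)) ?_
    exact mul_lt_mul_of_pos_left h2 (by positivity)
  have e : 100 * g * (c ^ 3 * r / (44000 * α * g)) = c * (r * (c ^ 2 / (110 * α)) / 4) := by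
    field_simp
    norm_num
  have h4 : c * (r * (c ^ 2 / (110 * α)) / 4) ≤ m * Y := by
    have := mul_le_mul_of_nonneg_left hY hc.le
    rwa [mul_div_cancel₀ _ hc.ne'] at this
  rw [e] at h3
  have h5 : m * (γ * q * √D) < m * Y := by
    calc m * (γ * q * √D) = γ * (m * q) * √D := by ring
      _ < m * Y := h3.trans_le h4
  exact lt_of_mul_lt_mul_left h5 hm.le

/-- Two bad events of probability at most 1/50 are excluded: the correlation plus charged errors
falls below half its mean bound (`F₁`), or the signed sum is too long (`F₂`). -/
theorem successEvent_ge_of_large (hα : 0 < α) (hα1 : α < 1) (hc : 0 < c) (hc1 : c ≤ 1 / 10)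
    (hγ : 1 ≤ γ) (hh : h ∉ M) (hk : 0 < k) (hlarge : 320000 / c ^ 2 ≤ M.card * α ^ 2)
    (hgood : HasShortImitation A h M) (hδ : δ ≤ c ^ 2 / 8800)
    (hm : 10 ^ 12 * (γ * k) ^ 2 ≤ c ^ 6 * M.card) (hr : 10 ^ 12 * (γ * k) ^ 2 ≤ c ^ 6 * r) :
    24 / 25 ≤ (runLaw r μ M α c).real (successEvent r R A h M α c γ δ) := by
  have hprob := isProbabilityMeasure_signalLaw hα hc
  obtain ⟨x, hx, hA, horth, hq⟩ := hgood
  have hk1 : (1 : ℝ) ≤ k := by exact_mod_cast hk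
  have hg : 1 ≤ γ * k := one_le_mul_of_one_le_of_one_le hγ hk1
  have hm0 : (0 : ℝ) < M.card := by
    have : 0 < c ^ 6 * (M.card : ℝ) := lt_of_lt_of_le (by positivity) hm
    exact pos_of_mul_pos_right this (by positivity)
  have hM : 0 < M.card := by exact_mod_cast hm0
  have hr0 : (0 : ℝ) < r := by
    have : 0 < c ^ 6 * (r : ℝ) := lt_of_lt_of_le (by positivity) hr
    exact pos_of_mul_pos_right this (by positivity)
  have hrN : 0 < r := by exact_mod_cast hr0
  let f : (t : ℕ) → Ω → (Fin t → ℝ × (Fin n → ℝ)) → ℝ × (Fin n → ℝ) → ℝ := fun t ω past y =>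
    R.answer h M t ω past (A.mulVec (query h c y.1 y.2)) * (M.card * (x ⬝ᵥ y.2) / c) +
      20 / α * (errorSet A h α c (R.answer h M t ω past)).indicator (fun _ => 1) y
  let S : (t : ℕ) → Ω → (Fin t → ℝ × (Fin n → ℝ)) → ℝ × (Fin n → ℝ) → (Fin n → ℝ) :=
    fun t ω past y => R.answer h M t ω past (A.mulVec (query h c y.1 y.2)) • y.2
  have hxz := (continuous_dotProduct_left x).measurable
  have hf : ∀ t, Measurable fun p : Ω × (Fin t → ℝ × (Fin n → ℝ)) × (ℝ × (Fin n → ℝ)) =>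
      f t p.1 p.2.1 p.2.2 := fun t =>
    ((measurable_answer_query R A h M c t).mul (((hxz.comp (measurable_snd.comp
      (measurable_snd.comp measurable_snd))).const_mul _).div_const _)).add
      ((measurable_errorIndicator R A h M α c t).const_mul _)
  have hS : ∀ t, Measurable fun p : Ω × (Fin t → ℝ × (Fin n → ℝ)) × (ℝ × (Fin n → ℝ)) =>
      S t p.1 p.2.1 p.2.2 := fun t =>
    (measurable_answer_query R A h M c t).smul (measurable_snd.comp
      (measurable_snd.comp measurable_snd))
  have hdot : Measurable fun v : Fin n → ℝ => v ⬝ᵥ v := by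
    unfold dotProduct
    fun_prop
  set F₁ : Set (Ω × (Fin r → ℝ × (Fin n → ℝ))) :=
    {p | adaptiveSum (fun t => f t p.1) p.2 < r * (c ^ 2 / (110 * α)) / 2}
  set F₂ : Set (Ω × (Fin r → ℝ × (Fin n → ℝ))) :=
    {p | 150 * (r * (r / M.card + 1)) < adaptiveSum (fun t => S t p.1) p.2 ⬝ᵥ
      adaptiveSum (fun t => S t p.1) p.2}
  have hF₁ : MeasurableSet F₁ := measurableSet_lt (measurable_adaptiveSum hf r) measurable_const
  have hF₂ : MeasurableSet F₂ :=
    measurableSet_lt measurable_const (hdot.comp (measurable_adaptiveSum hS r))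
  have hF₁le : runLaw r μ M α c F₁ ≤ ENNReal.ofReal (1 / 50) := by
    refine prod_measure_le_of_forall hF₁ fun ω => ?_
    have hmo := fun t past => secondMoment_large (A := A) (h := h) (x := x) hα hc hM hx
      (measurable_answer_right R h M t ω past) (R.answer_eq h M t ω past)
    have key := measure_adaptiveSum_lt_le ((signalLaw α c).prod (noiseLaw M))
      (f := fun t => f t ω) (fun t => (hf t).comp (measurable_const.prodMk measurable_id))
      (μ₀ := c ^ 2 / (110 * α)) (by positivity) (V₀ := 2 * (M.card * x ⬝ᵥ x) / c ^ 2 + 800 / α ^ 2)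
      (fun t past => errorRate_large hα hα1 hc hc1 hh hM hx hA hlarge
        (measurable_answer_right R h M t ω past) (R.answer_eq h M t ω past))
      (fun t past => (hmo t past).1) (fun t past => (hmo t past).2) hrN
    refine key.trans (ENNReal.ofReal_le_ofReal ?_)
    rw [div_le_iff₀ (by positivity)]
    have h1 : 2 * (M.card * x ⬝ᵥ x) / c ^ 2 + 800 / α ^ 2 ≤
        2 * (100 * k) / c ^ 2 + 800 / α ^ 2 := by gcongr
    have hc2 : c ^ 2 ≤ 1 := by nlinarith
    have hα2 : α ^ 2 ≤ 1 := by nlinarith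
    have h2 : 2 * (100 * k) / c ^ 2 + 800 / α ^ 2 ≤ 1000 * k / (c ^ 2 * α ^ 2) := by
      rw [div_add_div _ _ (by positivity) (by positivity)]
      refine div_le_div_of_nonneg_right ?_ (by positivity)
      have h3 : (k : ℝ) * α ^ 2 ≤ k := mul_le_of_le_one_right (by positivity) hα2
      nlinarith
    have h4 : (k : ℝ) ≤ (γ * k) ^ 2 := by nlinarith
    have h5 : 4 * (1000 * k / (c ^ 2 * α ^ 2)) ≤ 1 / 50 * (r * (c ^ 2 / (110 * α)) ^ 2) := by
      rw [div_pow, mul_div_assoc', mul_div_assoc', mul_div_assoc', div_le_div_iff₀ (by positivity)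
        (by positivity)]
      have h6 : 10 ^ 12 * (k : ℝ) ≤ c ^ 6 * r := by linarith
      have h7 : 0 ≤ α ^ 2 * (c ^ 6 * r - 10 ^ 12 * k) :=
        mul_nonneg (by positivity) (by linarith)
      have h8 : 0 ≤ α ^ 2 * (k : ℝ) := by positivity
      nlinarith
    linarith
  have hF₂le : runLaw r μ M α c F₂ ≤ ENNReal.ofReal (1 / 50) := by
    refine prod_measure_le_of_forall hF₂ fun ω => ?_
    exact measure_signedSum_gt_le hα hc hM
      (f := fun t past y => R.answer h M t ω past (A.mulVec (query h c y.1 y.2)))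
      (fun t => (measurable_answer_query R A h M c t).comp
        (measurable_const.prodMk measurable_id)) (fun t past y => R.answer_eq h M t ω past _) hrN
  have hle : runLaw r μ M α c (F₁ ∪ F₂) ≤ ENNReal.ofReal (1 / 25) := by
    refine (measure_union_le _ _).trans ((add_le_add hF₁le hF₂le).trans (le_of_eq ?_))
    rw [← ENNReal.ofReal_add (by norm_num) (by norm_num)]
    norm_num
  have hprobr : IsProbabilityMeasure (runLaw r μ M α c) := by
    unfold runLaw
    infer_instance
  have hsub : ∀ᵐ p ∂(runLaw r μ M α c), p ∉ F₁ ∪ F₂ → p ∈ successEvent r R A h M α c γ δ := by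
    filter_upwards [ae_runLaw_eq_zero (r := r) (μ := μ) (M := M) hα hc] with p hp hpF
    rw [Set.mem_union, not_or] at hpF
    have h1 : r * (c ^ 2 / (110 * α)) / 2 ≤ adaptiveSum (fun t => f t p.1) p.2 := not_lt.1 hpF.1
    have h2 : adaptiveSum (fun t => S t p.1) p.2 ⬝ᵥ adaptiveSum (fun t => S t p.1) p.2 ≤
      150 * (r * (r / M.card + 1)) := not_lt.1 hpF.2
    by_cases herr : δ * r < (errorCount R A h M α c p.1 p.2 : ℝ)
    · exact Or.inl herr
    refine Or.inr ?_
    have hSM : ∀ i, i ∉ M → adaptiveSum (fun t => S t p.1) p.2 i = 0 := fun i hi => by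
      simp [adaptiveSum, S, Finset.sum_apply, hp _ i hi]
    change IsAdversarial A h M c γ ((l2norm (adaptiveSum (fun t => S t p.1) p.2))⁻¹ •
      adaptiveSum (fun t => S t p.1) p.2)
    refine isAdversarial_of_signedSum hc hM hx hA horth hSM ?_
    refine signedSum_dominates (m := M.card) (g := γ * k) hα hα1 hc (by positivity) hr0 hm0
      hr hm ?_ h2 ?_
    · nlinarith
    · have e : adaptiveSum (fun t => f t p.1) p.2 =
          M.card * (x ⬝ᵥ adaptiveSum (fun t => S t p.1) p.2) / c +
            20 / α * (errorCount R A h M α c p.1 p.2 : ℝ) := by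
        rw [errorCount_eq_adaptiveSum]
        simp only [adaptiveSum, f, S, dotProduct_sum, dotProduct_smul, smul_eq_mul,
          Finset.sum_add_distrib, Finset.mul_sum, Finset.sum_div]
        congr 1
        refine Finset.sum_congr rfl fun t _ => ?_
        ring
      have h3 : (errorCount R A h M α c p.1 p.2 : ℝ) ≤ c ^ 2 / 8800 * r :=
        (not_lt.1 herr).trans (by gcongr)
      -- With at most c²r/8800 errors the charge uses half of the guaranteed amount r c²/(220α); the
      -- other half must come from x·Z.
      have h4 : 20 / α * (errorCount R A h M α c p.1 p.2 : ℝ) ≤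
          20 / α * (c ^ 2 / 8800 * r) := by gcongr
      have e2 : 20 / α * (c ^ 2 / 8800 * r) = r * (c ^ 2 / (110 * α)) / 4 := by
        field_simp
        norm_num
      linarith
  have := measureReal_ge_of_ae_compl_le (hF₁.union hF₂) (by norm_num) hle hsub
  linarith

end Run

/-! ### Averaging over the signal index and the noise support -/

section Average

variable {n k : ℕ} {α c γ δ : ℝ} {A : Matrix (Fin k) (Fin n) ℝ}
  {Ω : Type*} [MeasurableSpace Ω] {μ : Measure Ω}
  {R : Responder k n Ω} {r m : ℕ}

/-- The constants fit because 49/50 · 24/25 > 9/10. -/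
theorem successProb_ge_of_hasShortImitation (hk : 0 < k) (hkm : 100 * k ≤ m + 1) (hmn : m < n)
    (hsucc : ∀ p ∈ choices n m, HasShortImitation A p.1 p.2 →
      24 / 25 ≤ (runLaw r μ p.2 α c).real (successEvent r R A p.1 p.2 α c γ δ)) :
    9 / 10 ≤ successProb r m μ R A α c γ δ := by
  classical
  have hN : (0 : ℝ) < (choices n m).card := by exact_mod_cast choices_card_pos hmn
  rw [successProb, le_div_iff₀ hN]
  set good := (choices n m).filter fun p => HasShortImitation A p.1 p.2
  set bad := (choices n m).filter fun p => ¬ HasShortImitation A p.1 p.2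
  have hsplit : (good.card : ℝ) + bad.card = (choices n m).card := by
    exact_mod_cast Finset.card_filter_add_card_filter_not (s := choices n m)
      (fun p => HasShortImitation A p.1 p.2)
  have hbad : 50 * (bad.card : ℝ) ≤ (choices n m).card := by
    exact_mod_cast card_choices_not_hasShortImitation_le A hk hkm
  have h1 : good.card • (24 / 25 : ℝ) ≤
      ∑ p ∈ good, (runLaw r μ p.2 α c).real (successEvent r R A p.1 p.2 α c γ δ) :=
    Finset.card_nsmul_le_sum _ _ _ fun p hp =>
      hsucc p (Finset.mem_of_mem_filter p hp) (Finset.mem_filter.1 hp).2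
  have h2 : ∑ p ∈ good, (runLaw r μ p.2 α c).real (successEvent r R A p.1 p.2 α c γ δ) ≤
      ∑ p ∈ choices n m, (runLaw r μ p.2 α c).real (successEvent r R A p.1 p.2 α c γ δ) :=
    Finset.sum_le_sum_of_subset_of_nonneg (Finset.filter_subset _ _) fun _ _ _ =>
      measureReal_nonneg
  rw [nsmul_eq_mul] at h1
  linarith

theorem successProb_ge [IsProbabilityMeasure μ] (hα : 0 < α) (hα1 : α < 1) (hc : 0 < c) (hc1 : c ≤ 1 / 10) (hγ : 1 ≤ γ)
    (hk : 2 ≤ k) (hm : (10 ^ 12 / c ^ 6 + 6400 * smallDev c ^ 6) * γ ^ 2 * (k : ℝ) ^ 2 ≤ m)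
    (hmn : m < n)
    (hr : (10 ^ 13 / c ^ 6 + 1000 / smallRate c ^ 2) * γ ^ 2 * (α ^ 2)⁻¹ * (k : ℝ) ^ 2 *
      Real.log k ^ 2 ≤ r)
    (hδ : δ ≤ c ^ 2 / 8800) (hδ' : δ ≤ smallRate c / 4) :
    9 / 10 ≤ successProb r m μ R A α c γ δ := by
  have hp0 := smallRate_pos hc
  have hD : 0 ≤ 6400 * smallDev c ^ 6 := by positivity
  have hk0 : 0 < k := by omega
  have hk2 : (2 : ℝ) ≤ k := by exact_mod_cast hk
  have hg : 1 ≤ γ ^ 2 * (k : ℝ) ^ 2 :=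
    one_le_mul_of_one_le_of_one_le (one_le_pow₀ hγ) (one_le_pow₀ (by linarith))
  have hkg : (k : ℝ) ^ 2 ≤ γ ^ 2 * (k : ℝ) ^ 2 :=
    le_mul_of_one_le_left (by positivity) (by nlinarith)
  have hlog : 48 / 100 ≤ Real.log k ^ 2 := by
    have h1 : Real.log 2 ≤ Real.log k := Real.log_le_log (by norm_num) hk2
    have h2 := Real.log_two_gt_d9
    nlinarith
  have hα2 : 1 ≤ (α ^ 2)⁻¹ := (one_le_inv₀ (by positivity)).2 (by nlinarith)
  have hc6 : 0 < c ^ 6 := by positivity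
  have hc6' : c ^ 6 ≤ 1 := pow_le_one₀ hc.le (by linarith)
  have hm' : 10 ^ 12 / c ^ 6 * (γ ^ 2 * (k : ℝ) ^ 2) +
      6400 * smallDev c ^ 6 * (γ ^ 2 * (k : ℝ) ^ 2) ≤ m := by linarith
  have hm1 : 10 ^ 12 / c ^ 6 * (γ ^ 2 * (k : ℝ) ^ 2) ≤ m := by
    have : 0 ≤ 6400 * smallDev c ^ 6 * (γ ^ 2 * (k : ℝ) ^ 2) := by positivity
    linarith
  have hm2 : 6400 * smallDev c ^ 6 ≤ m := by
    have h1 := le_mul_of_one_le_right hD hg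
    have : 0 ≤ 10 ^ 12 / c ^ 6 * (γ ^ 2 * (k : ℝ) ^ 2) := by positivity
    linarith
  have hm3 : 10 ^ 12 * (γ * k) ^ 2 ≤ c ^ 6 * m := by
    rw [div_mul_eq_mul_div, div_le_iff₀ hc6] at hm1
    rw [mul_pow]
    linarith
  have hm4 : 10 ^ 12 * (k : ℝ) ^ 2 ≤ m := by
    have h1 : (10 : ℝ) ^ 12 ≤ 10 ^ 12 / c ^ 6 := (le_div_iff₀ hc6).2 (by linarith)
    calc 10 ^ 12 * (k : ℝ) ^ 2 ≤ 10 ^ 12 / c ^ 6 * (γ ^ 2 * (k : ℝ) ^ 2) := by gcongr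
      _ ≤ (m : ℝ) := hm1
  have hr' : (10 ^ 13 / c ^ 6 + 1000 / smallRate c ^ 2) * (γ ^ 2 * (k : ℝ) ^ 2) * (48 / 100) ≤
      r := by
    refine le_trans ?_ hr
    have h1 : (10 ^ 13 / c ^ 6 + 1000 / smallRate c ^ 2) * (γ ^ 2 * (k : ℝ) ^ 2) * 1 *
        (48 / 100) ≤ (10 ^ 13 / c ^ 6 + 1000 / smallRate c ^ 2) * (γ ^ 2 * (k : ℝ) ^ 2) *
          (α ^ 2)⁻¹ * Real.log k ^ 2 := by gcongr
    calc _ = (10 ^ 13 / c ^ 6 + 1000 / smallRate c ^ 2) * (γ ^ 2 * (k : ℝ) ^ 2) * 1 *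
        (48 / 100) := by ring
      _ ≤ _ := h1
      _ = _ := by ring
  have hr1 : 10 ^ 12 * (γ * k) ^ 2 ≤ c ^ 6 * r := by
    have h1 : 10 ^ 12 / c ^ 6 * (γ ^ 2 * (k : ℝ) ^ 2) ≤ r := by
      have h2 : 0 ≤ 1000 / smallRate c ^ 2 * (γ ^ 2 * (k : ℝ) ^ 2) := by positivity
      have h3 : 0 ≤ 10 ^ 12 / c ^ 6 * (γ ^ 2 * (k : ℝ) ^ 2) := by positivity
      have e : 10 ^ 13 / c ^ 6 * (γ ^ 2 * (k : ℝ) ^ 2) =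
          10 * (10 ^ 12 / c ^ 6 * (γ ^ 2 * (k : ℝ) ^ 2)) := by ring
      linarith
    rw [div_mul_eq_mul_div, div_le_iff₀ hc6] at h1
    rw [mul_pow]
    linarith
  have hr2 : 200 / smallRate c ^ 2 ≤ r := by
    have h1 : 0 ≤ 10 ^ 13 / c ^ 6 * (γ ^ 2 * (k : ℝ) ^ 2) := by positivity
    have h2 : 1000 / smallRate c ^ 2 * 1 ≤ 1000 / smallRate c ^ 2 * (γ ^ 2 * (k : ℝ) ^ 2) := by
      gcongr
    have e : 1000 / smallRate c ^ 2 = 5 * (200 / smallRate c ^ 2) := by ring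
    have h3 : 0 ≤ 200 / smallRate c ^ 2 := by positivity
    linarith
  have hkm : 100 * k ≤ m + 1 := by
    have h1 : (100 * k : ℝ) ≤ m + 1 := by nlinarith
    exact_mod_cast h1
  refine successProb_ge_of_hasShortImitation hk0 hkm hmn fun p hp hgood => ?_
  obtain ⟨hh, hcard⟩ := (Finset.mem_filter.1 hp).2
  -- Below the threshold the fluctuation of the noise norm hides the gap from the responder; above
  -- it the norm is concentrated within the gap.
  rcases le_total (m * α ^ 2 : ℝ) (320000 / c ^ 2) with hcase | hcase
  · exact successEvent_ge_of_small hα hα1 hc hc1 hh hk0 (by rw [hcard]; nlinarith)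
      (by rw [hcard]; exact hm2) (by rw [hcard]; exact hcase) hδ' hr2
  · exact successEvent_ge_of_large hα hα1 hc hc1 hγ hh hk0 (by rw [hcard]; exact hcase) hgood hδ
      (by rw [hcard]; exact hm3) hr1

end Average

end SketchAttack

theorem mainTheorem1 :
    ∃ c₀ : ℝ, 0 < c₀ ∧ c₀ < 1 ∧ ∀ c : ℝ, 0 < c → c ≤ c₀ →
      ∃ (C K : ℝ) (δ : ℝ → ℝ), 0 < C ∧ 0 < K ∧ (∀ α : ℝ, 0 < α → α < 1 → 0 < δ α) ∧
        ∀ (k n m : ℕ) (A : Matrix (Fin k) (Fin n) ℝ) (γ α : ℝ),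
          2 ≤ k → 1 ≤ γ → 0 < α → α < 1 → K * γ ^ 2 * (k : ℝ) ^ 2 ≤ m → m < n →
          ∀ (Ω : Type*) [MeasurableSpace Ω] (μ : Measure Ω) [IsProbabilityMeasure μ]
            (R : SketchAttack.Responder k n Ω),
            9 / 10 ≤ SketchAttack.successProb
              ⌈C * γ ^ 2 * (α ^ 2)⁻¹ * (k : ℝ) ^ 2 * Real.log k ^ 2⌉₊ m μ R A α c γ (δ α) := by
  refine ⟨1 / 10, by norm_num, by norm_num, fun c hc hc1 => ?_⟩
  have hp0 := SketchAttack.smallRate_pos hc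
  have hD : 0 ≤ 6400 * SketchAttack.smallDev c ^ 6 := by positivity
  -- In `C` and `K` the first summand serves the regime of large m α² and the second that of small m
  -- α². The admissible error fraction turns out to be independent of α.
  refine ⟨10 ^ 13 / c ^ 6 + 1000 / SketchAttack.smallRate c ^ 2,
    10 ^ 12 / c ^ 6 + 6400 * SketchAttack.smallDev c ^ 6,
    fun _ => min (c ^ 2 / 8800) (SketchAttack.smallRate c / 4), by positivity, by positivity,
    fun α _ _ => by positivity, fun k n m A γ α hk hγ hα hα1 hm hmn Ω _ μ _ R => ?_⟩
  exact SketchAttack.successProb_ge hα hα1 hc hc1 hγ hk hm hmn (Nat.le_ceil _) (min_le_left _ _)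
    (min_le_right _ _)
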